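/- Let $A$ be a countable alphabet with a fixed enumeration, and let $A^{-\mathbb N}$ be the set of infinite pasts $\underline z=\ldots z_{-2}z_{-1}$. Let $P:A\times A^{-\mathbb N}\to[0,1]$ satisfy $\sum_{a\in A}P(a|\underline z)=1$ for every $\underline z$. Strings inside $P(a|\cdot)$ are written with the most recent symbols first, and $\inf_{\underline z}$ runs over all pasts. Put $\alpha(a)=\inf_{\underline z}P(a|\underline z)$, assume that $\mathcal E=\{a\in A:\alpha(a)>0\}$ is not empty, and let $w$ be a finite string of symbols of $\mathcal E$. For a finite string $v$ let $m^w(v)$ be the distance from the present back to the most recent occurrence of $w$ in $v$ ($+\infty$ if there is none). Put $$\alpha_{-1}=\sum_{a\in A}\alpha(a),\qquad \alpha_k=\inf_{b}\ \inf_{c\in A^k}\ \sum_{a\in A}\inf_{\underline z}P(a|b\,w\,c\,\underline z)\quad(k\ge0),$$ where $b$ runs over the finite strings such that the most recent occurrence of $w$ in the string $b\,w$ (most recent symbols first) is the displayed one. Assume that $\sum_{k\ge0}(1-\alpha_k)<\infty$. *Update function.* Glue from $0$ on, in the order of the enumeration, half-open intervals $I(a)$ of lengths $\alpha(a)$, $a\in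 A$. For a finite string $v$ with $m^w(v)<\infty$ let $\alpha(a,v,k)=\inf_{\underline z}P(a|v^{(k)}\underline z)$, where $v^{(k)}$ consists of the $m^w(v)+|w|+k$ most recent symbols of $v$, put $\alpha(a,v,-1)=\alpha(a)$, and continue the gluing with intervals $I(a,v,k)$ of lengths $\alpha(a,v,k)-\alpha(a,v,k-1)$, $a\in A$, for $k=0,1,2,\ldots$ successively. For $u\in[0,1[$ put $F(u,v)=a$ if $u\in I(a)$, and also if $u\in[\alpha_{l-1},\alpha_l[$ for some $l\ge0$ with $m^w(v)+|w|+l\le|v|$ and $u\in\bigcup_{k=0}^{l}I(a,v,k)$; put $F(u,v)=\star$ otherwise. *Algorithm 1.* Let ${\bf U}=(U_i)_{i\in\mathbb Z}$ be i.i.d. and uniform on $[0,1[$. On input $m\le n$ in $\mathbb Z$, start with $B=\{m,\ldots,n\}$, the set of sites still to be constructed. (Forward part) For $i=m,m+1,\ldots$, as long as $B\ne\emptyset$ and $F(U_i,X_m^{i-1})\in A$, put $X_i=F(U_i,X_m^{i-1})$ and remove $i$ from $B$. Then put $i=m$. (Backward part) While $B\neq\emptyset$: replace $i$ by $i-1$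 and add it to $B$; while $U_i\in[\alpha_{-1},1[$, replace $i$ by $i-1$ and add it to $B$; put $X_i=F(U_i,\emptyset)$ and remove $i$ from $B$; then, as long as $B\ne\emptyset$ and, for $t=\min B$, $F(U_t,X_i^{t-1})\in A$, put $X_t=F(U_t,X_i^{t-1})$ and remove $t$ from $B$. When $B=\emptyset$, stop and return $\theta[m,n]=i$ and $(X_{\theta[m,n]},\ldots,X_n)$. A stationary chain on $A$ with law $\mu$ is compatible with $P$ if, for every $a\in A$, $\mu(X_0=a|X_{-\infty}^{-1})=P(a|X_{-\infty}^{-1})$ $\mu$-almost surely. Then there is a measurable function ${\bf U}\mapsto X({\bf U})\in A^{\mathbb Z}$ such that: 1. the law of $X({\bf U})$ is the law of a stationary chain compatible with $P$, and it is the only such law; 2. for all integers $m\le n$, almost surely Algorithm 1 stops after finitely many steps, and its output is a time $\theta[m,n]\le m$ together with $([X({\bf U})]_{\theta[m,n]},\ldots,[X({\bf U})]_n)$. Thus the output is a sample of the unique stationary chain compatible with $P$; 3. there are random times $T_i=T_i({\bf U})\in\mathbb Z$, $i\in\mathbb Z$ (measurable functions of ${\bf U}$), with almost surely $T_i<T_{i+1}$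 for all $i$ and $T_0\le0<T_1$, such that the random strings $([X({\bf U})]_{T_i},\ldots,[X({\bf U})]_{T_{i+1}-1})$, $i\neq0$, are i.i.d. and have finite expected length. -/

import Mathlib

open MeasureTheory ProbabilityTheory

namespace InfiniteMemory

/-! Strings and pasts are written with the most recent symbol first: the infinite past
`… z₋₂ z₋₁` is the function `z : ℕ → A` with `z n = z₋₍ₙ₊₁₎`, and the finite string
`a₋ₘ … a₋₁` is the list `[a₋₁, …, a₋ₘ]`. -/

variable {A : Type*}

/-- The infinite past whose most recent symbols are those of `s`, preceded by the past `z`. -/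
def concat (s : List A) (z : ℕ → A) : ℕ → A := fun n => s.getD n (z (n - s.length))

/-- `P a z = P(a | z)` is a transition probability kernel on `A`. -/
structure IsKernel (P : A → (ℕ → A) → ℝ) : Prop where
  nonneg : ∀ a z, 0 ≤ P a z
  hasSum_one : ∀ z, HasSum (fun a => P a z) 1

/-- `inf_z P(a | s z)`, the infimum over all pasts whose most recent symbols are those of `s`. -/
noncomputable def lowerProb (P : A → (ℕ → A) → ℝ) (a : A) (s : List A) : ℝ :=
  ⨅ z : ℕ → A, P a (concat s z)

/-- The symbols `a` with `inf_z P(a | z) > 0`. -/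
def spontaneousSymbols (P : A → (ℕ → A) → ℝ) : Set A := {a | 0 < lowerProb P a []}

/-- The distance `m^w(v)` to the most recent occurrence of `w` in `v`, and `⊤` if there is none. -/
noncomputable def distOcc (w v : List A) : ℕ∞ :=
  sInf ((fun k : ℕ => (k : ℕ∞)) '' {k : ℕ | w <+: v.drop k})

/-- `α^w_k`: the infimum of `∑_a inf_z P(a | b w c z)` over all finite strings `b` such that in
`b w` (most recent symbol first) the most recent occurrence of `w` is the displayed one, and over
all strings `c` of length `k`. -/
noncomputable def alphaW (P : A → (ℕ → A) → ℝ) (w : List A) (k : ℕ) : ℝ :=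
  sInf {x : ℝ | ∃ b c : List A, distOcc w (b ++ w) = (b.length : ℕ∞) ∧ c.length = k ∧
    x = ∑' a, lowerProb P a (b ++ w ++ c)}

/-- The thresholds, with the index shifted by one: `threshold P w 0 = α₋₁ = ∑_a inf_z P(a | z)`
and `threshold P w (k + 1) = α^w_k`. -/
noncomputable def threshold (P : A → (ℕ → A) → ℝ) (w : List A) : ℕ → ℝ
  | 0 => ∑' a, lowerProb P a []
  | k + 1 => alphaW P w k

/-- `α^w(a, v, k)`, again with the index shifted by one:
`alphaAt P w v 0 a = inf_z P(a | z)`, and `alphaAt P w v (k + 1) a` is `inf_z P(a | s z)`, where `s`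
is the part of `v` that reaches `k` symbols beyond the most recent occurrence of `w`. -/
noncomputable def alphaAt (P : A → (ℕ → A) → ℝ) (w v : List A) : ℕ → A → ℝ
  | 0, a => lowerProb P a []
  | k + 1, a => lowerProb P a (v.take ((distOcc w v).toNat + w.length + k))

/-- Starting at the point `base`, glue half-open intervals of lengths `f a`, `a ∈ A`, one after the
other in the order of the enumeration `e`; this is the interval that belongs to `a`. -/
noncomputable def glued (e : A ↪ ℕ) (base : ℝ) (f : A → ℝ) (a : A) : Set ℝ :=
  Set.Ico (base + ∑' b, if e b < e a then f b else 0)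
    (base + (∑' b, if e b < e a then f b else 0) + f a)

/-- The interval `I(a)`. -/
noncomputable def intervalI (e : A ↪ ℕ) (P : A → (ℕ → A) → ℝ) (a : A) : Set ℝ :=
  glued e 0 (fun b => lowerProb P b []) a

/-- The interval `I^w(a, v, k)`: the `k`-th layer is glued to the right of the preceding ones,
which together have length `∑_b α^w(b, v, k - 1)`. -/
noncomputable def intervalIw (e : A ↪ ℕ) (P : A → (ℕ → A) → ℝ) (w v : List A) (a : A) (k : ℕ) :
    Set ℝ :=
  glued e (∑' b, alphaAt P w v k b) (fun b => alphaAt P w v (k + 1) b - alphaAt P w v k b) a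

/-- The uniform variable `u` and the known part `v` of the past determine the present symbol, and
it is `a`: either `u ∈ I(a)`, or `u ∈ [α_{l-1}, α_l[` for some `l ≥ 0`, the string `v` is long
enough to contain its context in the `l`-th context tree, and `u ∈ ⋃_{k ≤ l} I^w(a, v, k)`. -/
def Determines (e : A ↪ ℕ) (P : A → (ℕ → A) → ℝ) (w : List A) (u : ℝ) (v : List A) (a : A) :
    Prop :=
  u ∈ intervalI e P a ∨
    ∃ l : ℕ, u ∈ Set.Ico (threshold P w l) (threshold P w (l + 1)) ∧
      distOcc w v + (w.length : ℕ∞) + (l : ℕ∞) ≤ (v.length : ℕ∞) ∧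
      ∃ k ≤ l, u ∈ intervalIw e P w v a k

open Classical in
/-- The update function `F`, with `none` in the role of the symbol `⋆`. -/
noncomputable def update (e : A ↪ ℕ) (P : A → (ℕ → A) → ℝ) (w : List A) (u : ℝ) (v : List A) :
    Option A :=
  if h : ∃ a, Determines e P w u v a then some h.choose else none

/-! ### The perfect simulation algorithm -/

/-- The control points of the algorithm: its four `while` loops and the final `return`. -/
inductive Loc
  | forward
  | outer
  | search
  | fill
  | halted

/-- The variables of the algorithm. -/
structure State (A : Type*) where
  loc : Loc
  i : ℤ
  t : ℤ
  B : Finset ℤ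
  X : ℤ → Option A
  theta : ℤ

/-- The string `X_i … X_{t-1}` (most recent symbol first). -/
def segment (X : ℤ → Option A) (i t : ℤ) : List A :=
  (List.range (t - i).toNat).filterMap fun j => X (t - 1 - (j : ℤ))

/-- The initial assignments of the algorithm on the window `[m, n]`. -/
noncomputable def initState (A : Type*) (m n : ℤ) : State A where
  loc := Loc.forward
  i := m
  t := m
  B := Finset.Icc m n
  X := fun _ => none
  theta := m

/-- `min B` (only used when `B` is not empty). -/
def minB (B : Finset ℤ) : ℤ := B.min.untopD 0

open Classical in
/-- One step of the algorithm with input `m`: one test of the loop condition at the current control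
point, followed by the corresponding assignments. `U i` is the uniform variable sampled for the
site `i`. -/
noncomputable def step (e : A ↪ ℕ) (P : A → (ℕ → A) → ℝ) (w : List A) (U : ℤ → ℝ) (m : ℤ)
    (s : State A) : State A :=
  match s.loc with
  | Loc.forward =>
      if update e P w (U s.i) (segment s.X m s.i) ≠ none ∧ s.B.Nonempty then
        { s with
          X := Function.update s.X s.i (update e P w (U s.i) (segment s.X m s.i))
          B := s.B.erase s.i
          i := s.i + 1 }
      else { s with loc := Loc.outer, i := m }
  | Loc.outer =>
      if s.B.Nonempty then
        { s with loc := Loc.search, i := s.i - 1, B := insert (s.i - 1) s.B }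
      else { s with loc := Loc.halted, theta := s.i }
  | Loc.search =>
      if U s.i ∈ Set.Ico (threshold P w 0) 1 then
        { s with i := s.i - 1, B := insert (s.i - 1) s.B }
      else
        { s with
          loc := Loc.fill
          X := Function.update s.X s.i (update e P w (U s.i) [])
          B := s.B.erase s.i
          t := minB (s.B.erase s.i) }
  | Loc.fill =>
      if update e P w (U s.t) (segment s.X s.i s.t) ≠ none ∧ s.B.Nonempty then
        { s with
          X := Function.update s.X s.t (update e P w (U s.t) (segment s.X s.i s.t))
          B := s.B.erase s.t
          t := minB (s.B.erase s.t) }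
      else { s with loc := Loc.outer }
  | Loc.halted => s

/-- On the window `[m, n]` and with the uniform variables `U`, the algorithm stops after finitely
many steps and returns the time `θ` and the string `x_θ … x_n`. -/
def Outputs (e : A ↪ ℕ) (P : A → (ℕ → A) → ℝ) (w : List A) (U : ℤ → ℝ) (m n : ℤ)
    (θ : ℤ) (x : ℤ → A) : Prop :=
  ∃ N : ℕ, ((step e P w U m)^[N] (initState A m n)).loc = Loc.halted ∧
    ((step e P w U m)^[N] (initState A m n)).theta = θ ∧
    ∀ j ∈ Set.Icc θ n, ((step e P w U m)^[N] (initState A m n)).X j = some (x j)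

/-! ### The probabilistic side -/

/-- The uniform distribution on `[0, 1[`. -/
noncomputable def unif : Measure ℝ := volume.restrict (Set.Ico 0 1)

instance : IsProbabilityMeasure unif := ⟨by simp [unif]⟩

/-- The law of a family `(U_i)`, `i ∈ ℤ`, of independent variables that are uniform on `[0, 1[`. -/
noncomputable def lawU : Measure (ℤ → ℝ) := Measure.infinitePi fun _ : ℤ => unif

/-- The past of time `0`, as an element of `A^{-ℕ}`. -/
def pastOf (x : ℤ → A) : ℕ → A := fun n => x (-((n : ℤ) + 1))

/-- `μ` is the law of a stationary chain on `A` that is compatible with `P`: for every `a`, a version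
of the conditional probability of `X₀ = a` given the past of time `0` is `P(a | past)`. -/
structure IsStationaryCompatible [MeasurableSpace A] (P : A → (ℕ → A) → ℝ) (μ : Measure (ℤ → A)) :
    Prop where
  isProbabilityMeasure : IsProbabilityMeasure μ
  stationary : MeasurePreserving (fun (x : ℤ → A) (n : ℤ) => x (n + 1)) μ μ
  compatible : ∀ a : A,
    μ[Set.indicator {x : ℤ → A | x 0 = a} (fun _ => (1 : ℝ)) |
      MeasurableSpace.comap (pastOf (A := A)) MeasurableSpace.pi] =ᵐ[μ] fun x => P a (pastOf x)

/-- The string `x_s … x_{t-1}` (in the order of time). -/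
def block (x : ℤ → A) (s t : ℤ) : List A :=
  (List.range (t - s).toNat).map fun j => x (s + (j : ℤ))

/-- The discrete σ-algebra on the set of finite strings. -/
instance : MeasurableSpace (List A) := ⊤

end InfiniteMemory

namespace InfiniteMemory

open scoped ENNReal

/-! ### Lower probabilities, gluing and the update function -/

section Basics

variable {A : Type*} {e : A ↪ ℕ} {P : A → (ℕ → A) → ℝ} {w : List A}

/-! ### Lower probabilities -/

/-! The proof rests on a monotonicity: if a uniform variable and a finite known past determine a
symbol, every longer known past determines the same symbol (`Determines.append`). Hence a
construction started earlier agrees with one started later as soon as it gets that far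
(`run_append`), and `chain` can be defined site by site. Call `s` a regeneration if the construction
started at `s` with nothing known never gets stuck. This event depends only on the `U i` with `i ≥
s`.

Regenerations exist. With positive probability the first sites spontaneously spell `K` symbols
followed by `w`. Far beyond them, a site in the `n`-th window can be stuck only if its variable is
at least `α_n`, or if no spontaneous copy of `w` starts in a stretch of order `n` before it. These
probabilities are summable, the first by hypothesis, the second as a geometric series, so a union
bound leaves positive probability (`lawU_isRegeneration_pos`). The zero-one law gives regenerations
arbitrarily far to the right, stationarity gives them to the left (`ae_isTypical`). The algorithm
fills in symbols of `chain` only, and it cannot go below a regeneration smaller than `m`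
(`IsTypical.outputs`).

For a past containing `w` the layers have the right lengths, so the uniform variables producing `a`
have measure exactly `P a z` (`unif_hitSet`). The past of the chain is independent of `U 0`, which
gives compatibility. Conversely, a stationary compatible law charges only pasts containing `w`
(`ae_hasWord`), so it is preserved by updating with fresh uniform variables. Run from its past, this
update agrees with `chain` after the first regeneration, and uniqueness follows (`map_pastOf_eq`).

For the blocks, "the next regeneration after `s` is `s + L`" becomes, given a regeneration at `s +
L`, an event about the sites from `s` to `s + L - 1` only (`mem_cycle_iff`). Probabilities of
successive blocks therefore factor (`lawU_window`). Summing over the position of the block around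
the origin gives probability one, which is the finiteness of the mean length (`tsum_cycle_mul`). -/

lemma concat_append (s t : List A) (z : ℕ → A) : concat (s ++ t) z = concat s (concat t z) := by
  ext n
  simp only [concat]
  rcases lt_or_ge n s.length with h | h
  · rw [List.getD_append _ _ _ _ h, List.getD_eq_getElem _ _ h, List.getD_eq_getElem _ _ h]
  · rw [List.getD_append_right _ _ _ _ h, List.getD_eq_default _ _ h, List.length_append,
      Nat.sub_add_eq]

lemma bddBelow_range_concat (hP : IsKernel P) (a : A) (s : List A) :
    BddBelow (Set.range fun z => P a (concat s z)) :=
  ⟨0, by rintro _ ⟨z, rfl⟩; exact hP.nonneg _ _⟩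

lemma lowerProb_nonneg (hP : IsKernel P) (a : A) (s : List A) : 0 ≤ lowerProb P a s :=
  Real.iInf_nonneg fun _ => hP.nonneg _ _

lemma lowerProb_le (hP : IsKernel P) (a : A) (s : List A) (z : ℕ → A) :
    lowerProb P a s ≤ P a (concat s z) :=
  ciInf_le (bddBelow_range_concat hP a s) z

lemma lowerProb_le_append [Nonempty A] (hP : IsKernel P) (a : A) (s t : List A) :
    lowerProb P a s ≤ lowerProb P a (s ++ t) :=
  le_ciInf fun z => by rw [concat_append]; exact lowerProb_le hP _ _ _

lemma lowerProb_le_of_isPrefix [Nonempty A] (hP : IsKernel P) (a : A) {s t : List A}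
    (h : s <+: t) : lowerProb P a s ≤ lowerProb P a t := by
  obtain ⟨r, rfl⟩ := h
  exact lowerProb_le_append hP _ _ _

lemma summable_lowerProb [Nonempty A] (hP : IsKernel P) (s : List A) :
    Summable fun a => lowerProb P a s :=
  Summable.of_nonneg_of_le (fun a => lowerProb_nonneg hP a s)
    (fun a => lowerProb_le hP a s (Classical.arbitrary _)) (hP.hasSum_one _).summable

lemma tsum_lowerProb_le_one [Nonempty A] (hP : IsKernel P) (s : List A) :
    ∑' a, lowerProb P a s ≤ 1 := by
  rw [← (hP.hasSum_one (concat s (Classical.arbitrary _))).tsum_eq]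
  exact (summable_lowerProb hP s).tsum_le_tsum (fun a => lowerProb_le hP a s _)
    (hP.hasSum_one _).summable

lemma tsum_lowerProb_nonneg (hP : IsKernel P) (s : List A) : 0 ≤ ∑' a, lowerProb P a s :=
  tsum_nonneg fun _ => lowerProb_nonneg hP _ _

lemma tsum_lowerProb_le_of_isPrefix [Nonempty A] (hP : IsKernel P) {s t : List A}
    (h : s <+: t) : ∑' a, lowerProb P a s ≤ ∑' a, lowerProb P a t :=
  (summable_lowerProb hP s).tsum_le_tsum (fun a => lowerProb_le_of_isPrefix hP a h)
    (summable_lowerProb hP t)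

/-! ### Occurrences of the word -/

lemma distOcc_le_of_isPrefix {v : List A} {k : ℕ} (h : w <+: v.drop k) : distOcc w v ≤ k :=
  sInf_le ⟨k, h, rfl⟩

lemma exists_of_distOcc_eq {v : List A} {m : ℕ} (h : distOcc w v = m) :
    w <+: v.drop m ∧ ∀ k < m, ¬ w <+: v.drop k := by
  have hne : ((fun k : ℕ => (k : ℕ∞)) '' {k : ℕ | w <+: v.drop k}).Nonempty := by
    by_contra hc
    rw [Set.not_nonempty_iff_eq_empty] at hc
    rw [distOcc, hc, sInf_empty] at h
    exact absurd h (ENat.natCast_ne_top m).symm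
  obtain ⟨k, hk, hkm⟩ := csInf_mem hne
  have : k = m := by
    have h' : ((k : ℕ) : ℕ∞) = m := hkm.trans h
    exact_mod_cast h'
  subst this
  refine ⟨hk, fun j hj hjw => ?_⟩
  have := distOcc_le_of_isPrefix hjw
  rw [h] at this
  have : k ≤ j := by exact_mod_cast this
  omega

lemma distOcc_eq_of {v : List A} {m : ℕ} (h : w <+: v.drop m)
    (h' : ∀ k < m, ¬ w <+: v.drop k) : distOcc w v = m := by
  refine le_antisymm (distOcc_le_of_isPrefix h) (le_sInf ?_)
  rintro _ ⟨k, hk, rfl⟩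
  by_contra hlt
  push Not at hlt
  exact h' k (by exact_mod_cast hlt) hk

/-- The hypothesis places the whole occurrence inside `v`. Any nearer one would also lie inside `v`,
so older symbols cannot create it. -/
lemma distOcc_append {v : List A} {m : ℕ} (h : distOcc w v = m) (hm : m + w.length ≤ v.length)
    (t : List A) : distOcc w (v ++ t) = m := by
  obtain ⟨h1, h2⟩ := exists_of_distOcc_eq h
  refine distOcc_eq_of ?_ fun k hk hw => h2 k hk ?_
  · rw [List.drop_append_of_le_length (by omega)]
    exact h1.trans (List.prefix_append _ _)
  · rw [List.drop_append_of_le_length (by omega)] at hw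
    exact List.prefix_of_prefix_length_le hw (List.prefix_append _ _) (by simp; omega)

/-- Brings a context to the form `b w c` over which the infimum in `alphaW` runs. -/
lemma exists_split_of_distOcc {v : List A} {m k : ℕ} (h : distOcc w v = m)
    (hk : m + w.length + k ≤ v.length) :
    ∃ b c : List A, distOcc w (b ++ w) = (b.length : ℕ∞) ∧ c.length = k ∧
      v.take (m + w.length + k) = b ++ w ++ c := by
  obtain ⟨⟨r, hr⟩, h2⟩ := exists_of_distOcc_eq h
  have hv : v = v.take m ++ (w ++ r) := by rw [hr, List.take_append_drop]
  have hlm : (v.take m).length = m := by simp; omega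
  refine ⟨v.take m, r.take k, ?_, ?_, ?_⟩
  · rw [hlm]
    refine distOcc_eq_of ?_ fun j hj hw => h2 j hj ?_
    · rw [List.drop_left' hlm]
    · rw [hv, ← List.append_assoc, List.drop_append_of_le_length (by simp; omega)]
      exact hw.trans (List.prefix_append _ _)
  · have := congrArg List.length hv
    simp at this ⊢
    omega
  · generalize v.take m = b at hlm hv
    subst hlm hv
    rw [add_assoc, List.take_length_add_append, List.append_assoc, List.take_length_add_append]

/-! ### Thresholds -/

lemma alphaW_set_bddBelow (hP : IsKernel P) (k : ℕ) :
    BddBelow {x : ℝ | ∃ b c : List A, distOcc w (b ++ w) = (b.length : ℕ∞) ∧ c.length = k ∧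
      x = ∑' a, lowerProb P a (b ++ w ++ c)} :=
  ⟨0, by rintro _ ⟨b, c, -, -, rfl⟩; exact tsum_lowerProb_nonneg hP _⟩

lemma alphaW_set_nonempty [Nonempty A] (k : ℕ) :
    {x : ℝ | ∃ b c : List A, distOcc w (b ++ w) = (b.length : ℕ∞) ∧ c.length = k ∧
      x = ∑' a, lowerProb P a (b ++ w ++ c)}.Nonempty := by
  refine ⟨_, [], List.replicate k (Classical.arbitrary A), ?_, by simp, rfl⟩
  exact distOcc_eq_of (m := 0) (by simp) (by simp)

lemma alphaW_le (hP : IsKernel P) {v : List A} {m k : ℕ} (h : distOcc w v = m)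
    (hk : m + w.length + k ≤ v.length) :
    alphaW P w k ≤ ∑' a, lowerProb P a (v.take (m + w.length + k)) := by
  obtain ⟨b, c, hb, hc, hv⟩ := exists_split_of_distOcc h hk
  exact csInf_le (alphaW_set_bddBelow hP k) ⟨b, c, hb, hc, by rw [hv]⟩

lemma alphaW_le_one [Nonempty A] (hP : IsKernel P) (k : ℕ) : alphaW P w k ≤ 1 := by
  obtain ⟨x, hx⟩ := alphaW_set_nonempty (P := P) (w := w) k
  refine (csInf_le (alphaW_set_bddBelow hP k) hx).trans ?_
  obtain ⟨b, c, -, -, rfl⟩ := hx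
  exact tsum_lowerProb_le_one hP _

lemma alphaW_le_succ [Nonempty A] (hP : IsKernel P) (k : ℕ) :
    alphaW P w k ≤ alphaW P w (k + 1) := by
  refine le_csInf (alphaW_set_nonempty _) ?_
  rintro _ ⟨b, c, hb, hc, rfl⟩
  refine (csInf_le (alphaW_set_bddBelow hP k) ⟨b, c.take k, hb, by simp [hc], rfl⟩).trans ?_
  exact tsum_lowerProb_le_of_isPrefix hP ((List.prefix_append_right_inj _).2
    ⟨_, List.take_append_drop _ _⟩)

lemma threshold_monotone [Nonempty A] (hP : IsKernel P) : Monotone (threshold P w) := by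
  refine monotone_nat_of_le_succ fun k => ?_
  cases k with
  | zero =>
    refine le_csInf (alphaW_set_nonempty _) ?_
    rintro _ ⟨b, c, hb, hc, rfl⟩
    exact tsum_lowerProb_le_of_isPrefix hP ⟨_, rfl⟩
  | succ k => exact alphaW_le_succ hP k

lemma threshold_le_one [Nonempty A] (hP : IsKernel P) (k : ℕ) : threshold P w k ≤ 1 := by
  cases k with
  | zero => exact tsum_lowerProb_le_one hP _
  | succ k => exact alphaW_le_one hP k

lemma tendsto_alphaW (hsum : Summable fun k : ℕ => 1 - alphaW P w k) :
    Filter.Tendsto (alphaW P w) Filter.atTop (nhds 1) := by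
  simpa using (tendsto_const_nhds (x := (1 : ℝ))).sub hsum.tendsto_atTop_zero

lemma exists_mem_Ico_threshold (hsum : Summable fun k : ℕ => 1 - alphaW P w k) {u : ℝ}
    (h0 : threshold P w 0 ≤ u) (h1 : u < 1) :
    ∃ l, u ∈ Set.Ico (threshold P w l) (threshold P w (l + 1)) := by
  have hex : ∃ l, u < threshold P w (l + 1) :=
    ((tendsto_alphaW hsum).eventually (lt_mem_nhds h1)).exists
  classical
  refine ⟨Nat.find hex, ?_, Nat.find_spec hex⟩
  rcases h : Nat.find hex with _ | l
  · exact h0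
  · exact not_lt.1 (Nat.find_min hex (m := l) (by omega))

/-! ### Gluing -/

/-- The total length of the intervals glued before those of rank `n`. -/
noncomputable def gluedBefore (e : A ↪ ℕ) (f : A → ℝ) (n : ℕ) : ℝ :=
  ∑' b, if e b < n then f b else 0

lemma summable_ite {f : A → ℝ} (hf : Summable f) (h0 : ∀ a, 0 ≤ f a) (p : A → Prop)
    [DecidablePred p] : Summable fun b => if p b then f b else 0 :=
  Summable.of_nonneg_of_le (fun b => by split_ifs; exacts [h0 b, le_rfl])
    (fun b => by split_ifs; exacts [le_rfl, h0 b]) hf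

lemma gluedBefore_nonneg {f : A → ℝ} (h0 : ∀ a, 0 ≤ f a) (n : ℕ) : 0 ≤ gluedBefore e f n :=
  tsum_nonneg fun b => by split_ifs; exacts [h0 b, le_rfl]

lemma gluedBefore_succ {f : A → ℝ} (hf : Summable f) (h0 : ∀ a, 0 ≤ f a) {a : A} {n : ℕ}
    (h : e a = n) : gluedBefore e f (n + 1) = gluedBefore e f n + f a := by
  classical
  have h1 : (∑' b, if b = a then f a else 0) = f a := tsum_ite_eq a _
  have h2 : Summable fun b => if b = a then f a else 0 := (hasSum_ite_eq a (f a)).summable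
  rw [gluedBefore, gluedBefore, ← h1, ← (summable_ite hf h0 _).tsum_add h2]
  refine tsum_congr fun b => ?_
  by_cases hb : b = a
  · subst hb; simp [h]
  · have : e b ≠ n := fun hh => hb (e.injective (hh.trans h.symm))
    by_cases hn : e b < n
    · simp [hb, hn, Nat.lt_succ_of_lt hn]
    · have : ¬ e b < n + 1 := by omega
      simp [hb, hn, this]

lemma gluedBefore_mono {f : A → ℝ} (hf : Summable f) (h0 : ∀ a, 0 ≤ f a) :
    Monotone (gluedBefore e f) := fun m n hmn =>
  (summable_ite hf h0 _).tsum_le_tsum (fun b => by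
    by_cases h : e b < m
    · simp [h, h.trans_le hmn]
    · simp only [h, if_false]; split_ifs; exacts [h0 b, le_rfl]) (summable_ite hf h0 _)

lemma gluedBefore_le {f : A → ℝ} (hf : Summable f) (h0 : ∀ a, 0 ≤ f a) (n : ℕ) :
    gluedBefore e f n ≤ ∑' b, f b :=
  (summable_ite hf h0 _).tsum_le_tsum (fun b => by split_ifs; exacts [le_rfl, h0 b]) hf

/-- With ranks in `ℕ` as index, the intervals are the gaps of a single monotone sequence, which
yields disjointness and covering at once. -/
lemma glued_eq (base : ℝ) {f : A → ℝ} (hf : Summable f) (h0 : ∀ a, 0 ≤ f a) (a : A) :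
    glued e base f a =
      Set.Ico (base + gluedBefore e f (e a)) (base + gluedBefore e f (e a + 1)) := by
  rw [gluedBefore_succ hf h0 rfl, ← add_assoc]; rfl

lemma glued_subset (base : ℝ) {f : A → ℝ} (hf : Summable f) (h0 : ∀ a, 0 ≤ f a) (a : A) :
    glued e base f a ⊆ Set.Ico base (base + ∑' b, f b) := by
  rw [glued_eq base hf h0]
  refine Set.Ico_subset_Ico ?_ ?_
  · linarith [gluedBefore_nonneg (e := e) h0 (e a)]
  · linarith [gluedBefore_le (e := e) hf h0 (e a + 1)]

lemma glued_injective {base : ℝ} {f : A → ℝ} (hf : Summable f) (h0 : ∀ a, 0 ≤ f a) {a b : A}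
    {u : ℝ} (ha : u ∈ glued e base f a) (hb : u ∈ glued e base f b) : a = b := by
  rw [glued_eq base hf h0] at ha hb
  have key : ∀ {a b : A}, e a < e b →
      u ∈ Set.Ico (base + gluedBefore e f (e a)) (base + gluedBefore e f (e a + 1)) →
      u ∈ Set.Ico (base + gluedBefore e f (e b)) (base + gluedBefore e f (e b + 1)) → False := by
    intro a b hab ha hb
    have := gluedBefore_mono (e := e) hf h0 (Nat.succ_le_of_lt hab)
    have h1 := ha.2
    have h2 := hb.1
    simp only [Nat.succ_eq_add_one] at this
    linarith
  rcases lt_trichotomy (e a) (e b) with h | h | h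
  · exact (key h ha hb).elim
  · exact e.injective h
  · exact (key h hb ha).elim

lemma exists_mem_glued {base : ℝ} {f : A → ℝ} (hf : Summable f) (h0 : ∀ a, 0 ≤ f a)
    {u : ℝ} (hu : u ∈ Set.Ico base (base + ∑' b, f b)) : ∃ a, u ∈ glued e base f a := by
  -- A finite partial sum already exceeds `u - base`, and the sum up to its largest rank is at least
  -- as large.
  have hex : ∃ n, u < base + gluedBefore e f n := by
    have hlt : u - base < ∑' b, f b := by linarith [hu.2]
    obtain ⟨s, hs⟩ := (hf.hasSum.eventually (lt_mem_nhds hlt)).exists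
    refine ⟨s.sup e + 1, ?_⟩
    have : ∑ b ∈ s, f b ≤ gluedBefore e f (s.sup e + 1) := by
      calc ∑ b ∈ s, f b = ∑ b ∈ s, (if e b < s.sup e + 1 then f b else 0) := by
            refine Finset.sum_congr rfl fun b hb => ?_
            rw [if_pos (Nat.lt_succ_of_le (Finset.le_sup (f := e) hb))]
        _ ≤ _ := (summable_ite hf h0 _).sum_le_tsum s fun b _ => by
            split_ifs; exacts [h0 b, le_rfl]
    linarith
  classical
  rcases hn : Nat.find hex with _ | n
  · have h1 := Nat.find_spec hex
    rw [hn] at h1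
    simp [gluedBefore] at h1
    exact absurd hu.1 (not_le.2 h1)
  · have h1 := Nat.find_spec hex
    rw [hn] at h1
    have h2 := not_lt.1 (Nat.find_min hex (m := n) (by omega))
    -- A rank that no symbol has contributes an empty gap, so the first rank that passes `u` belongs
    -- to a symbol.
    by_cases ha : ∃ a, e a = n
    · obtain ⟨a, rfl⟩ := ha
      exact ⟨a, by rw [glued_eq base hf h0]; exact ⟨h2, h1⟩⟩
    · exfalso
      have : gluedBefore e f (n + 1) = gluedBefore e f n := by
        refine tsum_congr fun b => ?_
        have hb : e b ≠ n := fun h => ha ⟨b, h⟩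
        simp only [show (e b < n + 1) = (e b < n) from
          propext ⟨fun _ => by omega, fun _ => by omega⟩]
      rw [this] at h1
      exact absurd h1 (not_lt.2 h2)

lemma volume_glued (base : ℝ) (f : A → ℝ) (a : A) :
    volume (glued e base f a) = ENNReal.ofReal (f a) := by
  rw [glued, Real.volume_Ico]; congr 1; ring

lemma measurableSet_glued (base : ℝ) (f : A → ℝ) (a : A) :
    MeasurableSet (glued e base f a) := measurableSet_Ico

/-! ### The layers -/

/-- The total length of the first `k` layers. -/
noncomputable def cover (P : A → (ℕ → A) → ℝ) (w v : List A) (k : ℕ) : ℝ :=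
  ∑' b, alphaAt P w v k b

lemma alphaAt_summable [Nonempty A] (hP : IsKernel P) (v : List A) (k : ℕ) :
    Summable (alphaAt P w v k) := by
  cases k <;> exact summable_lowerProb hP _

lemma alphaAt_le_succ [Nonempty A] (hP : IsKernel P) (v : List A) (k : ℕ) (a : A) :
    alphaAt P w v k a ≤ alphaAt P w v (k + 1) a := by
  cases k with
  | zero => exact lowerProb_le_of_isPrefix hP a ⟨_, rfl⟩
  | succ k =>
    exact lowerProb_le_of_isPrefix hP a (List.take_prefix_take_left (by omega))

lemma alphaAt_nonneg (hP : IsKernel P) (v : List A) (k : ℕ) (a : A) :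
    0 ≤ alphaAt P w v k a := by
  cases k <;> exact lowerProb_nonneg hP _ _

lemma layer_summable [Nonempty A] (hP : IsKernel P) (v : List A) (k : ℕ) :
    Summable fun b => alphaAt P w v (k + 1) b - alphaAt P w v k b :=
  (alphaAt_summable hP v (k + 1)).sub (alphaAt_summable hP v k)

lemma layer_nonneg [Nonempty A] (hP : IsKernel P) (v : List A) (k : ℕ) (b : A) :
    0 ≤ alphaAt P w v (k + 1) b - alphaAt P w v k b :=
  sub_nonneg.2 (alphaAt_le_succ hP v k b)

lemma cover_add_layer [Nonempty A] (hP : IsKernel P) (v : List A) (k : ℕ) :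
    cover P w v k + ∑' b, (alphaAt P w v (k + 1) b - alphaAt P w v k b) = cover P w v (k + 1) := by
  rw [(alphaAt_summable hP v (k + 1)).tsum_sub (alphaAt_summable hP v k), cover, cover]
  ring

lemma cover_monotone [Nonempty A] (hP : IsKernel P) (v : List A) : Monotone (cover P w v) :=
  monotone_nat_of_le_succ fun k => (alphaAt_summable hP v k).tsum_le_tsum
    (fun a => alphaAt_le_succ hP v k a) (alphaAt_summable hP v (k + 1))

lemma cover_zero (v : List A) : cover P w v 0 = threshold P w 0 := rfl

lemma cover_le_one [Nonempty A] (hP : IsKernel P) (v : List A) (k : ℕ) : cover P w v k ≤ 1 := by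
  cases k <;> exact tsum_lowerProb_le_one hP _

/-- The role of the infimum in `α_l`: whatever the context, the layers up to `l` are long enough to
cover `[0, α_l[`. -/
lemma threshold_le_cover (hP : IsKernel P) {v : List A} {m l : ℕ} (h : distOcc w v = m)
    (hl : m + w.length + l ≤ v.length) : threshold P w (l + 1) ≤ cover P w v (l + 1) := by
  have := alphaW_le (P := P) hP h hl
  simpa only [cover, alphaAt, h, ENat.toNat_natCast, threshold] using this

lemma intervalI_subset [Nonempty A] (hP : IsKernel P) (a : A) :
    intervalI e P a ⊆ Set.Ico 0 (threshold P w 0) := by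
  have := glued_subset (e := e) 0 (summable_lowerProb hP []) (fun b => lowerProb_nonneg hP b []) a
  rwa [zero_add] at this

lemma intervalIw_subset [Nonempty A] (hP : IsKernel P) (v : List A) (a : A) (k : ℕ) :
    intervalIw e P w v a k ⊆ Set.Ico (cover P w v k) (cover P w v (k + 1)) := by
  have := glued_subset (e := e) (cover P w v k) (layer_summable (w := w) hP v k)
    (layer_nonneg hP v k) a
  rwa [cover_add_layer hP] at this

lemma exists_mem_intervalI [Nonempty A] (hP : IsKernel P) {u : ℝ}
    (hu : u ∈ Set.Ico 0 (threshold P w 0)) : ∃ a, u ∈ intervalI e P a :=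
  exists_mem_glued (summable_lowerProb hP []) (fun b => lowerProb_nonneg hP b [])
    (by rwa [zero_add])

lemma exists_mem_intervalIw [Nonempty A] (hP : IsKernel P) {v : List A} {k : ℕ} {u : ℝ}
    (hu : u ∈ Set.Ico (cover P w v k) (cover P w v (k + 1))) : ∃ a, u ∈ intervalIw e P w v a k :=
  exists_mem_glued (layer_summable (w := w) hP v k) (layer_nonneg hP v k)
    (by rw [← cover_add_layer hP] at hu; exact hu)

lemma intervalIw_congr {v v' : List A} {k : ℕ}
    (h : ∀ j ≤ k + 1, alphaAt P w v j = alphaAt P w v' j) (a : A) :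
    intervalIw e P w v a k = intervalIw e P w v' a k := by
  simp only [intervalIw, h k (by omega), h (k + 1) le_rfl]

/-! ### Determination of a symbol -/

/-- Intervals of one layer are disjoint, distinct layers occupy disjoint stretches, and `α₋₁`
separates the two alternatives. -/
lemma Determines.unique [Nonempty A] (hP : IsKernel P) {u : ℝ} {v : List A} {a b : A}
    (ha : Determines e P w u v a) (hb : Determines e P w u v b) : a = b := by
  have key : ∀ {a b : A}, u ∈ intervalI e P a →
      ∀ l : ℕ, u ∈ Set.Ico (threshold P w l) (threshold P w (l + 1)) → False := by
    intro a b ha l hl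
    have := (intervalI_subset (w := w) hP a ha).2
    have h2 := threshold_monotone (w := w) hP (Nat.zero_le l)
    linarith [hl.1]
  rcases ha with ha | ⟨l, hl, -, k, -, hk⟩
  · rcases hb with hb | ⟨l, hl, -, k, -, hk⟩
    · exact glued_injective (summable_lowerProb hP []) (fun b => lowerProb_nonneg hP b []) ha hb
    · exact (key (a := a) (b := a) ha l hl).elim
  · rcases hb with hb | ⟨l', hl', -, k', -, hk'⟩
    · exact (key (a := b) (b := b) hb l hl).elim
    · have h1 := intervalIw_subset hP v a k hk
      have h2 := intervalIw_subset hP v b k' hk'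
      have hkk : k = k' := by
        by_contra hne
        rcases Nat.lt_or_gt_of_ne hne with h | h
        · have := cover_monotone (P := P) (w := w) hP v (Nat.succ_le_of_lt h)
          linarith [h1.2, h2.1]
        · have := cover_monotone (P := P) (w := w) hP v (Nat.succ_le_of_lt h)
          linarith [h2.2, h1.1]
      subst hkk
      exact glued_injective (layer_summable (w := w) hP v k) (layer_nonneg hP v k) hk hk'

lemma distOcc_add_le {v : List A} {c : ℕ}
    (h : distOcc w v + (w.length : ℕ∞) + (c : ℕ∞) ≤ (v.length : ℕ∞)) :
    ∃ m : ℕ, distOcc w v = m ∧ m + w.length + c ≤ v.length := by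
  cases hm : distOcc w v with
  | top => simp [hm] at h
  | coe m =>
    rw [hm] at h
    exact ⟨m, rfl, by exact_mod_cast h⟩

lemma alphaAt_append {v : List A} {m l : ℕ} (h : distOcc w v = m)
    (hl : m + w.length + l ≤ v.length) (t : List A) {j : ℕ} (hj : j ≤ l + 1) :
    alphaAt P w (v ++ t) j = alphaAt P w v j := by
  funext a
  cases j with
  | zero => rfl
  | succ j =>
    have := distOcc_append h (by omega) t
    simp only [alphaAt, h, this, ENat.toNat_natCast]
    rw [List.take_append_of_le_length (by omega)]

/-- A context that fits in `v` is read off from `v` alone: adding older symbols moves neither the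
nearest `w` nor the layers up to `l`. -/
lemma Determines.append {u : ℝ} {v : List A} {a : A}
    (h : Determines e P w u v a) (t : List A) : Determines e P w u (v ++ t) a := by
  rcases h with h | ⟨l, hl, hlen, k, hk, hu⟩
  · exact Or.inl h
  · obtain ⟨m, hm, hlen'⟩ := distOcc_add_le hlen
    refine Or.inr ⟨l, hl, ?_, k, hk, ?_⟩
    · rw [distOcc_append hm (by omega) t, ← hm]
      refine hlen.trans ?_
      rw [List.length_append]
      exact_mod_cast Nat.le_add_right _ _
    · rwa [intervalIw_congr fun j hj => alphaAt_append hm hlen' t (by omega)]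

lemma Determines.of_isPrefix {u : ℝ} {v v' : List A} {a : A}
    (h : Determines e P w u v a) (hv : v <+: v') : Determines e P w u v' a := by
  obtain ⟨t, rfl⟩ := hv
  exact h.append t

lemma exists_determines_of_lt_threshold_zero [Nonempty A] (hP : IsKernel P) {u : ℝ} (h0 : 0 ≤ u)
    (h : u < threshold P w 0) (v : List A) : ∃ a, Determines e P w u v a := by
  obtain ⟨a, ha⟩ := exists_mem_intervalI (e := e) (w := w) hP ⟨h0, h⟩
  exact ⟨a, Or.inl ha⟩

/-- Two searches: `l'` is the level of `u` among the thresholds, then `k` is its layer among the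
actual covers. Since covers dominate thresholds, `k ≤ l'`. -/
lemma exists_determines [Nonempty A] (hP : IsKernel P) {u : ℝ} (h0 : 0 ≤ u) {v : List A}
    {m l : ℕ} (hm : distOcc w v = m) (hl : m + w.length + l ≤ v.length)
    (h : u < threshold P w (l + 1)) : ∃ a, Determines e P w u v a := by
  rcases lt_or_ge u (threshold P w 0) with hu | hu
  · exact exists_determines_of_lt_threshold_zero hP h0 hu v
  classical
  have hex : ∃ l, u < threshold P w (l + 1) := ⟨l, h⟩
  have hle : Nat.find hex ≤ l := Nat.find_min' hex h
  have hmem : u ∈ Set.Ico (threshold P w (Nat.find hex)) (threshold P w (Nat.find hex + 1)) := by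
    refine ⟨?_, Nat.find_spec hex⟩
    rcases hl : Nat.find hex with _ | l
    · exact hu
    · exact not_lt.1 (Nat.find_min hex (m := l) (by omega))
  generalize Nat.find hex = l' at hle hmem
  have hlt : u < cover P w v (l' + 1) :=
    hmem.2.trans_le (threshold_le_cover hP hm (by omega))
  have hex2 : ∃ k, u < cover P w v (k + 1) := ⟨l', hlt⟩
  have hkle : Nat.find hex2 ≤ l' := Nat.find_min' hex2 hlt
  have hk : u ∈ Set.Ico (cover P w v (Nat.find hex2)) (cover P w v (Nat.find hex2 + 1)) := by
    refine ⟨?_, Nat.find_spec hex2⟩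
    rcases hl : Nat.find hex2 with _ | l
    · exact hu
    · exact not_lt.1 (Nat.find_min hex2 (m := l) (by omega))
  obtain ⟨a, ha⟩ := exists_mem_intervalIw (e := e) hP hk
  refine ⟨a, Or.inr ⟨l', hmem, ?_, _, hkle, ha⟩⟩
  rw [hm]
  exact_mod_cast (by omega : m + w.length + l' ≤ v.length)

/-- All truncations of the empty string are empty, so its layers beyond `I(a)` have total length
zero. This excludes the second alternative even when `w` is empty. -/
lemma Determines.nil_mem [Nonempty A] (hP : IsKernel P) {u : ℝ} {a : A}
    (h : Determines e P w u [] a) : u ∈ Set.Ico 0 (threshold P w 0) := by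
  rcases h with h | ⟨l, hl, -, k, -, hu⟩
  · exact intervalI_subset hP a h
  · have h1 := (intervalIw_subset hP [] a k hu).2
    have h2 := threshold_monotone (w := w) hP (Nat.zero_le l)
    have h3 : cover P w [] (k + 1) = threshold P w 0 := by
      simp [cover, alphaAt, threshold]
    linarith [hl.1]

lemma update_eq_some_iff [Nonempty A] (hP : IsKernel P) {u : ℝ} {v : List A} {a : A} :
    update e P w u v = some a ↔ Determines e P w u v a := by
  classical
  unfold update
  constructor
  · intro h
    split_ifs at h with hex
    rw [← Option.some.inj h]
    exact hex.choose_spec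
  · intro h
    rw [dif_pos ⟨a, h⟩]
    exact congrArg some (Determines.unique hP (Exists.choose_spec ⟨a, h⟩) h)

lemma update_ne_none_iff [Nonempty A] (hP : IsKernel P) {u : ℝ} {v : List A} :
    update e P w u v ≠ none ↔ ∃ a, Determines e P w u v a := by
  rw [Option.ne_none_iff_exists']
  simp only [update_eq_some_iff hP]

lemma measurableSet_determines [Countable A] (v : List A) (a : A) :
    MeasurableSet {u | Determines e P w u v a} := by
  have : {u | Determines e P w u v a} = intervalI e P a ∪
      ⋃ l : ℕ, {u | u ∈ Set.Ico (threshold P w l) (threshold P w (l + 1)) ∧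
        (distOcc w v + (w.length : ℕ∞) + (l : ℕ∞) ≤ (v.length : ℕ∞) ∧
          ∃ k ≤ l, u ∈ intervalIw e P w v a k)} := by
    ext u; simp [Determines]
  rw [this]
  refine (measurableSet_glued _ _ _).union (.iUnion fun l => ?_)
  refine MeasurableSet.inter (s₂ := {u | distOcc w v + (w.length : ℕ∞) + (l : ℕ∞) ≤ v.length ∧
    ∃ k ≤ l, u ∈ intervalIw e P w v a k}) measurableSet_Ico ?_
  have : {u | distOcc w v + (w.length : ℕ∞) + (l : ℕ∞) ≤ (v.length : ℕ∞) ∧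
      ∃ k ≤ l, u ∈ intervalIw e P w v a k} =
      {_u | distOcc w v + (w.length : ℕ∞) + (l : ℕ∞) ≤ (v.length : ℕ∞)} ∩
        ⋃ k ∈ Set.Iic l, intervalIw e P w v a k := by
    ext u
    simp
  rw [this]
  exact (MeasurableSet.const _).inter
    (.biUnion (Set.to_countable _) fun k _ => measurableSet_glued _ _ _)

end Basics

/-! ### Infinite pasts and the exact transition probabilities -/

section Pasts

variable {A : Type*} {e : A ↪ ℕ} {P : A → (ℕ → A) → ℝ} {w : List A}

/-- The string of the `n` most recent symbols of a past. -/
def pre (z : ℕ → A) (n : ℕ) : List A := (List.range n).map z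

/-- The past obtained from `z` when the symbol `a` comes next. -/
def extend (a : A) (z : ℕ → A) : ℕ → A := fun n => Nat.casesOn n a z

@[simp] lemma length_pre (z : ℕ → A) (n : ℕ) : (pre z n).length = n := by simp [pre]

@[simp] lemma pre_zero (z : ℕ → A) : pre z 0 = [] := rfl

lemma pre_succ (z : ℕ → A) (n : ℕ) : pre z (n + 1) = pre z n ++ [z n] := by
  simp [pre, List.range_succ]

lemma pre_succ' (z : ℕ → A) (n : ℕ) : pre z (n + 1) = z 0 :: pre (fun k => z (k + 1)) n := by
  simp [pre, List.range_succ_eq_map, Function.comp_def]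

lemma pre_extend (a : A) (z : ℕ → A) (n : ℕ) : pre (extend a z) (n + 1) = a :: pre z n :=
  pre_succ' _ _

lemma pre_add (z : ℕ → A) (n k : ℕ) : pre z (n + k) = pre z n ++ pre (fun j => z (j + n)) k := by
  induction k with
  | zero => simp
  | succ k ih => rw [← add_assoc, pre_succ, ih, pre_succ, List.append_assoc, add_comm n k]

lemma pre_isPrefix (z : ℕ → A) {n k : ℕ} (h : n ≤ k) : pre z n <+: pre z k := by
  obtain ⟨j, rfl⟩ := Nat.exists_eq_add_of_le h
  rw [pre_add]; exact List.prefix_append _ _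

lemma take_pre (z : ℕ → A) {n k : ℕ} (h : k ≤ n) : (pre z n).take k = pre z k := by
  obtain ⟨j, rfl⟩ := Nat.exists_eq_add_of_le h
  rw [pre_add, List.take_left' (length_pre _ _)]

lemma concat_pre (z : ℕ → A) (n : ℕ) : concat (pre z n) (fun j => z (j + n)) = z := by
  ext k
  simp only [concat, length_pre]
  rcases lt_or_ge k n with h | h
  · rw [List.getD_eq_getElem _ _ (by simpa using h)]; simp [pre]
  · rw [List.getD_eq_default _ _ (by simpa using h)]; congr 1; omega

lemma lowerProb_pre_le (hP : IsKernel P) (a : A) (z : ℕ → A) (n : ℕ) :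
    lowerProb P a (pre z n) ≤ P a z := by
  conv_rhs => rw [← concat_pre z n]
  exact lowerProb_le hP _ _ _

/-- The word `w` occurs in the past `z`. -/
def HasWord (w : List A) (z : ℕ → A) : Prop :=
  ∃ n m : ℕ, distOcc w (pre z n) = m ∧ m + w.length ≤ n

/-- The values of `u` with which the past `z` produces the symbol `a`. -/
def hitSet (e : A ↪ ℕ) (P : A → (ℕ → A) → ℝ) (w : List A) (z : ℕ → A) (a : A) : Set ℝ :=
  {u | ∃ n, Determines e P w u (pre z n) a}

open Classical in
/-- The symbol that comes after the past `z`, when the uniform variable is `u`. -/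
noncomputable def nextSymbol [Nonempty A] (e : A ↪ ℕ) (P : A → (ℕ → A) → ℝ) (w : List A)
    (z : ℕ → A) (u : ℝ) : A :=
  if h : ∃ a, u ∈ hitSet e P w z a then h.choose else Classical.arbitrary A

lemma hitSet_unique [Nonempty A] (hP : IsKernel P) {z : ℕ → A} {u : ℝ} {a b : A}
    (ha : u ∈ hitSet e P w z a) (hb : u ∈ hitSet e P w z b) : a = b := by
  obtain ⟨n, hn⟩ := ha
  obtain ⟨k, hk⟩ := hb
  exact Determines.unique hP (hn.of_isPrefix (pre_isPrefix z (le_max_left n k)))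
    (hk.of_isPrefix (pre_isPrefix z (le_max_right n k)))

lemma nextSymbol_eq [Nonempty A] (hP : IsKernel P) {z : ℕ → A} {u : ℝ} {a : A}
    (ha : u ∈ hitSet e P w z a) : nextSymbol e P w z u = a := by
  have h : ∃ a, u ∈ hitSet e P w z a := ⟨a, ha⟩
  rw [nextSymbol, dif_pos h]
  exact hitSet_unique hP h.choose_spec ha

lemma measurableSet_hitSet [Countable A] (z : ℕ → A) (a : A) :
    MeasurableSet (hitSet e P w z a) := by
  have : hitSet e P w z a = ⋃ n, {u | Determines e P w u (pre z n) a} := by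
    ext; simp [hitSet]
  rw [this]
  exact .iUnion fun n => measurableSet_determines _ _

/-- `D` consists of `I(a)` and the intervals of `a` in the layers of index below `k`, all determined
by a sufficiently long piece of `z`. An inclusion is enough, since `unif_hitSet` gets equality from
the total mass. -/
lemma exists_subset_hitSet [Nonempty A] (hP : IsKernel P)
    (hsum : Summable fun k : ℕ => 1 - alphaW P w k) {z : ℕ → A} {n m : ℕ}
    (hm : distOcc w (pre z n) = m) (hmn : m + w.length ≤ n) (a : A) (k : ℕ) :
    ∃ D : Set ℝ, MeasurableSet D ∧ D ⊆ hitSet e P w z a ∧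
      D ⊆ Set.Ico 0 (cover P w (pre z (n + k)) k) ∧
      volume D = ENNReal.ofReal (alphaAt P w (pre z (n + k)) k a) := by
  have hext : ∀ {k i j : ℕ}, k ≤ i → j ≤ k + 1 →
      alphaAt P w (pre z (n + i)) j = alphaAt P w (pre z (n + k)) j := by
    intro k i j hki hj
    obtain ⟨t, ht⟩ := pre_isPrefix z (show n + k ≤ n + i by omega)
    rw [← ht]
    refine alphaAt_append (m := m) (l := k) ?_ (by simp; omega) t hj
    obtain ⟨t', ht'⟩ := pre_isPrefix z (show n ≤ n + k by omega)
    rw [← ht']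
    exact distOcc_append hm (by simpa using hmn) _
  have hdist : ∀ i, distOcc w (pre z (n + i)) = m := by
    intro i
    obtain ⟨t', ht'⟩ := pre_isPrefix z (show n ≤ n + i by omega)
    rw [← ht']
    exact distOcc_append hm (by simpa using hmn) _
  induction k with
  | zero =>
    refine ⟨intervalI e P a, measurableSet_glued _ _ _, fun u hu => ⟨0, Or.inl hu⟩,
      intervalI_subset (w := w) hP a, volume_glued _ _ _⟩
  | succ k ih =>
    obtain ⟨D, hD, hD1, hD2, hD3⟩ := ih
    have hcov : cover P w (pre z (n + k)) k = cover P w (pre z (n + (k + 1))) k := by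
      rw [cover, cover, hext (i := k + 1) (k := k) (by omega) (by omega)]
    have hI := intervalIw_subset (e := e) (w := w) hP (pre z (n + (k + 1))) a k
    refine ⟨D ∪ intervalIw e P w (pre z (n + (k + 1))) a k, hD.union (measurableSet_glued _ _ _),
      Set.union_subset hD1 ?_, Set.union_subset ?_ ?_, ?_⟩
    · intro u hu
      have hu' := hI hu
      have h0 : threshold P w 0 ≤ u := by
        rw [← cover_zero (pre z (n + (k + 1)))]
        exact (cover_monotone hP _ (Nat.zero_le k)).trans hu'.1
      obtain ⟨l, hl⟩ := exists_mem_Ico_threshold hsum h0 (hu'.2.trans_le (cover_le_one hP _ _))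
      -- For `l < k` the layers before the `k`-th would cover `[0, α_l[`, which contains `u`.
      have hkl : k ≤ l := by
        by_contra hlt
        push Not at hlt
        have h1 := threshold_le_cover (v := pre z (n + (k + 1))) (l := l) hP (hdist _)
          (by simp; omega)
        have h2 := cover_monotone (w := w) hP (pre z (n + (k + 1))) (Nat.succ_le_of_lt hlt)
        have := hl.2
        have := hu'.1
        simp only [Nat.succ_eq_add_one] at h2
        linarith
      refine ⟨n + l, Or.inr ⟨l, hl, ?_, k, hkl, ?_⟩⟩
      · rw [hdist, length_pre]
        exact_mod_cast (by omega : m + w.length + l ≤ n + l)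
      · rw [intervalIw_congr (v' := pre z (n + k)) fun j hj => hext (by omega) hj]
        rwa [intervalIw_congr (v' := pre z (n + k)) fun j hj => hext (by omega) hj] at hu
    · exact hD2.trans (Set.Ico_subset_Ico_right (hcov.le.trans (cover_monotone hP _ (by omega))))
    · refine hI.trans (Set.Ico_subset_Ico_left ?_)
      exact tsum_nonneg fun b => alphaAt_nonneg hP _ _ _
    · have hms : MeasurableSet (intervalIw e P w (pre z (n + (k + 1))) a k) :=
        measurableSet_glued _ _ _
      rw [measure_union _ hms, hD3, intervalIw, volume_glued,
        ← ENNReal.ofReal_add (alphaAt_nonneg hP _ _ _) (layer_nonneg hP _ _ _),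
        hext (i := k + 1) (k := k) (j := k) (by omega) (by omega)]
      · congr 1; ring
      · refine Set.disjoint_left.2 fun u hu hu' => ?_
        have h1 := (hD2 hu).2
        have h2 := (hI hu').1
        rw [hcov] at h1
        linarith

/-- The measures `q` of the hit sets and `P · z` both dominate the lower probabilities along `z` and
have total mass at most one. The lower probabilities sum to at least `α_k`, which tends to one, so
both are their common limit. -/
lemma unif_hitSet [Countable A] [Nonempty A] (hP : IsKernel P)
    (hsum : Summable fun k : ℕ => 1 - alphaW P w k) {z : ℕ → A} (hz : HasWord w z) (a : A) :
    unif (hitSet e P w z a) = ENNReal.ofReal (P a z) := by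
  obtain ⟨n, m, hm, hmn⟩ := hz
  set q : A → ℝ := fun b => (unif (hitSet e P w z b)).toReal with hq
  have hqsum : ∑' b, unif (hitSet e P w z b) ≤ 1 := by
    rw [← measure_iUnion (fun b c hbc => Set.disjoint_left.2 fun u hb hc =>
      hbc (hitSet_unique hP hb hc)) fun b => measurableSet_hitSet z b]
    exact prob_le_one
  have hqs : Summable q := ENNReal.summable_toReal (ne_top_of_le_ne_top ENNReal.one_ne_top hqsum)
  have hq1 : ∑' b, q b ≤ 1 := by
    rw [← ENNReal.tsum_toReal_eq fun b => measure_ne_top _ _]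
    exact ENNReal.toReal_le_of_le_ofReal zero_le_one (by simpa using hqsum)
  have hlow : ∀ k b, alphaAt P w (pre z (n + k)) k b ≤ q b := by
    intro k b
    obtain ⟨D, hD, hD1, hD2, hD3⟩ := exists_subset_hitSet (e := e) hP hsum hm hmn b k
    rw [hq, ← ENNReal.ofReal_le_iff_le_toReal (measure_ne_top _ _), ← hD3]
    have : D ⊆ hitSet e P w z b ∩ Set.Ico 0 1 :=
      Set.subset_inter hD1 (hD2.trans (Set.Ico_subset_Ico_right (cover_le_one hP _ _)))
    rw [unif, Measure.restrict_apply (measurableSet_hitSet z b)]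
    exact measure_mono this
  have hlow' : ∀ k b, alphaAt P w (pre z (n + k)) k b ≤ P b z := by
    intro k b
    cases k with
    | zero => exact lowerProb_pre_le hP b z 0
    | succ k =>
      refine le_trans ?_ (lowerProb_pre_le hP b z (n + (k + 1)))
      exact lowerProb_le_of_isPrefix hP b ⟨_, List.take_append_drop _ _⟩
  -- A family above the lower bounds with mass at most one exceeds each of them by no more than the
  -- missing mass `1 - α_k`.
  have key : ∀ (g : A → ℝ), Summable g → ∑' b, g b ≤ 1 →
      (∀ k b, alphaAt P w (pre z (n + k)) k b ≤ g b) → ∀ k,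
      g a ≤ alphaAt P w (pre z (n + (k + 1))) (k + 1) a + (1 - alphaW P w k) := by
    intro g hg hg1 hgl k
    have hs := alphaAt_summable (w := w) hP (pre z (n + (k + 1))) (k + 1)
    have h1 := (hg.sub hs).le_tsum a fun b _ => sub_nonneg.2 (hgl (k + 1) b)
    rw [hg.tsum_sub hs] at h1
    have hdist : distOcc w (pre z (n + (k + 1))) = m := by
      obtain ⟨t', ht'⟩ := pre_isPrefix z (show n ≤ n + (k + 1) by omega)
      rw [← ht']
      exact distOcc_append hm (by simpa using hmn) _
    have h2 : alphaW P w k ≤ _ := threshold_le_cover (l := k) hP hdist (by simp; omega)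
    simp only [cover] at h2
    linarith
  have hlim : Filter.Tendsto (fun k => 1 - alphaW P w k) Filter.atTop (nhds 0) :=
    hsum.tendsto_atTop_zero
  have hPs := hP.hasSum_one z
  have hPq : P a z = q a := by
    refine le_antisymm ?_ ?_
    · refine ge_of_tendsto' (by simpa using hlim.const_add (q a)) fun k => ?_
      exact (key _ hPs.summable hPs.tsum_eq.le hlow' k).trans
        (by linarith [hlow (k + 1) a])
    · refine ge_of_tendsto' (by simpa using hlim.const_add (P a z)) fun k => ?_
      exact (key _ hqs hq1 hlow k).trans (by linarith [hlow' (k + 1) a])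
  rw [hPq, hq, ENNReal.ofReal_toReal (measure_ne_top _ _)]

lemma ae_mem_hitSet [Countable A] [Nonempty A] (hP : IsKernel P)
    (hsum : Summable fun k : ℕ => 1 - alphaW P w k) {z : ℕ → A} (hz : HasWord w z) :
    ∀ᵐ u ∂unif, ∃ a, u ∈ hitSet e P w z a := by
  have hms : MeasurableSet (⋃ a, hitSet e P w z a) :=
    .iUnion fun a => measurableSet_hitSet z a
  have h1 : unif (⋃ a, hitSet e P w z a) = 1 := by
    rw [measure_iUnion (fun b c hbc => Set.disjoint_left.2 fun u hb hc =>
      hbc (hitSet_unique hP hb hc)) fun b => measurableSet_hitSet z b]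
    simp_rw [unif_hitSet hP hsum hz]
    rw [← ENNReal.ofReal_tsum_of_nonneg (fun a => hP.nonneg a z) (hP.hasSum_one z).summable,
      (hP.hasSum_one z).tsum_eq, ENNReal.ofReal_one]
  have := (prob_compl_eq_zero_iff hms).2 h1
  rw [ae_iff]
  convert this using 2
  ext u; simp

lemma unif_nextSymbol_eq [Countable A] [Nonempty A] (hP : IsKernel P)
    (hsum : Summable fun k : ℕ => 1 - alphaW P w k) {z : ℕ → A} (hz : HasWord w z) (a : A) :
    unif {u | nextSymbol e P w z u = a} = ENNReal.ofReal (P a z) := by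
  rw [← unif_hitSet (e := e) hP hsum hz a]
  refine measure_congr ?_
  filter_upwards [ae_mem_hitSet (e := e) hP hsum hz] with u ⟨b, hb⟩
  refine propext ⟨fun h => ?_, fun h => nextSymbol_eq hP h⟩
  have h' : nextSymbol e P w z u = a := h
  rw [nextSymbol_eq hP hb] at h'
  exact h' ▸ hb

variable [MeasurableSpace A]

lemma measurable_extend : Measurable fun p : A × (ℕ → A) => extend p.1 p.2 := by
  refine measurable_pi_lambda _ fun n => ?_
  cases n with
  | zero => exact measurable_fst
  | succ n => exact (measurable_pi_apply n).comp measurable_snd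

variable [Countable A] [DiscreteMeasurableSpace A]

instance : DiscreteMeasurableSpace (List A) := ⟨fun _ => trivial⟩

lemma measurable_pre (n : ℕ) : Measurable fun z : ℕ → A => pre z n := by
  induction n with
  | zero => simp only [pre_zero]; exact measurable_const
  | succ n ih =>
    simp only [pre_succ]
    exact (Measurable.of_discrete (f := fun p : List A × A => p.1 ++ [p.2])).comp
      (ih.prodMk (measurable_pi_apply n))

lemma measurableSet_mem_hitSet (a : A) :
    MeasurableSet {p : (ℕ → A) × ℝ | p.2 ∈ hitSet e P w p.1 a} := by
  have : {p : (ℕ → A) × ℝ | p.2 ∈ hitSet e P w p.1 a} =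
      ⋃ n : ℕ, ⋃ v : List A, {z : ℕ → A | pre z n = v} ×ˢ {u | Determines e P w u v a} := by
    ext ⟨z, u⟩; simp [hitSet]
  rw [this]
  exact .iUnion fun n => .iUnion fun v =>
    ((measurable_pre n) (measurableSet_singleton v)).prod (measurableSet_determines _ _)

lemma measurable_nextSymbol [Nonempty A] (hP : IsKernel P) :
    Measurable fun p : (ℕ → A) × ℝ => nextSymbol e P w p.1 p.2 := by
  refine measurable_to_countable' fun a => ?_
  have hun : MeasurableSet {p : (ℕ → A) × ℝ | ∃ b, p.2 ∈ hitSet e P w p.1 b} := by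
    simp only [Set.ofPred_exists]
    exact .iUnion fun b => measurableSet_mem_hitSet b
  have : (fun p : (ℕ → A) × ℝ => nextSymbol e P w p.1 p.2) ⁻¹' {a} =
      {p | p.2 ∈ hitSet e P w p.1 a} ∪
        ({p | ∃ b, p.2 ∈ hitSet e P w p.1 b}ᶜ ∩ {_p | Classical.arbitrary A = a}) := by
    ext ⟨z, u⟩
    simp only [Set.mem_preimage, Set.mem_singleton_iff, Set.mem_union, Set.mem_ofPred_eq,
      Set.mem_inter_iff, Set.mem_compl_iff]
    constructor
    · intro h
      by_cases hex : ∃ b, u ∈ hitSet e P w z b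
      · obtain ⟨b, hb⟩ := hex
        rw [nextSymbol_eq hP hb] at h
        exact Or.inl (h ▸ hb)
      · rw [nextSymbol, dif_neg hex] at h
        exact Or.inr ⟨hex, h⟩
    · rintro (h | ⟨h1, h2⟩)
      · exact nextSymbol_eq hP h
      · rw [nextSymbol, dif_neg h1, h2]
  rw [this]
  exact (measurableSet_mem_hitSet a).union (hun.compl.inter (MeasurableSet.const _))

lemma measurableSet_hasWord : MeasurableSet {z : ℕ → A | HasWord w z} := by
  simp only [HasWord, Set.ofPred_exists]
  refine .iUnion fun n => .iUnion fun m => ?_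
  exact measurable_pre n (.of_discrete (s := {v | distOcc w v = m ∧ m + w.length ≤ n}))

end Pasts

/-! ### Constructions from a finite starting site, and the chain they define -/

section Construction

variable {A : Type*} {e : A ↪ ℕ} {P : A → (ℕ → A) → ℝ} {w : List A}

/-- The past of time `t`. -/
def pastAt (x : ℤ → A) (t : ℤ) : ℕ → A := fun n => x (t - 1 - n)

/-- The shift of a two-sided sequence by `k`. -/
def shift {S : Type*} (k : ℤ) (x : ℤ → S) : ℤ → S := fun i => x (i + k)

lemma pre_pastAt_succ (x : ℤ → A) (t : ℤ) (n : ℕ) :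
    pre (pastAt x (t + 1)) (n + 1) = x t :: pre (pastAt x t) n := by
  rw [pre_succ']
  congr 1
  · simp [pastAt]
  · congr 1
    ext k
    simp only [pastAt]
    congr 1
    push_cast
    ring

/-- The string constructed at the `n` sites from `s` on, when nothing is known before `s`;
`none` if the construction gets stuck. -/
noncomputable def run (e : A ↪ ℕ) (P : A → (ℕ → A) → ℝ) (w : List A) (U : ℤ → ℝ) (s : ℤ) :
    ℕ → Option (List A)
  | 0 => some []
  | n + 1 => (run e P w U s n).bind fun v => (update e P w (U (s + n)) v).map fun a => a :: v

@[simp] lemma run_zero (U : ℤ → ℝ) (s : ℤ) : run e P w U s 0 = some [] := rfl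

lemma run_succ_eq_some [Nonempty A] (hP : IsKernel P) {U : ℤ → ℝ} {s : ℤ} {n : ℕ} {V : List A} :
    run e P w U s (n + 1) = some V ↔
      ∃ v a, run e P w U s n = some v ∧ Determines e P w (U (s + n)) v a ∧ V = a :: v := by
  simp only [run, Option.bind_eq_some_iff, Option.map_eq_some_iff, update_eq_some_iff hP]
  constructor
  · rintro ⟨v, hv, a, ha, rfl⟩; exact ⟨v, a, hv, ha, rfl⟩
  · rintro ⟨v, a, hv, ha, rfl⟩; exact ⟨v, hv, a, ha, rfl⟩

lemma length_of_run [Nonempty A] (hP : IsKernel P) {U : ℤ → ℝ} {s : ℤ} {n : ℕ} {v : List A}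
    (h : run e P w U s n = some v) : v.length = n := by
  induction n generalizing v with
  | zero => simp at h; simp [← h]
  | succ n ih =>
    obtain ⟨v', a, hv', -, rfl⟩ := (run_succ_eq_some hP).1 h
    simp [ih hv']

/-- By `Determines.append`, the extra past known to the earlier start neither alters nor blocks the
symbols obtained by the later one. -/
lemma run_append [Nonempty A] (hP : IsKernel P) {U : ℤ → ℝ} {s : ℤ} {n k : ℕ} {v v' : List A}
    (h : run e P w U s n = some v) (h' : run e P w U (s + n) k = some v') :
    run e P w U s (n + k) = some (v' ++ v) := by
  induction k generalizing v' with
  | zero => simp at h'; simp [← h', h]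
  | succ k ih =>
    obtain ⟨v'', a, hv'', ha, rfl⟩ := (run_succ_eq_some hP).1 h'
    rw [← add_assoc]
    refine (run_succ_eq_some hP).2 ⟨_, a, ih hv'', ?_, rfl⟩
    push_cast
    rw [← add_assoc]
    exact ha.append _

lemma exists_run_of_add [Nonempty A] (hP : IsKernel P) {U : ℤ → ℝ} {s : ℤ} {n k : ℕ}
    {v : List A} (h : run e P w U s (n + k) = some v) :
    ∃ v', run e P w U s n = some v' := by
  induction k generalizing v with
  | zero => exact ⟨v, h⟩
  | succ k ih =>
    obtain ⟨v', a, hv', -, -⟩ := (run_succ_eq_some hP).1 h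
    exact ih hv'

lemma run_congr {U U' : ℤ → ℝ} {s : ℤ} {n : ℕ} (h : ∀ i ∈ Set.Ico s (s + n), U i = U' i) :
    run e P w U s n = run e P w U' s n := by
  induction n with
  | zero => rfl
  | succ n ih =>
    rw [run, run, ih fun i hi => h i ⟨hi.1, hi.2.trans (by push_cast; omega)⟩,
      h (s + n) ⟨by omega, by push_cast; omega⟩]

lemma run_shift (U : ℤ → ℝ) (s k : ℤ) (n : ℕ) :
    run e P w (shift k U) s n = run e P w U (s + k) n := by
  induction n with
  | zero => rfl
  | succ n ih =>
    rw [run, run, ih]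
    simp only [shift, add_right_comm s (n : ℤ) k]

/-- The construction that starts at `s` never gets stuck. -/
def IsRegeneration (e : A ↪ ℕ) (P : A → (ℕ → A) → ℝ) (w : List A) (U : ℤ → ℝ) (s : ℤ) : Prop :=
  ∀ n, run e P w U s n ≠ none

/-- Once a construction reaches a regeneration it inherits its infinite continuation. -/
lemma IsRegeneration.of_run [Nonempty A] (hP : IsKernel P) {U : ℤ → ℝ} {s : ℤ} {n : ℕ}
    (h : IsRegeneration e P w U (s + n)) (hn : run e P w U s n ≠ none) :
    IsRegeneration e P w U s := by
  intro k
  obtain ⟨v, hv⟩ := Option.ne_none_iff_exists'.1 hn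
  rcases le_total k n with hk | hk
  · obtain ⟨j, rfl⟩ := Nat.exists_eq_add_of_le hk
    obtain ⟨v', hv'⟩ := exists_run_of_add hP hv
    simp [hv']
  · obtain ⟨j, rfl⟩ := Nat.exists_eq_add_of_le hk
    obtain ⟨v', hv'⟩ := Option.ne_none_iff_exists'.1 (h j)
    simp [run_append hP hv hv']

lemma isRegeneration_congr {U U' : ℤ → ℝ} {s : ℤ} (h : ∀ i ∈ Set.Ici s, U i = U' i) :
    IsRegeneration e P w U s ↔ IsRegeneration e P w U' s :=
  forall_congr' fun _ => by rw [run_congr fun i hi => h i hi.1]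

lemma isRegeneration_shift (U : ℤ → ℝ) (s k : ℤ) :
    IsRegeneration e P w (shift k U) s ↔ IsRegeneration e P w U (s + k) :=
  forall_congr' fun _ => by rw [run_shift]

/-- The symbol `a` is constructed at the site `j` when the construction starts at a suitable
earlier site. -/
def Constructs (e : A ↪ ℕ) (P : A → (ℕ → A) → ℝ) (w : List A) (U : ℤ → ℝ) (j : ℤ) (a : A) : Prop :=
  ∃ (n : ℕ) (v : List A), run e P w U (j - n) (n + 1) = some (a :: v)

/-- Of two successful starts, the earlier one passes through the later one and then repeats its
symbols, by `run_append`. -/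
lemma Constructs.unique [Nonempty A] (hP : IsKernel P) {U : ℤ → ℝ} {j : ℤ} {a b : A}
    (ha : Constructs e P w U j a) (hb : Constructs e P w U j b) : a = b := by
  have key : ∀ {n k : ℕ} {v v' : List A} {a b : A}, n ≤ k →
      run e P w U (j - n) (n + 1) = some (a :: v) →
      run e P w U (j - k) (k + 1) = some (b :: v') → a = b := by
    intro n k v v' a b hnk h h'
    obtain ⟨i, rfl⟩ := Nat.exists_eq_add_of_le hnk
    rw [show n + i + 1 = i + (n + 1) by omega] at h'
    obtain ⟨v'', hv''⟩ := exists_run_of_add hP h'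
    have hs : j - ((n + i : ℕ) : ℤ) + (i : ℤ) = j - n := by push_cast; ring
    have := run_append hP hv'' (by rw [hs]; exact h)
    rw [this, Option.some_inj, List.cons_append] at h'
    exact (List.cons.inj h').1
  obtain ⟨n, v, hv⟩ := ha
  obtain ⟨k, v', hv'⟩ := hb
  rcases le_total n k with h | h
  · exact key h hv hv'
  · exact (key h hv' hv).symm

/-- The constructed chain. -/
noncomputable def chain [Nonempty A] (e : A ↪ ℕ) (P : A → (ℕ → A) → ℝ) (w : List A)
    (U : ℤ → ℝ) (j : ℤ) : A :=
  Classical.epsilon (Constructs e P w U j)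

lemma constructs_shift (U : ℤ → ℝ) (j k : ℤ) (a : A) :
    Constructs e P w (shift k U) j a ↔ Constructs e P w U (j + k) a := by
  simp only [Constructs, run_shift]
  refine exists_congr fun n => exists_congr fun v => ?_
  rw [show j - (n : ℤ) + k = j + k - n by ring]

lemma constructs_congr {U U' : ℤ → ℝ} {j : ℤ} (h : ∀ i ≤ j, U i = U' i) (a : A) :
    Constructs e P w U j a ↔ Constructs e P w U' j a := by
  refine exists_congr fun n => exists_congr fun v => ?_
  rw [run_congr fun i hi => h i ?_]
  have := hi.2
  push_cast at this
  omega

variable [Nonempty A]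

lemma chain_eq (hP : IsKernel P) {U : ℤ → ℝ} {j : ℤ} {a : A}
    (h : Constructs e P w U j a) : chain e P w U j = a :=
  Constructs.unique hP (Classical.epsilon_spec ⟨a, h⟩) h

/-- True for every `U`, including those with sites where nothing is constructed, because
`Classical.epsilon` depends on the predicate alone. -/
lemma chain_shift (U : ℤ → ℝ) (k : ℤ) :
    chain e P w (shift k U) = shift k (chain e P w U) :=
  funext fun j => congrArg Classical.epsilon (funext fun a => propext (constructs_shift U j k a))

lemma chain_congr {U U' : ℤ → ℝ} {j : ℤ} (h : ∀ i ≤ j, U i = U' i) :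
    chain e P w U j = chain e P w U' j :=
  congrArg Classical.epsilon (funext fun a => propext (constructs_congr h a))

/-- The link from `run` to `chain`: any finite successful construction witnesses the symbols of the
chain at its own sites. -/
lemma run_eq_pre (hP : IsKernel P) {U : ℤ → ℝ} {s : ℤ} {n : ℕ} (h : run e P w U s n ≠ none) :
    run e P w U s n = some (pre (pastAt (chain e P w U) (s + n)) n) := by
  induction n with
  | zero => simp
  | succ n ih =>
    obtain ⟨V, hV⟩ := Option.ne_none_iff_exists'.1 h
    obtain ⟨v, a, hv, ha, rfl⟩ := (run_succ_eq_some hP).1 hV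
    have hpre := ih (by simp [hv])
    rw [hv, Option.some_inj] at hpre
    have : chain e P w U (s + n) = a :=
      chain_eq hP ⟨n, v, by rw [add_sub_cancel_right]; exact hV⟩
    rw [hV]
    push_cast
    rw [← add_assoc, pre_pastAt_succ, this, hpre]

lemma determines_of_run (hP : IsKernel P) {U : ℤ → ℝ} {s : ℤ} {n : ℕ}
    (h : run e P w U s (n + 1) ≠ none) :
    Determines e P w (U (s + n)) (pre (pastAt (chain e P w U) (s + n)) n)
      (chain e P w U (s + n)) := by
  have hV := run_eq_pre hP h
  obtain ⟨v, a, hv, ha, hva⟩ := (run_succ_eq_some hP).1 hV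
  push_cast at hva
  rw [← add_assoc, pre_pastAt_succ] at hva
  obtain ⟨h1, h2⟩ := List.cons.inj hva
  rwa [h1, h2]

lemma IsRegeneration.determines (hP : IsKernel P) {U : ℤ → ℝ} {s : ℤ}
    (h : IsRegeneration e P w U s) (n : ℕ) :
    Determines e P w (U (s + n)) (pre (pastAt (chain e P w U) (s + n)) n)
      (chain e P w U (s + n)) :=
  determines_of_run hP (h (n + 1))

lemma IsRegeneration.mem_hitSet (hP : IsKernel P) {U : ℤ → ℝ} {s t : ℤ}
    (h : IsRegeneration e P w U s) (hst : s ≤ t) :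
    U t ∈ hitSet e P w (pastAt (chain e P w U) t) (chain e P w U t) := by
  obtain ⟨n, rfl⟩ := Int.exists_add_of_le hst
  exact ⟨n, h.determines hP n⟩

end Construction

/-! ### Termination and correctness of the algorithm -/

section Algorithm

variable {A : Type*} {e : A ↪ ℕ} {P : A → (ℕ → A) → ℝ} {w : List A}

lemma minB_mem {B : Finset ℤ} (h : B.Nonempty) : minB B ∈ B := by
  rw [minB, ← Finset.coe_min' h]
  exact B.min'_mem h

lemma minB_le {B : Finset ℤ} {j : ℤ} (hj : j ∈ B) : minB B ≤ j := by
  rw [minB, ← Finset.coe_min' ⟨j, hj⟩]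
  exact B.min'_le j hj

/-- `segment` and `block` unfold to a `List.range` coerced to integers in this monadic form. -/
lemma coe_range (n : ℕ) :
    (do let a ← List.range n; pure (a : ℤ)) = (List.range n).map fun a : ℕ => (a : ℤ) := by
  simp [List.map_eq_flatMap]

lemma segment_eq_pre {X : ℤ → Option A} {x : ℤ → A} {i t : ℤ}
    (h : ∀ j ∈ Set.Ico i t, X j = some (x j)) :
    segment X i t = pre (pastAt x t) (t - i).toNat := by
  rw [segment, coe_range, List.filterMap_map, pre, ← List.filterMap_eq_map]
  refine List.filterMap_congr fun j hj => ?_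
  rw [List.mem_range] at hj
  exact h (t - 1 - (j : ℤ)) ⟨by omega, by omega⟩

/-- The uniform variables all lie in `[0, 1[`, and the construction that starts at `s` never gets
stuck, for arbitrarily small `s`. -/
structure IsTypical (e : A ↪ ℕ) (P : A → (ℕ → A) → ℝ) (w : List A) (U : ℤ → ℝ) : Prop where
  mem_Ico : ∀ i, U i ∈ Set.Ico (0 : ℝ) 1
  exists_le : ∀ i, ∃ s ≤ i, IsRegeneration e P w U s
  exists_ge : ∀ i, ∃ s ≥ i, IsRegeneration e P w U s

/-- The algorithm leads from the state `s` to the state `s'`. -/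
def Reaches (e : A ↪ ℕ) (P : A → (ℕ → A) → ℝ) (w : List A) (U : ℤ → ℝ) (m : ℤ)
    (s s' : State A) : Prop :=
  ∃ N : ℕ, (step e P w U m)^[N] s = s'

lemma Reaches.refl {U : ℤ → ℝ} {m : ℤ} (s : State A) : Reaches e P w U m s s := ⟨0, rfl⟩

lemma Reaches.trans {U : ℤ → ℝ} {m : ℤ} {s s' s'' : State A} (h : Reaches e P w U m s s')
    (h' : Reaches e P w U m s' s'') : Reaches e P w U m s s'' := by
  obtain ⟨N, rfl⟩ := h
  obtain ⟨N', rfl⟩ := h'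
  exact ⟨N' + N, Function.iterate_add_apply _ _ _ _⟩

lemma Reaches.of_step {U : ℤ → ℝ} {m : ℤ} {s s' : State A}
    (h : Reaches e P w U m (step e P w U m s) s') : Reaches e P w U m s s' :=
  Reaches.trans ⟨1, rfl⟩ h

/-- All sites from `s.i` to `n` outside `s.B` have been constructed correctly. -/
def Correct (x : ℤ → A) (n : ℤ) (s : State A) : Prop :=
  s.B ⊆ Finset.Icc s.i n ∧ ∀ j ∈ Set.Icc s.i n, j ∉ s.B → s.X j = some (x j)

lemma Correct.insert {x : ℤ → A} {n : ℤ} {s s' : State A} (hs : Correct x n s) (hsn : s.i ≤ n)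
    (hi : s'.i = s.i - 1) (hB : s'.B = insert (s.i - 1) s.B) (hX : s'.X = s.X) :
    Correct x n s' := by
  unfold Correct
  rw [hi, hB, hX]
  refine ⟨?_, fun j hj hjB => ?_⟩
  · refine Finset.insert_subset (Finset.mem_Icc.2 ⟨le_rfl, by omega⟩) (hs.1.trans ?_)
    exact Finset.Icc_subset_Icc_left (by omega)
  · rw [Finset.mem_insert, not_or] at hjB
    have h1 := hj.1
    have h2 := hjB.1
    exact hs.2 j ⟨by omega, hj.2⟩ hjB.2

variable [Nonempty A]

/-- A regeneration at or before `t` makes `U t` hit the chain's own symbol, and no `u` hits two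
symbols after one past. -/
lemma IsTypical.eq_chain (hP : IsKernel P) {U : ℤ → ℝ} (hU : IsTypical e P w U) {t : ℤ} {n : ℕ}
    {a : A} (h : Determines e P w (U t) (pre (pastAt (chain e P w U) t) n) a) :
    a = chain e P w U t := by
  obtain ⟨s, hs, hR⟩ := hU.exists_le t
  exact hitSet_unique hP ⟨n, h⟩ (hR.mem_hitSet hP hs)

/-- The forward loop may stop early with `B` not empty; only correctness is claimed. The number of
sites still ahead decreases. -/
lemma reaches_outer_of_forward (hP : IsKernel P) {U : ℤ → ℝ} (hU : IsTypical e P w U) {m n : ℤ}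
    (k : ℕ) (s : State A) (hk : (n + 1 - s.i).toNat = k) (hloc : s.loc = Loc.forward)
    (hmi : m ≤ s.i) (hB : s.B = Finset.Icc s.i n)
    (hX : ∀ j ∈ Set.Ico m s.i, s.X j = some (chain e P w U j)) :
    ∃ s', Reaches e P w U m s s' ∧ s'.loc = Loc.outer ∧ s'.i = m ∧
      Correct (chain e P w U) n s' := by
  induction k using Nat.strong_induction_on generalizing s with
  | _ k ih =>
  by_cases hc : update e P w (U s.i) (segment s.X m s.i) ≠ none ∧ s.B.Nonempty
  · obtain ⟨a, ha⟩ := Option.ne_none_iff_exists'.1 hc.1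
    have hax : a = chain e P w U s.i := by
      rw [segment_eq_pre hX, update_eq_some_iff hP] at ha
      exact hU.eq_chain hP ha
    have hin : s.i ≤ n := by
      obtain ⟨j, hj⟩ := hc.2
      rw [hB, Finset.mem_Icc] at hj
      omega
    have hstep : step e P w U m s = { s with
        X := Function.update s.X s.i (some (chain e P w U s.i))
        B := s.B.erase s.i
        i := s.i + 1 } := by
      simp only [step, hloc]
      rw [if_pos hc, ha, hax]
    obtain ⟨s', h1, h2⟩ := ih ((n + 1 - (s.i + 1)).toNat) (by omega)
      (step e P w U m s) (by rw [hstep]) (by rw [hstep, ← hloc]) (by rw [hstep]; dsimp only; omega)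
      (by
        rw [hstep, hB]
        ext j
        simp only [Finset.mem_erase, Finset.mem_Icc]
        omega)
      (by
        rw [hstep]
        intro j hj
        dsimp only at hj ⊢
        by_cases hji : j = s.i
        · rw [hji, Function.update_self]
        · rw [Function.update_of_ne hji]
          exact hX j ⟨hj.1, by have := hj.2; omega⟩)
    exact ⟨s', h1.of_step, h2⟩
  · have hstep : step e P w U m s = { s with loc := Loc.outer, i := m } := by
      simp only [step, hloc]
      rw [if_neg hc]
    refine ⟨_, (Reaches.refl _).of_step, by rw [hstep], by rw [hstep], ?_⟩
    rw [hstep]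
    refine ⟨?_, ?_⟩
    · rw [hB]; exact Finset.Icc_subset_Icc_left hmi
    · intro j hj hjB
      rw [hB, Finset.mem_Icc] at hjB
      have := hj.1
      have := hj.2
      dsimp only at *
      exact hX j ⟨by omega, by omega⟩

/-- Each round shrinks `B`. The last clause is what ends the algorithm: filling from a regeneration
leaves nothing to construct. -/
lemma reaches_outer_of_fill (hP : IsKernel P) {U : ℤ → ℝ} (hU : IsTypical e P w U) {m n : ℤ}
    (k : ℕ) (s : State A) (hk : s.B.card = k) (hloc : s.loc = Loc.fill)
    (ht : s.t = minB s.B) (hs : Correct (chain e P w U) n s) :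
    ∃ s', Reaches e P w U m s s' ∧ s'.loc = Loc.outer ∧ s'.i = s.i ∧
      Correct (chain e P w U) n s' ∧ (IsRegeneration e P w U s.i → s'.B = ∅) := by
  induction k using Nat.strong_induction_on generalizing s with
  | _ k ih =>
  have hseg : s.B.Nonempty →
      segment s.X s.i s.t = pre (pastAt (chain e P w U) s.t) (s.t - s.i).toNat := by
    intro hne
    have htB : s.t ∈ s.B := ht ▸ minB_mem hne
    have h1 := Finset.mem_Icc.1 (hs.1 htB)
    refine segment_eq_pre fun j hj => hs.2 j ⟨hj.1, hj.2.le.trans h1.2⟩ fun hjB => ?_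
    have := minB_le hjB
    have := hj.2
    omega
  by_cases hc : update e P w (U s.t) (segment s.X s.i s.t) ≠ none ∧ s.B.Nonempty
  · have htB : s.t ∈ s.B := ht ▸ minB_mem hc.2
    obtain ⟨a, ha⟩ := Option.ne_none_iff_exists'.1 hc.1
    have hax : a = chain e P w U s.t := by
      rw [hseg hc.2, update_eq_some_iff hP] at ha
      exact hU.eq_chain hP ha
    have hstep : step e P w U m s = { s with
        X := Function.update s.X s.t (some (chain e P w U s.t))
        B := s.B.erase s.t
        t := minB (s.B.erase s.t) } := by
      simp only [step, hloc]
      rw [if_pos hc, ha, hax]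
    obtain ⟨s', h1, h2⟩ := ih ((s.B.erase s.t).card)
      (by rw [← hk]; exact Finset.card_erase_lt_of_mem htB)
      (step e P w U m s) (by rw [hstep]) (by rw [hstep, ← hloc]) (by rw [hstep])
      (by
        rw [hstep]
        refine ⟨(Finset.erase_subset _ _).trans hs.1, fun j hj hjB => ?_⟩
        dsimp only at hj hjB ⊢
        by_cases hji : j = s.t
        · rw [hji, Function.update_self]
        · rw [Function.update_of_ne hji]
          exact hs.2 j hj fun h => hjB (Finset.mem_erase.2 ⟨hji, h⟩))
    refine ⟨s', h1.of_step, ?_⟩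
    rw [hstep] at h2
    exact h2
  · have hstep : step e P w U m s = { s with loc := Loc.outer } := by
      simp only [step, hloc]
      rw [if_neg hc]
    refine ⟨_, (Reaches.refl _).of_step, by rw [hstep], by rw [hstep], by rw [hstep]; exact hs, ?_⟩
    -- All sites from `s.i` to just before `min B` are filled, so the test made at `min B` is the
    -- one met by the construction started at `s.i`, which succeeds.
    intro hR
    rw [hstep]
    by_contra hne
    have hne' : s.B.Nonempty := Finset.nonempty_iff_ne_empty.2 hne
    have htB : s.t ∈ s.B := ht ▸ minB_mem hne'
    have h1 := (Finset.mem_Icc.1 (hs.1 htB)).1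
    refine hc ⟨?_, hne'⟩
    rw [hseg hne', update_ne_none_iff hP]
    obtain ⟨j, hj⟩ := Int.exists_add_of_le h1
    have := hR.determines hP j
    rw [← hj] at this
    rw [show (s.t - s.i).toNat = j by omega]
    exact ⟨_, this⟩

lemma IsRegeneration.lt_threshold (hP : IsKernel P) {U : ℤ → ℝ} {s : ℤ}
    (h : IsRegeneration e P w U s) : U s < threshold P w 0 := by
  have := h.determines hP 0
  simp only [Nat.cast_zero, add_zero, pre_zero] at this
  exact (this.nil_mem hP).2

/-- The search cannot jump over the regeneration `r`: with nothing known before it, `r` can be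
constructed only if `U r < α₋₁`. -/
lemma reaches_fill_of_search (hP : IsKernel P) {U : ℤ → ℝ} (hU : IsTypical e P w U) {m n r : ℤ}
    (hr : IsRegeneration e P w U r)
    (k : ℕ) (s : State A) (hk : (s.i - r).toNat = k) (hrs : r ≤ s.i) (hsn : s.i ≤ n)
    (hloc : s.loc = Loc.search) (hs : Correct (chain e P w U) n s) :
    ∃ s', Reaches e P w U m s s' ∧ s'.loc = Loc.fill ∧ s'.t = minB s'.B ∧
      Correct (chain e P w U) n s' ∧ r ≤ s'.i ∧ s'.i ≤ s.i := by
  induction k using Nat.strong_induction_on generalizing s with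
  | _ k ih =>
  by_cases hc : U s.i ∈ Set.Ico (threshold P w 0) 1
  · have hstep : step e P w U m s =
        { s with i := s.i - 1, B := insert (s.i - 1) s.B } := by
      simp only [step, hloc]
      rw [if_pos hc]
    have hne : r ≠ s.i := by
      rintro rfl
      exact absurd hc.1 (not_le.2 (hr.lt_threshold hP))
    have hlt : r ≤ s.i - 1 := by omega
    have hi : (step e P w U m s).i = s.i - 1 := by rw [hstep]
    obtain ⟨s', h1, h2, h3, h4, h5, h6⟩ := ih ((s.i - 1 - r).toNat) (by omega)
      (step e P w U m s) (by rw [hi]) (by rw [hi]; exact hlt) (by rw [hi]; omega)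
      (by rw [hstep, ← hloc])
      (hs.insert hsn hi (by rw [hstep]) (by rw [hstep]))
    exact ⟨s', h1.of_step, h2, h3, h4, h5, by rw [hi] at h6; omega⟩
  · have hlt : U s.i < threshold P w 0 := by
      by_contra hge
      exact hc ⟨not_lt.1 hge, (hU.mem_Ico _).2⟩
    obtain ⟨a, ha⟩ := exists_determines_of_lt_threshold_zero (e := e) hP (hU.mem_Ico s.i).1 hlt []
    have hax : a = chain e P w U s.i := hU.eq_chain (n := 0) hP ha
    have hstep : step e P w U m s = { s with
          loc := Loc.fill
          X := Function.update s.X s.i (some (chain e P w U s.i))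
          B := s.B.erase s.i
          t := minB (s.B.erase s.i) } := by
      simp only [step, hloc]
      rw [if_neg hc, (update_eq_some_iff hP).2 ha, hax]
    refine ⟨_, (Reaches.refl _).of_step, by rw [hstep], by rw [hstep], ?_, by rw [hstep]; exact hrs,
      by rw [hstep]⟩
    rw [hstep]
    refine ⟨(Finset.erase_subset _ _).trans hs.1, fun j hj hjB => ?_⟩
    dsimp only at hj hjB ⊢
    by_cases hji : j = s.i
    · rw [hji, Function.update_self]
    · rw [Function.update_of_ne hji]
      exact hs.2 j hj fun h => hjB (Finset.mem_erase.2 ⟨hji, h⟩)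

/-- Each round moves `i` closer to `r` without passing it. The hypothesis `hrB` records that on
arrival at `r` everything has been filled. -/
lemma reaches_halted_of_outer (hP : IsKernel P) {U : ℤ → ℝ} (hU : IsTypical e P w U) {m n r : ℤ}
    (hr : IsRegeneration e P w U r)
    (k : ℕ) (s : State A) (hk : (s.i - r).toNat = k) (hrs : r ≤ s.i) (hsn : s.i ≤ n)
    (hloc : s.loc = Loc.outer) (hs : Correct (chain e P w U) n s) (hrB : s.i = r → s.B = ∅) :
    ∃ s', Reaches e P w U m s s' ∧ s'.loc = Loc.halted ∧ s'.theta ≤ s.i ∧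
      ∀ j ∈ Set.Icc s'.theta n, s'.X j = some (chain e P w U j) := by
  induction k using Nat.strong_induction_on generalizing s with
  | _ k ih =>
  by_cases hB : s.B.Nonempty
  · have hne : s.i ≠ r := fun h => Finset.nonempty_iff_ne_empty.1 hB (hrB h)
    have hstep : step e P w U m s =
        { s with loc := Loc.search, i := s.i - 1, B := insert (s.i - 1) s.B } := by
      simp only [step, hloc]
      rw [if_pos hB]
    have hi : (step e P w U m s).i = s.i - 1 := by rw [hstep]
    obtain ⟨s₁, h1, h2, h3, h4, h5, h6⟩ := reaches_fill_of_search hP hU (m := m) (n := n) hr _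
      (step e P w U m s) rfl (by rw [hi]; omega) (by rw [hi]; omega) (by rw [hstep])
      (hs.insert hsn hi (by rw [hstep]) (by rw [hstep]))
    rw [hi] at h6
    obtain ⟨s₂, h7, h8, h9, h10, h11⟩ := reaches_outer_of_fill hP hU (m := m) _ s₁ rfl h2 h3 h4
    obtain ⟨s₃, h12, h13, h14, h15⟩ := ih ((s₂.i - r).toNat) (by omega) s₂ rfl (by omega) (by omega)
      h8 h10 fun h => h11 (by rw [← h9, h]; exact hr)
    exact ⟨s₃, ((h1.of_step.trans h7).trans h12), h13, by omega, h15⟩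
  · have hstep : step e P w U m s = { s with loc := Loc.halted, theta := s.i } := by
      simp only [step, hloc]
      rw [if_neg hB]
    refine ⟨_, (Reaches.refl _).of_step, by rw [hstep], by rw [hstep], ?_⟩
    rw [hstep]
    intro j hj
    refine hs.2 j hj ?_
    rw [Finset.not_nonempty_iff_eq_empty.1 hB]
    exact Finset.notMem_empty j

/-- The algorithm stops, and its output is a part of the constructed chain. -/
lemma IsTypical.outputs (hP : IsKernel P) {U : ℤ → ℝ} (hU : IsTypical e P w U) {m n : ℤ}
    (hmn : m ≤ n) : ∃ θ ≤ m, Outputs e P w U m n θ (chain e P w U) := by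
  obtain ⟨s₁, h1, h2, h3, h4⟩ := reaches_outer_of_forward (m := m) (n := n) hP hU _
    (initState A m n) rfl rfl le_rfl rfl fun j hj => absurd hj.1 (not_le.2 hj.2)
  -- Strictly below `m`: the forward part may leave `B` nonempty at `i = m`, and `m ≠ r` makes the
  -- hypothesis `hrB` vacuous there.
  obtain ⟨r, hrm, hr⟩ := hU.exists_le (m - 1)
  obtain ⟨s₂, h5, h6, h7, h8⟩ := reaches_halted_of_outer (m := m) (n := n) hP hU hr _ s₁ rfl
    (by omega) (by omega) h2 h4 fun h => by omega
  obtain ⟨N, hN⟩ := h1.trans h5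
  exact ⟨s₂.theta, by omega, N, by rw [hN]; exact h6, by rw [hN], by rw [hN]; exact h8⟩

end Algorithm

/-! ### Independence of events on disjoint sets of sites -/

section Sites

/-- Membership in `E` depends only on the coordinates in `S`. -/
def DependsOnSites (E : Set (ℤ → ℝ)) (S : Set ℤ) : Prop :=
  ∀ ⦃U U' : ℤ → ℝ⦄, (∀ i ∈ S, U i = U' i) → U ∈ E → U' ∈ E

lemma DependsOnSites.mono {E : Set (ℤ → ℝ)} {S T : Set ℤ} (h : DependsOnSites E S) (hST : S ⊆ T) :
    DependsOnSites E T := fun _ _ hU => h fun i hi => hU i (hST hi)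

lemma DependsOnSites.inter {E F : Set (ℤ → ℝ)} {S : Set ℤ} (hE : DependsOnSites E S)
    (hF : DependsOnSites F S) : DependsOnSites (E ∩ F) S :=
  fun _ _ hU h => ⟨hE hU h.1, hF hU h.2⟩

lemma DependsOnSites.compl {E : Set (ℤ → ℝ)} {S : Set ℤ} (hE : DependsOnSites E S) :
    DependsOnSites Eᶜ S :=
  fun _ _ hU h h' => h (hE (fun i hi => (hU i hi).symm) h')

lemma DependsOnSites.iUnion {ι : Sort*} {E : ι → Set (ℤ → ℝ)} {S : Set ℤ}
    (hE : ∀ i, DependsOnSites (E i) S) : DependsOnSites (⋃ i, E i) S := fun _ _ hU h => by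
  obtain ⟨i, hi⟩ := Set.mem_iUnion.1 h
  exact Set.mem_iUnion.2 ⟨i, hE i hU hi⟩

lemma DependsOnSites.preimage_shift {E : Set (ℤ → ℝ)} {S : Set ℤ} (hE : DependsOnSites E S)
    (k : ℤ) : DependsOnSites (shift k ⁻¹' E) ((fun i => i + k) '' S) := fun _ _ hU h =>
  hE (fun i hi => hU (i + k) ⟨i, hi, rfl⟩) h

/-- The σ-algebra generated by the coordinates in `S`. -/
abbrev siteAlgebra (S : Set ℤ) : MeasurableSpace (ℤ → ℝ) :=
  ⨆ i ∈ S, MeasurableSpace.comap (fun U : ℤ → ℝ => U i) inferInstance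

/-- Setting all coordinates outside `S` to zero is measurable for the σ-algebra of `S`, and `E` is
its own preimage under this map. -/
lemma DependsOnSites.measurableSet {E : Set (ℤ → ℝ)} {S : Set ℤ} (hE : DependsOnSites E S)
    (hm : MeasurableSet E) : MeasurableSet[siteAlgebra S] E := by
  classical
  let ψ : (ℤ → ℝ) → ℤ → ℝ := fun U i => if i ∈ S then U i else 0
  have hψ : @Measurable _ _ (siteAlgebra S) _ ψ := by
    refine @measurable_pi_lambda _ _ _ (siteAlgebra S) _ _ fun i => ?_
    by_cases hi : i ∈ S
    · simp only [ψ, hi, if_true]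
      refine Measurable.mono (comap_measurable fun U : ℤ → ℝ => U i) ?_ le_rfl
      exact le_iSup₂ (f := fun (i : ℤ) (_ : i ∈ S) =>
        MeasurableSpace.comap (fun U : ℤ → ℝ => U i) inferInstance) i hi
    · simp only [ψ, hi, if_false]
      exact measurable_const
  have : E = ψ ⁻¹' E := by
    ext U
    exact ⟨fun h => hE (fun i hi => by simp [ψ, hi]) h, fun h => hE (fun i hi => by simp [ψ, hi]) h⟩
  rw [this]
  exact hψ hm

instance : IsProbabilityMeasure lawU := by unfold lawU; infer_instance

lemma iIndep_coordinates :
    iIndep (fun i : ℤ => MeasurableSpace.comap (fun U : ℤ → ℝ => U i) inferInstance) lawU :=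
  iIndepFun_infinitePi (X := fun _ (x : ℝ) => x) fun _ => measurable_id

/-- The product formula for events on disjoint sites. Locality is stated pointwise through
`DependsOnSites`, so each application only requires comparing index sets. -/
lemma lawU_inter {E F : Set (ℤ → ℝ)} {S T : Set ℤ} (hE : MeasurableSet E) (hF : MeasurableSet F)
    (hES : DependsOnSites E S) (hFT : DependsOnSites F T) (hST : Disjoint S T) :
    lawU (E ∩ F) = lawU E * lawU F := by
  have := indep_iSup_of_disjoint (μ := lawU)
    (fun i : ℤ => (measurable_pi_apply i).comap_le) iIndep_coordinates hST
  exact Indep_iff _ _ _ |>.1 this E F (hES.measurableSet hE) (hFT.measurableSet hF)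

lemma lawU_eval (i : ℤ) {D : Set ℝ} (hD : MeasurableSet D) : lawU {U | U i ∈ D} = unif D := by
  rw [← Measure.infinitePi_map_eval (fun _ : ℤ => unif) i,
    Measure.map_apply (measurable_pi_apply i) hD]
  rfl

lemma measurable_shift {S : Type*} [MeasurableSpace S] (k : ℤ) :
    Measurable (shift k : (ℤ → S) → ℤ → S) :=
  measurable_pi_lambda _ fun i => measurable_pi_apply (i + k)

lemma measurePreserving_shift (k : ℤ) : MeasurePreserving (shift k) lawU lawU := by
  refine ⟨measurable_shift k, ?_⟩
  have := Measure.infinitePi_map_piCongrLeft (X := fun _ : ℤ => ℝ) (fun _ : ℤ => unif)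
    (Equiv.subRight k)
  rw [lawU]
  conv_rhs => rw [← this]
  congr 1
  ext U i
  have := Equiv.piCongrLeft_apply_apply (fun _ : ℤ => ℝ) (Equiv.subRight k) U (i + k)
  simp at this
  simp [MeasurableEquiv.coe_piCongrLeft, shift, this]

lemma lawU_preimage_shift {E : Set (ℤ → ℝ)} (hE : MeasurableSet E) (k : ℤ) :
    lawU (shift k ⁻¹' E) = lawU E :=
  (measurePreserving_shift k).measure_preimage hE.nullMeasurableSet

lemma ae_mem_Ico : ∀ᵐ U ∂lawU, ∀ i, U i ∈ Set.Ico (0 : ℝ) 1 := by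
  rw [ae_all_iff]
  intro i
  have := lawU_eval i (D := (Set.Ico (0 : ℝ) 1)ᶜ) measurableSet_Ico.compl
  rw [ae_iff]
  exact this.trans (by simp [unif, Measure.restrict_apply measurableSet_Ico.compl])

end Sites

/-! ### Measurability of the construction -/

section Measurability

variable {A : Type*} {e : A ↪ ℕ} {P : A → (ℕ → A) → ℝ} {w : List A}

lemma dependsOnSites_isRegeneration (s : ℤ) :
    DependsOnSites {U | IsRegeneration e P w U s} (Set.Ici s) := fun _ _ hU h =>
  (isRegeneration_congr hU).1 h

variable [Nonempty A]

lemma measurableSet_run_eq [Countable A] (hP : IsKernel P) (s : ℤ) (n : ℕ) (V : List A) :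
    MeasurableSet {U | run e P w U s n = some V} := by
  induction n generalizing V with
  | zero => simp only [run_zero]; exact MeasurableSet.const _
  | succ n ih =>
    have : {U | run e P w U s (n + 1) = some V} = ⋃ (v : List A) (a : A),
        ({U | run e P w U s n = some v} ∩ ((fun U : ℤ → ℝ => U (s + n)) ⁻¹'
          {u | Determines e P w u v a} ∩ {_U | V = a :: v})) := by
      ext U
      simp only [Set.mem_ofPred_eq, run_succ_eq_some hP, Set.mem_iUnion, Set.mem_inter_iff,
        Set.mem_preimage]
    rw [this]
    exact .iUnion fun v => .iUnion fun a => (ih v).inter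
      (((measurable_pi_apply (s + (n : ℤ))) (measurableSet_determines v a)).inter (MeasurableSet.const _))

lemma measurableSet_run_ne_none [Countable A] (hP : IsKernel P) (s : ℤ) (n : ℕ) :
    MeasurableSet {U | run e P w U s n ≠ none} := by
  have : {U | run e P w U s n ≠ none} = ⋃ v, {U | run e P w U s n = some v} := by
    ext U; simp [Option.ne_none_iff_exists']
  rw [this]
  exact .iUnion fun v => measurableSet_run_eq hP s n v

lemma measurableSet_isRegeneration [Countable A] (hP : IsKernel P) (s : ℤ) :
    MeasurableSet {U | IsRegeneration e P w U s} := by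
  simp only [IsRegeneration, Set.ofPred_forall]
  exact .iInter fun n => measurableSet_run_ne_none hP s n

lemma measurableSet_constructs [Countable A] (hP : IsKernel P) (j : ℤ) (a : A) :
    MeasurableSet {U | Constructs e P w U j a} := by
  simp only [Constructs, Set.ofPred_exists]
  exact .iUnion fun n => .iUnion fun v => measurableSet_run_eq hP _ _ _

lemma measurable_chain [Countable A] [MeasurableSpace A] [DiscreteMeasurableSpace A]
    (hP : IsKernel P) : Measurable (chain e P w) := by
  refine measurable_pi_lambda _ fun j => measurable_to_countable' fun a => ?_
  have hex : MeasurableSet {U | ∃ b, Constructs e P w U j b} := by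
    simp only [Set.ofPred_exists]
    exact .iUnion fun b => measurableSet_constructs hP j b
  have : (fun U => chain e P w U j) ⁻¹' {a} = {U | Constructs e P w U j a} ∪
      ({U | ∃ b, Constructs e P w U j b}ᶜ ∩ {_U | Classical.epsilon (fun _ : A => False) = a}) := by
    ext U
    simp only [Set.mem_preimage, Set.mem_singleton_iff, Set.mem_union, Set.mem_ofPred_eq,
      Set.mem_inter_iff, Set.mem_compl_iff]
    -- Where nothing is constructed the predicate is everywhere false, so the default is one fixed
    -- symbol.
    have hno : (¬ ∃ b, Constructs e P w U j b) →
        chain e P w U j = Classical.epsilon (fun _ : A => False) := fun h =>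
      congrArg Classical.epsilon (funext fun b => propext ⟨fun hb => h ⟨b, hb⟩, False.elim⟩)
    constructor
    · intro h
      by_cases hex : ∃ b, Constructs e P w U j b
      · exact Or.inl (h ▸ Classical.epsilon_spec hex)
      · exact Or.inr ⟨hex, (hno hex).symm.trans h⟩
    · rintro (h | ⟨h1, h2⟩)
      · exact chain_eq hP h
      · exact (hno h1).trans h2
  rw [this]
  exact (measurableSet_constructs hP j a).union (hex.compl.inter (MeasurableSet.const _))

end Measurability

/-! ### Existence of regenerations -/

section Regeneration

variable {A : Type*} {e : A ↪ ℕ} {P : A → (ℕ → A) → ℝ} {w : List A}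

/-- The uniform variables from `s` on spontaneously produce the symbols of `c` (in the order of
time). -/
def Spells (e : A ↪ ℕ) (P : A → (ℕ → A) → ℝ) (U : ℤ → ℝ) : ℤ → List A → Prop
  | _, [] => True
  | s, a :: c => U s ∈ intervalI e P a ∧ Spells e P U (s + 1) c

lemma spells_shift (U : ℤ → ℝ) (s k : ℤ) (c : List A) :
    Spells e P (shift k U) s c ↔ Spells e P U (s + k) c := by
  induction c generalizing s with
  | nil => rfl
  | cons a c ih => rw [Spells, Spells, ih, add_right_comm]; rfl

lemma dependsOnSites_spells (s : ℤ) (c : List A) :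
    DependsOnSites {U | Spells e P U s c} (Set.Ico s (s + c.length)) := by
  induction c generalizing s with
  | nil => exact fun _ _ _ _ => trivial
  | cons a c ih =>
    intro U U' hU h
    refine ⟨?_, ih (s + 1) (fun i hi => hU i ?_) h.2⟩
    · rw [← hU s ⟨le_rfl, by simp⟩]; exact h.1
    · have h1 := hi.1
      have h2 := hi.2
      simp only [List.length_cons, Set.mem_Ico]
      push_cast
      omega

lemma measurableSet_spells (s : ℤ) (c : List A) : MeasurableSet {U | Spells e P U s c} := by
  induction c generalizing s with
  | nil => exact MeasurableSet.univ
  | cons a c ih =>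
    exact MeasurableSet.inter (s₁ := (fun U : ℤ → ℝ => U s) ⁻¹' intervalI e P a)
      ((measurable_pi_apply s) (measurableSet_glued _ _ _)) (ih (s + 1))

lemma run_of_spells [Nonempty A] (hP : IsKernel P) {U : ℤ → ℝ} {s : ℤ} {c v : List A} {n : ℕ}
    (hv : run e P w U s n = some v) (h : Spells e P U (s + n) c) :
    run e P w U s (n + c.length) = some (c.reverse ++ v) := by
  induction c generalizing n v with
  | nil => simpa using hv
  | cons a c ih =>
    have h1 : run e P w U s (n + 1) = some (a :: v) :=
      (run_succ_eq_some hP).2 ⟨v, a, hv, Or.inl h.1, rfl⟩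
    have := ih h1 (by push_cast; rw [← add_assoc]; exact h.2)
    rw [List.length_cons, add_comm c.length, ← add_assoc, this]
    simp

lemma unif_intervalI [Nonempty A] (hP : IsKernel P) (a : A) :
    unif (intervalI e P a) = ENNReal.ofReal (lowerProb P a []) := by
  have hsub : intervalI e P a ⊆ Set.Ico 0 1 :=
    (intervalI_subset (w := []) hP a).trans (Set.Ico_subset_Ico_right (threshold_le_one hP _))
  have hm : MeasurableSet (intervalI e P a) := measurableSet_glued _ _ _
  rw [unif, Measure.restrict_apply hm, Set.inter_eq_left.2 hsub, intervalI, volume_glued]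

lemma lawU_spells_pos [Nonempty A] (hP : IsKernel P) (s : ℤ) {c : List A}
    (hc : ∀ a ∈ c, a ∈ spontaneousSymbols P) : 0 < lawU {U | Spells e P U s c} := by
  induction c generalizing s with
  | nil => simp [Spells]
  | cons a c ih =>
    have hm : MeasurableSet (intervalI e P a) := measurableSet_glued _ _ _
    have : {U | Spells e P U s (a :: c)} =
        {U | U s ∈ intervalI e P a} ∩ {U | Spells e P U (s + 1) c} := rfl
    rw [this, lawU_inter (S := {s}) (T := Set.Ico (s + 1) (s + 1 + c.length))
      (show MeasurableSet {U : ℤ → ℝ | U s ∈ intervalI e P a} from (measurable_pi_apply s) hm)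
      (measurableSet_spells _ _) ?_ (dependsOnSites_spells _ _) ?_,
      lawU_eval s hm, unif_intervalI hP]
    · refine ENNReal.mul_pos ?_ (ih (s + 1) fun b hb => hc b (List.mem_cons_of_mem _ hb)).ne'
      exact (ENNReal.ofReal_pos.2 (hc a (List.mem_cons_self))).ne'
    · intro U U' hU h
      have h' : U s ∈ intervalI e P a := h
      rw [hU s rfl] at h'
      exact h'
    · refine Set.disjoint_left.2 fun i hi hi' => ?_
      rw [Set.mem_singleton_iff] at hi
      have := hi'.1
      omega

lemma run_drop [Nonempty A] (hP : IsKernel P) {U : ℤ → ℝ} {s : ℤ} {n k : ℕ} {V : List A}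
    (h : run e P w U s (n + k) = some V) : run e P w U s n = some (V.drop k) := by
  induction k generalizing V with
  | zero => simpa using h
  | succ k ih =>
    obtain ⟨v, a, hv, -, rfl⟩ := (run_succ_eq_some hP).1 h
    simpa using ih hv

/-- The occurrence need not be the most recent one: the most recent is nearer and leaves even more
symbols behind it. -/
lemma exists_determines_of_occurrence [Nonempty A] (hP : IsKernel P) {u : ℝ} (h0 : 0 ≤ u)
    {v : List A} {k l : ℕ} (hw : w <+: v.drop k) (hl : k + w.length + l ≤ v.length)
    (hu : u < alphaW P w l) : ∃ a, Determines e P w u v a := by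
  have hle := distOcc_le_of_isPrefix hw
  obtain ⟨m, hm⟩ := ENat.ne_top_iff_exists.1 (ne_top_of_le_ne_top (ENat.natCast_ne_top k) hle)
  rw [← hm] at hle
  have : m ≤ k := by exact_mod_cast hle
  exact exists_determines hP h0 hm.symm (by omega) hu

/-- The length of the windows in which spontaneous occurrences of the word are looked for. -/
def spacing (w : List A) : ℕ := w.length + 1

/-- No spontaneous occurrence of the word starts at one of `k` consecutive window boundaries
from `n` on. -/
def NoWord (e : A ↪ ℕ) (P : A → (ℕ → A) → ℝ) (w : List A) (n k : ℕ) : Set (ℤ → ℝ) :=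
  {U | ∀ j < k, ¬ Spells e P U (((n + j) * spacing w : ℕ) : ℤ) w.reverse}

/-- One of the sites of the `n`-th window of length `2 * spacing w` needs a context that is
larger than `n`, or no spontaneous occurrence of the word starts between the windows `n` and
`2 * n` of length `spacing w`. -/
def BadWindow (e : A ↪ ℕ) (P : A → (ℕ → A) → ℝ) (w : List A) (n : ℕ) : Set (ℤ → ℝ) :=
  (⋃ r ∈ Finset.range (2 * spacing w), {U | alphaW P w n ≤ U ((2 * spacing w * n + r : ℕ) : ℤ)}) ∪
    NoWord e P w n n

/-- The uniform variables never prevent the construction from going on, once the word has been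
seen at least `K` sites after the start. -/
def NeverStuck (e : A ↪ ℕ) (P : A → (ℕ → A) → ℝ) (w : List A) (K N : ℕ) : Set (ℤ → ℝ) :=
  {U | ∀ t : ℕ, 0 ≤ U t} ∩ {U | ∀ t < 2 * spacing w * N, U (t : ℤ) < alphaW P w K} ∩
    {U | ∀ n ≥ N, U ∉ BadWindow e P w n}

/-- The deterministic core. By induction on `t`, every site after the initial string sees a copy of
`w` with enough constructed symbols behind it for its uniform variable. -/
lemma isRegeneration_of_neverStuck [Nonempty A] (hP : IsKernel P) {U : ℤ → ℝ} {s : ℤ} {M K N : ℕ}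
    {c : List A} (hc : K ≤ c.length) (hrun : run e P w U s M = some (w ++ c))
    (hU : shift (s + M) U ∈ NeverStuck e P w K N) : IsRegeneration e P w U s := by
  have hM : w.length + c.length = M := by simpa using length_of_run hP hrun
  obtain ⟨⟨hU0, hU1⟩, hU2⟩ := hU
  have hval : ∀ t : ℕ, shift (s + M) U t = U (s + (M + t : ℕ)) := fun t => by
    simp only [shift]; congr 1; push_cast; ring
  have hLpos : 0 < 2 * spacing w := by simp [spacing]
  have main : ∀ t : ℕ, run e P w U s (M + t) ≠ none := by
    intro t
    induction t with
    | zero => simp [hrun]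
    | succ t ih =>
      obtain ⟨v, hv⟩ := Option.ne_none_iff_exists'.1 ih
      have hlen := length_of_run hP hv
      suffices h : ∃ a, Determines e P w (U (s + (M + t : ℕ))) v a by
        obtain ⟨a, ha⟩ := h
        rw [← add_assoc, (run_succ_eq_some hP).2 ⟨v, a, hv, ha, rfl⟩]
        simp
      have h0 : 0 ≤ U (s + (M + t : ℕ)) := by rw [← hval]; exact hU0 t
      rcases lt_or_ge t (2 * spacing w * N) with ht | ht
      -- Early sites use the initial `w`, which has the string `c` of at least `K` symbols behind
      -- it.
      · have hlt := hU1 t ht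
        rw [hval] at hlt
        have hd := run_drop hP hv
        rw [hrun, Option.some_inj] at hd
        exact exists_determines_of_occurrence hP h0 (k := t) (by rw [← hd]; exact List.prefix_append _ _)
          (by omega) hlt
      -- Later sites use a spontaneous copy of `w` at `p`, with `p ≥ n`, while the variable of the
      -- site is below `α_n`.
      · set n := t / (2 * spacing w) with hn
        have hdm : 2 * spacing w * n + t % (2 * spacing w) = t := Nat.div_add_mod t _
        have hmod : t % (2 * spacing w) < 2 * spacing w := Nat.mod_lt _ hLpos
        have hNn : N ≤ n := by
          rw [hn, Nat.le_div_iff_mul_le hLpos, mul_comm]; exact ht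
        have hnb := hU2 n hNn
        rw [BadWindow, Set.mem_union, not_or] at hnb
        obtain ⟨hb1, hb2⟩ := hnb
        have hlt : U (s + (M + t : ℕ)) < alphaW P w n := by
          by_contra hge
          refine hb1 (Set.mem_biUnion (Finset.mem_range.2 hmod) ?_)
          rw [Set.mem_ofPred_eq, hdm, hval]
          exact not_lt.1 hge
        simp only [NoWord, Set.mem_ofPred_eq, not_forall, not_not] at hb2
        obtain ⟨j, hj, hsp⟩ := hb2
        rw [spells_shift] at hsp
        set p := (n + j) * spacing w with hp
        -- Since `j < n`, the copy ends within the first `2 * n` stretches of length `spacing w`,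
        -- all of which precede `t`.
        have hpt : p + spacing w ≤ t := by
          have : p + spacing w = (n + j + 1) * spacing w := by rw [hp]; ring
          rw [this]
          calc (n + j + 1) * spacing w ≤ (2 * n) * spacing w := Nat.mul_le_mul_right _ (by omega)
            _ = 2 * spacing w * n := by ring
            _ ≤ t := by omega
        have hpn : n ≤ p := by
          rw [hp]
          exact (Nat.le_add_right n j).trans (Nat.le_mul_of_pos_right _ (by simp [spacing]))
        have hsw : spacing w = w.length + 1 := rfl
        obtain ⟨i, hi⟩ := Nat.exists_eq_add_of_le (show p + w.length ≤ t by omega)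
        have hv' : run e P w U s ((M + p + w.length) + i) = some v := by
          rw [← hv]; congr 1; omega
        have h1 := run_drop hP hv'
        have h2 := run_drop hP h1
        have h3 := run_of_spells hP h2 (c := w.reverse)
          (by rw [show s + ((M + p : ℕ) : ℤ) = (p : ℤ) + (s + M) by push_cast; ring]; exact hsp)
        rw [List.length_reverse, h1, Option.some_inj, List.reverse_reverse] at h3
        exact exists_determines_of_occurrence hP h0 (k := i)
          (by rw [h3]; exact List.prefix_append _ _) (by omega) hlt
  intro t
  rcases le_total t M with h | h
  · obtain ⟨j, rfl⟩ := Nat.exists_eq_add_of_le h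
    obtain ⟨v, hv⟩ := exists_run_of_add hP hrun
    simp [hv]
  · obtain ⟨j, rfl⟩ := Nat.exists_eq_add_of_le h
    exact main j

/-! ### Probability of never getting stuck -/

lemma dependsOnSites_noWord (n k : ℕ) :
    DependsOnSites (NoWord e P w n k) (Set.Ico ((n * spacing w : ℕ) : ℤ)
      (((n + k) * spacing w : ℕ) : ℤ)) := by
  intro U U' hU h j hj h'
  refine h j hj ?_
  refine dependsOnSites_spells _ _ (fun i hi => (hU i ?_).symm) h'
  have h1 := hi.1
  have h2 := hi.2
  have h3 : n * spacing w ≤ (n + j) * spacing w := Nat.mul_le_mul_right _ (by omega)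
  have h4 : (n + j + 1) * spacing w ≤ (n + k) * spacing w := Nat.mul_le_mul_right _ (by omega)
  have h5 : (n + j + 1) * spacing w = (n + j) * spacing w + (w.length + 1) := by
    rw [spacing]; ring
  rw [List.length_reverse] at h2
  constructor <;> omega

lemma measurableSet_noWord (n k : ℕ) : MeasurableSet (NoWord e P w n k) := by
  simp only [NoWord, Set.ofPred_forall]
  exact .iInter fun j => .iInter fun _ => (measurableSet_spells _ _).compl

lemma lawU_spells_eq (s : ℤ) (c : List A) :
    lawU {U | Spells e P U s c} = lawU {U | Spells e P U 0 c} := by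
  rw [← lawU_preimage_shift (measurableSet_spells 0 c) s]
  congr 1
  ext U
  simp [spells_shift]

/-- The copies are looked for on disjoint stretches, hence independently. The extra one in `spacing`
keeps it positive when `w` is empty. -/
lemma lawU_noWord (n k : ℕ) :
    lawU (NoWord e P w n k) = (1 - lawU {U | Spells e P U 0 w.reverse}) ^ k := by
  induction k with
  | zero => simp [NoWord]
  | succ k ih =>
    have : NoWord e P w n (k + 1) = NoWord e P w n k ∩
        {U | Spells e P U (((n + k) * spacing w : ℕ) : ℤ) w.reverse}ᶜ := by
      ext U
      simp only [NoWord, Set.mem_ofPred_eq, Set.mem_inter_iff, Set.mem_compl_iff,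
        Nat.lt_succ_iff_lt_or_eq]
      constructor
      · exact fun h => ⟨fun j hj => h j (Or.inl hj), h k (Or.inr rfl)⟩
      · rintro ⟨h1, h2⟩ j (hj | rfl)
        exacts [h1 j hj, h2]
    rw [this, lawU_inter (measurableSet_noWord n k) (measurableSet_spells _ _).compl
      (dependsOnSites_noWord n k) (dependsOnSites_spells _ _).compl, ih,
      prob_compl_eq_one_sub (measurableSet_spells _ _),
      lawU_spells_eq (((n + k) * spacing w : ℕ) : ℤ), pow_succ]
    refine Set.disjoint_left.2 fun i hi hi' => ?_
    exact absurd hi'.1 (not_le.2 hi.2)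

lemma unif_Ici_le (x : ℝ) : unif (Set.Ici x) ≤ ENNReal.ofReal (1 - x) := by
  rw [unif, Measure.restrict_apply measurableSet_Ici, ← Real.volume_Ico]
  exact measure_mono fun u hu => ⟨hu.1, hu.2.2⟩

lemma lawU_badWindow_le (n : ℕ) : lawU (BadWindow e P w n) ≤
    (2 * spacing w : ℕ) * ENNReal.ofReal (1 - alphaW P w n) +
      (1 - lawU {U | Spells e P U 0 w.reverse}) ^ n := by
  refine (measure_union_le _ _).trans (add_le_add ?_ (lawU_noWord n n).le)
  refine (measure_biUnion_finset_le _ _).trans ?_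
  refine (Finset.sum_le_card_nsmul _ _ (ENNReal.ofReal (1 - alphaW P w n)) fun r _ => ?_).trans ?_
  · exact (lawU_eval _ measurableSet_Ici).le.trans (unif_Ici_le _)
  · simp

/-- The first terms are a fixed multiple of `1 - α_n`, the others a geometric series whose ratio is
below one because `w` is spelled with positive probability. -/
lemma tsum_lawU_badWindow_ne_top [Nonempty A] (hP : IsKernel P)
    (hw : ∀ a ∈ w, a ∈ spontaneousSymbols P)
    (hsum : Summable fun k : ℕ => 1 - alphaW P w k) :
    ∑' n, lawU (BadWindow e P w n) ≠ ⊤ := by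
  refine ne_top_of_le_ne_top ?_ (ENNReal.tsum_le_tsum lawU_badWindow_le)
  rw [ENNReal.tsum_add, ENNReal.tsum_mul_left, ENNReal.tsum_geometric]
  refine ENNReal.add_ne_top.2 ⟨ENNReal.mul_ne_top (ENNReal.natCast_ne_top _) ?_, ?_⟩
  · exact hsum.tsum_ofReal_ne_top
  · rw [ENNReal.inv_ne_top]
    have hpos := lawU_spells_pos (e := e) hP 0 (c := w.reverse) fun a ha =>
      hw a (List.mem_reverse.1 ha)
    rw [ENNReal.sub_sub_cancel ENNReal.one_ne_top prob_le_one]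
    exact hpos.ne'

lemma measurableSet_badWindow (n : ℕ) : MeasurableSet (BadWindow e P w n) := by
  refine MeasurableSet.union ?_ (measurableSet_noWord _ _)
  exact Finset.measurableSet_biUnion _ fun r _ => (measurable_pi_apply _) measurableSet_Ici

lemma measurableSet_neverStuck (K N : ℕ) : MeasurableSet (NeverStuck e P w K N) := by
  refine MeasurableSet.inter (MeasurableSet.inter ?_ ?_) ?_
  · simp only [Set.ofPred_forall]
    exact .iInter fun t => (measurable_pi_apply (t : ℤ)) measurableSet_Ici
  · simp only [Set.ofPred_forall]
    exact .iInter fun t => .iInter fun _ => (measurable_pi_apply (t : ℤ)) measurableSet_Iio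
  · simp only [Set.ofPred_forall]
    exact .iInter fun t => .iInter fun _ => (measurableSet_badWindow t).compl

lemma dependsOnSites_neverStuck (K N : ℕ) : DependsOnSites (NeverStuck e P w K N) (Set.Ici 0) := by
  rintro U U' hU ⟨⟨h0, h1⟩, h2⟩
  have hU' : ∀ t : ℕ, U t = U' t := fun t => hU t (Int.natCast_nonneg t)
  refine ⟨⟨fun t => hU' t ▸ h0 t, fun t ht => hU' t ▸ h1 t ht⟩, fun n hn hb => h2 n hn ?_⟩
  rcases hb with hb | hb
  · left
    obtain ⟨r, hr, hb⟩ := Set.mem_iUnion₂.1 hb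
    refine Set.mem_biUnion hr ?_
    rw [Set.mem_ofPred_eq] at hb ⊢
    rwa [hU']
  · right
    exact dependsOnSites_noWord n n (fun i hi => (hU i (le_trans (by positivity) hi.1)).symm) hb

/-- `N` is chosen first, to make the tail of bad windows less than `1/2`, then `K`, to make the
finitely many earlier failures less than `1/2`. No independence is needed here. -/
lemma exists_lawU_neverStuck_pos [Nonempty A] (hP : IsKernel P)
    (hw : ∀ a ∈ w, a ∈ spontaneousSymbols P)
    (hsum : Summable fun k : ℕ => 1 - alphaW P w k) :
    ∃ K N, 0 < lawU (NeverStuck e P w K N) := by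
  have hhalf : (0 : ℝ≥0∞) < 1 / 2 := by norm_num
  obtain ⟨N, hN⟩ := ((ENNReal.tendsto_sum_nat_add (fun n => lawU (BadWindow e P w n))
    (tsum_lawU_badWindow_ne_top hP hw hsum)).eventually (gt_mem_nhds hhalf)).exists
  have hlim : Filter.Tendsto (fun K => (2 * spacing w * N : ℕ) *
      ENNReal.ofReal (1 - alphaW P w K)) Filter.atTop (nhds 0) := by
    have h1 := ENNReal.tendsto_ofReal hsum.tendsto_atTop_zero
    rw [ENNReal.ofReal_zero] at h1
    simpa using ENNReal.Tendsto.const_mul h1 (Or.inr (ENNReal.natCast_ne_top (2 * spacing w * N)))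
  obtain ⟨K, hK⟩ := (hlim.eventually (gt_mem_nhds hhalf)).exists
  refine ⟨K, N, ?_⟩
  have hsub : (NeverStuck e P w K N)ᶜ ⊆ {U | ∀ i, U i ∈ Set.Ico (0 : ℝ) 1}ᶜ ∪
      ((⋃ t ∈ Finset.range (2 * spacing w * N), {U : ℤ → ℝ | alphaW P w K ≤ U (t : ℤ)}) ∪
        ⋃ n, BadWindow e P w (n + N)) := by
    intro U hU
    by_contra hc
    simp only [Set.mem_union, not_or, Set.mem_compl_iff, not_not, Set.mem_iUnion, not_exists,
      Set.mem_ofPred_eq, not_le, Finset.mem_range] at hc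
    refine hU ⟨⟨fun t => (hc.1 t).1, fun t ht => hc.2.1 t ht⟩, fun n hn => ?_⟩
    obtain ⟨j, rfl⟩ := Nat.exists_eq_add_of_le hn
    rw [add_comm]
    exact hc.2.2 j
  have hlt : lawU (NeverStuck e P w K N)ᶜ < 1 := by
    calc lawU (NeverStuck e P w K N)ᶜ
        ≤ 0 + ((2 * spacing w * N : ℕ) * ENNReal.ofReal (1 - alphaW P w K) +
          ∑' n, lawU (BadWindow e P w (n + N))) := by
          refine (measure_mono hsub).trans ((measure_union_le _ _).trans (add_le_add ?_ ?_))
          · exact (ae_iff.1 ae_mem_Ico).le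
          · refine (measure_union_le _ _).trans (add_le_add ?_ (measure_iUnion_le _))
            refine (measure_biUnion_finset_le _ _).trans ?_
            refine (Finset.sum_le_card_nsmul _ _ (ENNReal.ofReal (1 - alphaW P w K))
              fun r _ => ?_).trans ?_
            · exact (lawU_eval _ measurableSet_Ici).le.trans (unif_Ici_le _)
            · simp
      _ < 1 / 2 + 1 / 2 := by rw [zero_add]; exact ENNReal.add_lt_add hK hN
      _ = 1 := by simp [ENNReal.inv_two_add_inv_two]
  rw [pos_iff_ne_zero]
  intro h0
  rw [prob_compl_eq_one_sub (measurableSet_neverStuck K N), h0] at hlt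
  simp at hlt

/-- Spelling `K` copies of a spontaneous symbol and then `w` provides the start required by
`NeverStuck`, and the two events concern disjoint sites. -/
lemma lawU_isRegeneration_pos [Countable A] [Nonempty A] (hP : IsKernel P)
    (hE : (spontaneousSymbols P).Nonempty) (hw : ∀ a ∈ w, a ∈ spontaneousSymbols P)
    (hsum : Summable fun k : ℕ => 1 - alphaW P w k) :
    0 < lawU {U | IsRegeneration e P w U 0} := by
  obtain ⟨a, ha⟩ := hE
  obtain ⟨K, N, hpos⟩ := exists_lawU_neverStuck_pos (e := e) hP hw hsum
  set c := List.replicate K a ++ w.reverse with hc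
  have hcE : ∀ b ∈ c, b ∈ spontaneousSymbols P := by
    intro b hb
    rcases List.mem_append.1 hb with hb | hb
    · exact (List.eq_of_mem_replicate hb) ▸ ha
    · exact hw b (List.mem_reverse.1 hb)
  have hsub : {U | Spells e P U 0 c} ∩ shift c.length ⁻¹' NeverStuck e P w K N ⊆
      {U | IsRegeneration e P w U 0} := by
    rintro U ⟨h1, h2⟩
    have := run_of_spells (w := w) hP (run_zero U 0) (c := c) (by simpa using h1)
    refine isRegeneration_of_neverStuck (M := c.length) (K := K) (c := List.replicate K a) hP (by simp) ?_
      (by rw [zero_add]; exact h2)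
    rw [zero_add] at this
    rw [this, hc]
    simp
  refine lt_of_lt_of_le ?_ (measure_mono hsub)
  rw [lawU_inter (measurableSet_spells 0 c) (measurable_shift _ (measurableSet_neverStuck K N))
    (dependsOnSites_spells 0 c) ((dependsOnSites_neverStuck K N).preimage_shift _),
    lawU_preimage_shift (measurableSet_neverStuck K N)]
  · exact ENNReal.mul_pos (lawU_spells_pos hP 0 hcE).ne' hpos.ne'
  · refine Set.disjoint_left.2 fun i hi hi' => ?_
    obtain ⟨j, hj, rfl⟩ := hi'
    have h1 := hi.2
    have h2 : (0 : ℤ) ≤ j := hj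
    simp only at h1
    omega

lemma lawU_isRegeneration_eq [Countable A] [Nonempty A] (hP : IsKernel P) (s : ℤ) :
    lawU {U | IsRegeneration e P w U s} = lawU {U | IsRegeneration e P w U 0} := by
  rw [← lawU_preimage_shift (measurableSet_isRegeneration hP 0) s]
  congr 1
  ext U
  simp [isRegeneration_shift]

/-- Each event `E N` has probability at least that of a regeneration at `0`, hence so has their
decreasing intersection. It is a tail event, so its probability is one. -/
lemma ae_exists_ge [Countable A] [Nonempty A] (hP : IsKernel P)
    (hE : (spontaneousSymbols P).Nonempty) (hw : ∀ a ∈ w, a ∈ spontaneousSymbols P)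
    (hsum : Summable fun k : ℕ => 1 - alphaW P w k) :
    ∀ᵐ U ∂lawU, ∀ N : ℤ, ∃ s ≥ N, IsRegeneration e P w U s := by
  set E : ℤ → Set (ℤ → ℝ) := fun N => ⋃ s ∈ Set.Ici N, {U | IsRegeneration e P w U s} with hEdef
  have hEm : ∀ N, MeasurableSet (E N) := fun N =>
    .biUnion (Set.to_countable _) fun s _ => measurableSet_isRegeneration hP s
  have hEanti : Antitone E := fun M N hMN =>
    Set.biUnion_subset_biUnion_left (Set.Ici_subset_Ici.2 hMN)
  have hset : {U | ∀ N : ℤ, ∃ s ≥ N, IsRegeneration e P w U s} = ⋂ N, E N := by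
    ext U; simp [hEdef]
  have hpos : lawU (⋂ N, E N) ≠ 0 := by
    have hlim := tendsto_measure_iInter_atTop (μ := lawU) (fun N => (hEm N).nullMeasurableSet)
      hEanti ⟨0, measure_ne_top _ _⟩
    have hge : lawU {U | IsRegeneration e P w U 0} ≤ lawU (⋂ N, E N) := by
      refine ge_of_tendsto' hlim fun N => ?_
      rw [← lawU_isRegeneration_eq hP N]
      exact measure_mono fun U hU => Set.mem_biUnion (Set.mem_Ici.2 le_rfl) hU
    exact (lt_of_lt_of_le (lawU_isRegeneration_pos hP hE hw hsum) hge).ne'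
  -- Regenerations beyond `max N k` suffice, and they ignore the coordinates below `k`.
  have htail : ∀ k : ℤ, DependsOnSites (⋂ N, E N) (Set.Ici k) := by
    intro k U U' hU h
    refine Set.mem_iInter.2 fun N => ?_
    obtain ⟨s, hs, hR⟩ := Set.mem_iUnion₂.1 (Set.mem_iInter.1 h (max N k))
    refine Set.mem_biUnion (Set.mem_Ici.2 ((le_max_left N k).trans hs)) ?_
    exact dependsOnSites_isRegeneration s
      (fun i hi => hU i ((le_max_right N k).trans (le_trans hs hi))) hR
  have hms : MeasurableSet (⋂ N, E N) := .iInter hEm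
  have h01 := measure_zero_or_one_of_measurableSet_limsup_atTop (μ := lawU)
    (fun i : ℤ => (measurable_pi_apply i).comap_le) iIndep_coordinates (t := ⋂ N, E N) (by
      rw [Filter.atTop_basis.limsup_eq_iInf_iSup]
      simp only [MeasurableSpace.measurableSet_iInf]
      exact fun k _ => (htail k).measurableSet hms)
  rw [← hset] at h01 hpos hms
  exact (prob_compl_eq_zero_iff hms).2 (h01.resolve_left hpos)

/-- No construction that starts at one of the sites `0, …, k` goes on forever. -/
def NoRegeneration (e : A ↪ ℕ) (P : A → (ℕ → A) → ℝ) (w : List A) (k : ℕ) : Set (ℤ → ℝ) :=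
  ⋂ s ∈ Set.Icc (0 : ℤ) k, {U | IsRegeneration e P w U s}ᶜ

lemma measurableSet_noRegeneration [Countable A] [Nonempty A] (hP : IsKernel P) (k : ℕ) :
    MeasurableSet (NoRegeneration e P w k) :=
  .biInter (Set.to_countable _) fun s _ => (measurableSet_isRegeneration hP s).compl

lemma tendsto_noRegeneration [Countable A] [Nonempty A] (hP : IsKernel P)
    (hE : (spontaneousSymbols P).Nonempty) (hw : ∀ a ∈ w, a ∈ spontaneousSymbols P)
    (hsum : Summable fun k : ℕ => 1 - alphaW P w k) :
    Filter.Tendsto (fun k => lawU (NoRegeneration e P w k)) Filter.atTop (nhds 0) := by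
  have hanti : Antitone (NoRegeneration e P w) := fun i j hij =>
    Set.biInter_subset_biInter_left (Set.Icc_subset_Icc_right (by exact_mod_cast hij))
  have hlim := tendsto_measure_iInter_atTop (μ := lawU)
    (fun k => (measurableSet_noRegeneration hP k).nullMeasurableSet) hanti ⟨0, measure_ne_top _ _⟩
  have h0 : lawU (⋂ k, NoRegeneration e P w k) = 0 := by
    refine measure_mono_null ?_ (ae_iff.1 (ae_exists_ge (e := e) hP hE hw hsum))
    intro U hU hU'
    obtain ⟨s, hs, hR⟩ := hU' 0
    obtain ⟨k, rfl⟩ := Int.eq_ofNat_of_zero_le hs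
    exact Set.mem_iInter₂.1 (Set.mem_iInter.1 hU k) k ⟨hs, le_rfl⟩ hR
  rwa [h0] at hlim

/-- A regeneration depends on the whole future, so this is not a tail event at `-∞`. Instead, by
stationarity, the absence of regenerations up to `N` is no likelier than their absence from `0, …,
k`. -/
lemma ae_exists_le [Countable A] [Nonempty A] (hP : IsKernel P)
    (hE : (spontaneousSymbols P).Nonempty) (hw : ∀ a ∈ w, a ∈ spontaneousSymbols P)
    (hsum : Summable fun k : ℕ => 1 - alphaW P w k) :
    ∀ᵐ U ∂lawU, ∀ N : ℤ, ∃ s ≤ N, IsRegeneration e P w U s := by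
  rw [ae_all_iff]
  intro N
  rw [ae_iff]
  refine le_antisymm (ge_of_tendsto' (tendsto_noRegeneration (e := e) hP hE hw hsum) fun k => ?_) zero_le
  rw [← lawU_preimage_shift (measurableSet_noRegeneration hP k) (N - k)]
  refine measure_mono fun U hU => ?_
  refine Set.mem_iInter₂.2 fun s hs hR => hU ⟨s + (N - k), ?_, (isRegeneration_shift U s _).1 hR⟩
  have := hs.2
  omega

lemma ae_isTypical [Countable A] [Nonempty A] (hP : IsKernel P)
    (hE : (spontaneousSymbols P).Nonempty) (hw : ∀ a ∈ w, a ∈ spontaneousSymbols P)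
    (hsum : Summable fun k : ℕ => 1 - alphaW P w k) :
    ∀ᵐ U ∂lawU, IsTypical e P w U := by
  filter_upwards [ae_mem_Ico, ae_exists_le (e := e) hP hE hw hsum,
    ae_exists_ge (e := e) hP hE hw hsum] with U h1 h2 h3
  exact ⟨h1, h2, h3⟩

end Regeneration

/-! ### Compatibility with the kernel -/

section Compatibility

variable {A : Type*} {e : A ↪ ℕ} {P : A → (ℕ → A) → ℝ} {w : List A}

lemma pastOf_eq (x : ℤ → A) : pastOf x = pastAt x 0 := by
  ext n; simp only [pastOf, pastAt]; congr 1; ring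

lemma pastAt_shift (x : ℤ → A) (k t : ℤ) : pastAt (shift k x) t = pastAt x (t + k) := by
  ext n; simp only [pastAt, shift]; congr 1; ring

lemma pastOf_shift (x : ℤ → A) (k : ℤ) : pastOf (shift k x) = pastAt x k := by
  rw [pastOf_eq, pastAt_shift, zero_add]

/-- The pasts whose most recent symbols are those of `c`, preceded by a past in `B`. -/
def prepend (B : Set (ℕ → A)) : List A → Set (ℕ → A)
  | [] => B
  | a :: c => {z | z 0 = a ∧ (fun n => z (n + 1)) ∈ prepend B c}

lemma hasWord_of_tail {z : ℕ → A} {k : ℕ} (h : HasWord w fun n => z (n + k)) : HasWord w z := by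
  obtain ⟨n, m, hm, hmn⟩ := h
  have hw := (exists_of_distOcc_eq hm).1
  have hpre : pre z (k + n) = pre z k ++ pre (fun j => z (j + k)) n := pre_add z k n
  have hocc : w <+: (pre z (k + n)).drop (k + m) := by
    rw [hpre, ← List.drop_drop, List.drop_left' (length_pre _ _)]
    exact hw
  have hle := distOcc_le_of_isPrefix hocc
  obtain ⟨m', hm'⟩ := ENat.ne_top_iff_exists.1 (ne_top_of_le_ne_top (ENat.natCast_ne_top _) hle)
  rw [← hm'] at hle
  have : m' ≤ k + m := by exact_mod_cast hle
  exact ⟨k + n, m', hm'.symm, by omega⟩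

lemma hasWord_of_mem_prepend {B : Set (ℕ → A)} {z : ℕ → A} (hz : z ∈ prepend B w) :
    HasWord w z := by
  have key : ∀ (c : List A) (z : ℕ → A), z ∈ prepend B c → pre z c.length = c := by
    intro c
    induction c with
    | nil => intro z _; rfl
    | cons a c ih =>
      intro z hz
      rw [List.length_cons, pre_succ', ih _ hz.2, hz.1]
  refine ⟨w.length, 0, distOcc_eq_of ?_ (by simp), by simp⟩
  rw [key w z hz]
  simp

lemma tail_mem_of_mem_prepend {B : Set (ℕ → A)} {c : List A} {z : ℕ → A} (hz : z ∈ prepend B c) :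
    (fun n => z (n + c.length)) ∈ B := by
  induction c generalizing z with
  | nil => exact hz
  | cons a c ih =>
    have := ih hz.2
    simpa only [List.length_cons, add_assoc] using this

variable [MeasurableSpace A]

lemma measurable_pastOf : Measurable (pastOf (A := A)) :=
  measurable_pi_lambda _ fun _ => measurable_pi_apply _

lemma measurable_pastAt (t : ℤ) : Measurable fun x : ℤ → A => pastAt x t :=
  measurable_pi_lambda _ fun _ => measurable_pi_apply _

lemma measurable_tail : Measurable fun (z : ℕ → A) (n : ℕ) => z (n + 1) :=
  measurable_pi_lambda _ fun _ => measurable_pi_apply _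

lemma measurePreserving_shift_of_stationary {ν : Measure (ℤ → A)}
    (hν : MeasurePreserving (fun (x : ℤ → A) (n : ℤ) => x (n + 1)) ν ν) (k : ℕ) :
    MeasurePreserving (shift (k : ℤ)) ν ν := by
  induction k with
  | zero => convert MeasurePreserving.id ν; ext x n; simp [shift]
  | succ k ih =>
    convert hν.comp ih using 1
    ext x n
    simp only [shift, Function.comp_apply]
    congr 1
    push_cast
    ring

/-- With the chain `ν`, the symbol after the past is obtained from the past and an independent
uniform variable. -/
def FollowsUpdate [Nonempty A] (e : A ↪ ℕ) (P : A → (ℕ → A) → ℝ) (w : List A)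
    (ν : Measure (ℤ → A)) : Prop :=
  ∀ (B : Set (ℕ → A)), MeasurableSet B → ∀ a : A,
    ν (pastOf ⁻¹' B ∩ {x | x 0 = a}) =
      ∫⁻ z in B, unif {u | nextSymbol e P w z u = a} ∂(ν.map pastOf)

/-- With its analogue for `IsStationaryCompatible`, this minorization lets `ae_hasWord` serve both
the constructed chain and an arbitrary compatible one. -/
lemma FollowsUpdate.le_measure [Nonempty A] (hP : IsKernel P) {ν : Measure (ℤ → A)}
    (hν : FollowsUpdate e P w ν) {B : Set (ℕ → A)} (hB : MeasurableSet B) (a : A) :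
    ENNReal.ofReal (lowerProb P a []) * ν (pastOf ⁻¹' B) ≤ ν (pastOf ⁻¹' B ∩ {x | x 0 = a}) := by
  rw [hν B hB, ← Measure.map_apply measurable_pastOf hB, ← setLIntegral_const,
    ← unif_intervalI (e := e) hP]
  exact lintegral_mono fun z => measure_mono fun u hu => nextSymbol_eq hP ⟨0, Or.inl hu⟩

variable [Countable A] [DiscreteMeasurableSpace A]

lemma measurableSet_coord_eq (t : ℤ) (a : A) : MeasurableSet {x : ℤ → A | x t = a} :=
  (measurable_pi_apply t : Measurable fun x : ℤ → A => x t) (measurableSet_singleton a)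

lemma measurableSet_prepend {B : Set (ℕ → A)} (hB : MeasurableSet B) (c : List A) :
    MeasurableSet (prepend B c) := by
  induction c with
  | nil => exact hB
  | cons a c ih =>
    exact ((measurable_pi_apply 0) (measurableSet_singleton a)).inter (measurable_tail ih)

lemma IsStationaryCompatible.measure_eq (hP : IsKernel P) {ν : Measure (ℤ → A)}
    (hν : IsStationaryCompatible P ν) {B : Set (ℕ → A)} (hB : MeasurableSet B) (a : A) :
    ν (pastOf ⁻¹' B ∩ {x | x 0 = a}) =
      ∫⁻ x in pastOf ⁻¹' B, ENNReal.ofReal (P a (pastOf x)) ∂ν := by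
  have := hν.isProbabilityMeasure
  have hind : Integrable (Set.indicator {x : ℤ → A | x 0 = a} (fun _ => (1 : ℝ))) ν :=
    (integrable_const 1).indicator (measurableSet_coord_eq 0 a)
  have h1 := setIntegral_condExp measurable_pastOf.comap_le hind (s := pastOf ⁻¹' B) ⟨B, hB, rfl⟩
  -- A kernel is not assumed measurable; integrability is inherited from the conditional expectation
  -- it equals almost everywhere.
  have hint : Integrable (fun x => P a (pastOf x)) ν :=
    integrable_condExp.congr (hν.compatible a)
  rw [setIntegral_congr_ae (measurable_pastOf hB)
    ((hν.compatible a).mono fun x hx _ => hx),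
    setIntegral_indicator (measurableSet_coord_eq 0 a), setIntegral_const, smul_eq_mul,
    mul_one] at h1
  rw [← ofReal_integral_eq_lintegral_ofReal hint.integrableOn (.of_forall fun x => hP.nonneg _ _),
    h1, Measure.real, ENNReal.ofReal_toReal (measure_ne_top _ _)]

lemma measure_prepend_cons {ν : Measure (ℤ → A)}
    (hν : MeasurePreserving (fun (x : ℤ → A) (n : ℤ) => x (n + 1)) ν ν) {B : Set (ℕ → A)}
    (hB : MeasurableSet B) (a : A) :
    ν (pastOf ⁻¹' {z | z 0 = a ∧ (fun n => z (n + 1)) ∈ B}) =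
      ν (pastOf ⁻¹' B ∩ {x | x 0 = a}) := by
  have hm : MeasurableSet {z : ℕ → A | z 0 = a ∧ (fun n => z (n + 1)) ∈ B} :=
    measurableSet_prepend hB [a]
  rw [← ((measurePreserving_shift_of_stationary hν) 1).measure_preimage
    (measurable_pastOf hm).nullMeasurableSet]
  congr 1
  ext x
  have h1 : pastOf (shift ((1 : ℕ) : ℤ) x) 0 = x 0 := by simp [pastOf, shift]
  have h2 : (fun n => pastOf (shift ((1 : ℕ) : ℤ) x) (n + 1)) = pastOf x := by
    ext n; simp only [pastOf, shift]; congr 1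
  simp only [Set.mem_preimage, Set.mem_ofPred_eq, Set.mem_inter_iff, h1, h2]
  exact and_comm

lemma measurable_unif_nextSymbol [Nonempty A] (hP : IsKernel P) (a : A) :
    Measurable fun z => unif {u | nextSymbol e P w z u = a} :=
  measurable_measure_prodMk_left (ν := unif)
    (s := {p : (ℕ → A) × ℝ | nextSymbol e P w p.1 p.2 = a})
    (measurable_nextSymbol hP (measurableSet_singleton a))

/-- The function `q`, measurable by construction, is a version of the conditional probability. It
agrees with `P a` on pasts containing `w`, hence almost everywhere. -/
lemma FollowsUpdate.compatible [Nonempty A] (hP : IsKernel P)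
    (hsum : Summable fun k : ℕ => 1 - alphaW P w k)
    {ν : Measure (ℤ → A)} [IsProbabilityMeasure ν] (hν : FollowsUpdate e P w ν)
    (hword : ∀ᵐ x ∂ν, HasWord w (pastOf x)) (a : A) :
    ν[Set.indicator {x : ℤ → A | x 0 = a} (fun _ => (1 : ℝ)) |
      MeasurableSpace.comap (pastOf (A := A)) MeasurableSpace.pi] =ᵐ[ν] fun x => P a (pastOf x) := by
  set q : (ℕ → A) → ℝ := fun z => (unif {u | nextSymbol e P w z u = a}).toReal with hq
  have hqm : Measurable q := (measurable_unif_nextSymbol hP a).ennreal_toReal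
  have hq1 : ∀ z, ‖q z‖ ≤ 1 := fun z => by
    rw [Real.norm_of_nonneg ENNReal.toReal_nonneg]
    exact ENNReal.toReal_le_of_le_ofReal zero_le_one (by simpa using prob_le_one)
  have hqi : Integrable (fun x => q (pastOf x)) ν :=
    Integrable.of_bound (hqm.comp measurable_pastOf).aestronglyMeasurable 1 (.of_forall fun x => hq1 _)
  have hqP : (fun x => q (pastOf x)) =ᵐ[ν] fun x => P a (pastOf x) := by
    filter_upwards [hword] with x hx
    simp only [hq]
    rw [unif_nextSymbol_eq hP hsum hx, ENNReal.toReal_ofReal (hP.nonneg _ _)]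
  refine Filter.EventuallyEq.trans (Filter.EventuallyEq.symm ?_) hqP
  have hind : Integrable (Set.indicator {x : ℤ → A | x 0 = a} (fun _ => (1 : ℝ))) ν :=
    (integrable_const 1).indicator (measurableSet_coord_eq 0 a)
  refine ae_eq_condExp_of_forall_setIntegral_eq measurable_pastOf.comap_le hind
    (fun _ _ _ => hqi.integrableOn) ?_ ?_
  · rintro _ ⟨B, hB, rfl⟩ -
    rw [setIntegral_indicator (measurableSet_coord_eq 0 a), setIntegral_const, smul_eq_mul, mul_one,
      Measure.real, hν B hB a]
    rw [← setIntegral_map (f := q) (g := pastOf) hB hqm.aestronglyMeasurable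
      measurable_pastOf.aemeasurable]
    rw [integral_toReal (measurable_unif_nextSymbol hP a).aemeasurable
      (.of_forall fun z => measure_lt_top _ _)]
  · exact (hqm.comp (comap_measurable _)).aestronglyMeasurable

lemma IsStationaryCompatible.le_measure (hP : IsKernel P) {ν : Measure (ℤ → A)}
    (hν : IsStationaryCompatible P ν) {B : Set (ℕ → A)} (hB : MeasurableSet B) (a : A) :
    ENNReal.ofReal (lowerProb P a []) * ν (pastOf ⁻¹' B) ≤ ν (pastOf ⁻¹' B ∩ {x | x 0 = a}) := by
  rw [hν.measure_eq hP hB, ← setLIntegral_const]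
  exact lintegral_mono fun x => ENNReal.ofReal_le_ofReal (lowerProb_pre_le hP a _ 0)

lemma exists_le_prepend {ν : Measure (ℤ → A)}
    (hν : MeasurePreserving (fun (x : ℤ → A) (n : ℤ) => x (n + 1)) ν ν)
    (hle : ∀ (B : Set (ℕ → A)), MeasurableSet B → ∀ a : A,
      ENNReal.ofReal (lowerProb P a []) * ν (pastOf ⁻¹' B) ≤ ν (pastOf ⁻¹' B ∩ {x | x 0 = a}))
    {B : Set (ℕ → A)} (hB : MeasurableSet B) {c : List A}
    (hc : ∀ a ∈ c, a ∈ spontaneousSymbols P) :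
    ∃ δ : ℝ≥0∞, δ ≠ 0 ∧ δ * ν (pastOf ⁻¹' B) ≤ ν (pastOf ⁻¹' prepend B c) := by
  induction c with
  | nil => exact ⟨1, one_ne_zero, by simp [prepend]⟩
  | cons a c ih =>
    obtain ⟨δ, hδ, h⟩ := ih fun b hb => hc b (List.mem_cons_of_mem _ hb)
    refine ⟨ENNReal.ofReal (lowerProb P a []) * δ,
      mul_ne_zero (ENNReal.ofReal_pos.2 (hc a List.mem_cons_self)).ne' hδ, ?_⟩
    rw [prepend, measure_prepend_cons hν (measurableSet_prepend hB c)]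
    refine le_trans ?_ (hle _ (measurableSet_prepend hB c) a)
    rw [mul_assoc]
    gcongr

/-- Let `B` be the pasts without `w`. The pasts whose tail beyond `|w|` symbols lies in `B` have the
measure of `B`, but they include both `B` and the disjoint set of pasts `w z` with `z ∈ B`. The
latter is therefore null, while spontaneity of `w` bounds it below by a positive multiple of the
measure of `B`. -/
lemma ae_hasWord {ν : Measure (ℤ → A)} [IsProbabilityMeasure ν]
    (hν : MeasurePreserving (fun (x : ℤ → A) (n : ℤ) => x (n + 1)) ν ν)
    (hle : ∀ (B : Set (ℕ → A)), MeasurableSet B → ∀ a : A,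
      ENNReal.ofReal (lowerProb P a []) * ν (pastOf ⁻¹' B) ≤ ν (pastOf ⁻¹' B ∩ {x | x 0 = a}))
    (hw : ∀ a ∈ w, a ∈ spontaneousSymbols P) :
    ∀ᵐ x ∂ν, HasWord w (pastOf x) := by
  set B : Set (ℕ → A) := {z | HasWord w z}ᶜ with hBdef
  have hB : MeasurableSet B := measurableSet_hasWord.compl
  obtain ⟨δ, hδ, hle⟩ := exists_le_prepend hν hle hB hw
  set L := w.length
  have htm : Measurable fun (z : ℕ → A) (n : ℕ) => z (n + L) :=
    measurable_pi_lambda _ fun _ => measurable_pi_apply _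
  have heq : ν (pastOf ⁻¹' ((fun (z : ℕ → A) (n : ℕ) => z (n + L)) ⁻¹' B)) = ν (pastOf ⁻¹' B) := by
    rw [← ((measurePreserving_shift_of_stationary hν) L).measure_preimage
      (measurable_pastOf (htm hB)).nullMeasurableSet]
    congr 1
    ext x
    have h2 : (fun n => pastOf (shift (L : ℤ) x) (n + L)) = pastOf x := by
      ext n; simp only [pastOf, shift]; congr 1; push_cast; ring
    simp only [Set.mem_preimage, h2]
  have hsub : pastOf ⁻¹' B ∪ pastOf ⁻¹' prepend B w ⊆
      pastOf ⁻¹' ((fun (z : ℕ → A) (n : ℕ) => z (n + L)) ⁻¹' B) := by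
    rintro x (hx | hx)
    · exact fun h => hx (hasWord_of_tail h)
    · exact tail_mem_of_mem_prepend hx
  have hdisj : Disjoint (pastOf ⁻¹' B) (pastOf ⁻¹' prepend B w) :=
    Set.disjoint_left.2 fun x hx hx' => hx (hasWord_of_mem_prepend hx')
  have h1 := measure_mono (μ := ν) hsub
  rw [measure_union hdisj (measurable_pastOf (measurableSet_prepend hB w)), heq] at h1
  have h2 : ν (pastOf ⁻¹' prepend B w) = 0 := by
    have : ν (pastOf ⁻¹' B) + ν (pastOf ⁻¹' prepend B w) ≤ ν (pastOf ⁻¹' B) + 0 := by simpa using h1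
    exact le_antisymm ((ENNReal.add_le_add_iff_left (measure_ne_top _ _)).1 this) zero_le
  rw [h2] at hle
  have h3 : ν (pastOf ⁻¹' B) = 0 := by
    rcases mul_eq_zero.1 (le_antisymm hle zero_le) with h | h
    · exact absurd h hδ
    · exact h
  exact h3

variable [Nonempty A]

lemma IsStationaryCompatible.followsUpdate (hP : IsKernel P)
    (hsum : Summable fun k : ℕ => 1 - alphaW P w k) {ν : Measure (ℤ → A)}
    (hν : IsStationaryCompatible P ν) (hw : ∀ a ∈ w, a ∈ spontaneousSymbols P) :
    FollowsUpdate e P w ν := by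
  intro B hB a
  rw [hν.measure_eq hP hB, setLIntegral_map hB (measurable_unif_nextSymbol hP a) measurable_pastOf]
  refine lintegral_congr_ae (ae_restrict_of_ae ?_)
  have := hν.isProbabilityMeasure
  filter_upwards [ae_hasWord hν.stationary (fun _ hB a => hν.le_measure hP hB a) hw] with x hx
  rw [unif_nextSymbol_eq hP hsum hx]

/-! ### The constructed chain -/

lemma map_chain_stationary (hP : IsKernel P) :
    MeasurePreserving (fun (x : ℤ → A) (n : ℤ) => x (n + 1)) (lawU.map (chain e P w))
      (lawU.map (chain e P w)) := by
  refine ⟨measurable_shift 1, ?_⟩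
  have h : (fun (x : ℤ → A) (n : ℤ) => x (n + 1)) = shift 1 := rfl
  rw [h, Measure.map_map (measurable_shift 1) (measurable_chain hP)]
  have : shift 1 ∘ chain e P w = chain e P w ∘ shift 1 := by
    ext U : 1
    exact (chain_shift U 1).symm
  rw [this, ← Measure.map_map (measurable_chain hP) (measurable_shift 1),
    (InfiniteMemory.measurePreserving_shift 1).map_eq]

/-- The past of time `0` is a function of the negative coordinates, hence independent of `U 0`. -/
lemma map_chain_pastOf_coord (hP : IsKernel P) :
    lawU.map (fun U => (pastOf (chain e P w U), U 0)) =
      ((lawU.map (chain e P w)).map pastOf).prod unif := by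
  have hm1 : Measurable fun U => pastOf (chain e P w U) :=
    measurable_pastOf.comp (measurable_chain hP)
  have hm2 : Measurable fun U : ℤ → ℝ => U 0 := measurable_pi_apply 0
  have := Measure.isProbabilityMeasure_map (μ := lawU) (measurable_chain (e := e) (w := w) hP).aemeasurable
  have := Measure.isProbabilityMeasure_map (μ := lawU.map (chain e P w))
    (measurable_pastOf (A := A)).aemeasurable
  refine (Measure.prod_eq fun s t hs ht => ?_).symm
  rw [Measure.map_apply (hm1.prodMk hm2) (hs.prod ht), Measure.map_apply measurable_pastOf hs,
    Measure.map_apply (measurable_chain hP) (measurable_pastOf hs), ← lawU_eval 0 ht]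
  refine lawU_inter (S := Set.Iio 0) (T := {0}) (hm1 hs) (hm2 ht) ?_ ?_ (by simp)
  · intro U U' hU h
    have : pastOf (chain e P w U') = pastOf (chain e P w U) := by
      ext n
      refine (chain_congr fun i hi => hU i ?_).symm
      simp only [Set.mem_Iio]
      omega
    have h' : pastOf (chain e P w U) ∈ s := h
    rw [← this] at h'
    exact h'
  · intro U U' hU h
    have h' : U 0 ∈ t := h
    rw [hU 0 rfl] at h'
    exact h'

/-- A regeneration at or before `0` makes the symbol at `0` equal to `nextSymbol` of the past and `U
0`; the joint law is then a product. -/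
lemma followsUpdate_map_chain (hP : IsKernel P)
    (hE : (spontaneousSymbols P).Nonempty) (hw : ∀ a ∈ w, a ∈ spontaneousSymbols P)
    (hsum : Summable fun k : ℕ => 1 - alphaW P w k) :
    FollowsUpdate e P w (lawU.map (chain e P w)) := by
  intro B hB a
  have hm1 : Measurable fun U => pastOf (chain e P w U) :=
    measurable_pastOf.comp (measurable_chain hP)
  have hm2 : Measurable fun U : ℤ → ℝ => U 0 := measurable_pi_apply 0
  have := Measure.isProbabilityMeasure_map (μ := lawU) (measurable_chain (e := e) (w := w) hP).aemeasurable
  have := Measure.isProbabilityMeasure_map (μ := lawU.map (chain e P w))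
    (measurable_pastOf (A := A)).aemeasurable
  have hset : MeasurableSet {p : (ℕ → A) × ℝ | p.1 ∈ B ∧ nextSymbol e P w p.1 p.2 = a} :=
    (measurable_fst hB).inter (measurable_nextSymbol hP (measurableSet_singleton a))
  rw [Measure.map_apply (measurable_chain hP)
    ((measurable_pastOf hB).inter (measurableSet_coord_eq 0 a))]
  have h1 : lawU (chain e P w ⁻¹' (pastOf ⁻¹' B ∩ {x | x 0 = a})) =
      lawU.map (fun U => (pastOf (chain e P w U), U 0))
        {p : (ℕ → A) × ℝ | p.1 ∈ B ∧ nextSymbol e P w p.1 p.2 = a} := by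
    rw [Measure.map_apply (hm1.prodMk hm2) hset]
    refine measure_congr ?_
    filter_upwards [ae_isTypical (e := e) hP hE hw hsum] with U hU
    obtain ⟨s, hs, hR⟩ := hU.exists_le 0
    have := nextSymbol_eq hP (hR.mem_hitSet hP hs)
    rw [← pastOf_eq] at this
    refine propext ?_
    change (pastOf (chain e P w U) ∈ B ∧ chain e P w U 0 = a) ↔
      (pastOf (chain e P w U) ∈ B ∧ nextSymbol e P w (pastOf (chain e P w U)) (U 0) = a)
    rw [this]
  rw [h1, map_chain_pastOf_coord hP, Measure.prod_apply hset, ← lintegral_indicator hB]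
  refine lintegral_congr fun z => ?_
  by_cases hz : z ∈ B <;> simp [hz]

lemma isStationaryCompatible_map_chain (hP : IsKernel P)
    (hE : (spontaneousSymbols P).Nonempty) (hw : ∀ a ∈ w, a ∈ spontaneousSymbols P)
    (hsum : Summable fun k : ℕ => 1 - alphaW P w k) :
    IsStationaryCompatible P (lawU.map (chain e P w)) := by
  have := Measure.isProbabilityMeasure_map (μ := lawU)
    (measurable_chain (e := e) (w := w) hP).aemeasurable
  have hF := followsUpdate_map_chain (e := e) hP hE hw hsum
  exact ⟨this, map_chain_stationary hP, hF.compatible hP hsum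
    (ae_hasWord (map_chain_stationary hP) (fun _ hB a => hF.le_measure hP hB a) hw)⟩

end Compatibility

/-! ### Uniqueness by coupling -/

section Uniqueness

variable {A : Type*} {e : A ↪ ℕ} {P : A → (ℕ → A) → ℝ} {w : List A}

lemma pre_eq_of_le {z z' : ℕ → A} {n j : ℕ} (h : pre z n = pre z' n) (hj : j ≤ n) :
    pre z j = pre z' j := by
  rw [← take_pre z hj, h, take_pre z' hj]

variable [Nonempty A]

/-- The past of time `k` that results from the past `z` of time `0`. -/
noncomputable def evolve (e : A ↪ ℕ) (P : A → (ℕ → A) → ℝ) (w : List A) (z : ℕ → A)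
    (U : ℤ → ℝ) : ℕ → ℕ → A
  | 0 => z
  | k + 1 => extend (nextSymbol e P w (evolve e P w z U k) (U k)) (evolve e P w z U k)

lemma evolve_congr (z : ℕ → A) {U U' : ℤ → ℝ} {k : ℕ} (h : ∀ i ∈ Set.Iio (k : ℤ), U i = U' i) :
    evolve e P w z U k = evolve e P w z U' k := by
  induction k with
  | zero => rfl
  | succ k ih =>
    rw [evolve, evolve, ih fun i hi => h i (lt_trans (Set.mem_Iio.1 hi) (by push_cast; omega)),
      h k (Set.mem_Iio.2 (by push_cast; omega))]

/-- The coupling: after a regeneration the symbols are determined without looking further back, so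
the initial past `z` is forgotten. -/
lemma pre_evolve (hP : IsKernel P) (z : ℕ → A) {U : ℤ → ℝ} {s : ℕ}
    (hs : IsRegeneration e P w U s) (n : ℕ) :
    pre (evolve e P w z U (s + n)) n = pre (pastAt (chain e P w U) (s + n)) n := by
  induction n with
  | zero => rfl
  | succ n ih =>
    have h1 : nextSymbol e P w (evolve e P w z U (s + n)) (U ((s + n : ℕ) : ℤ)) =
        chain e P w U (s + n) := by
      refine nextSymbol_eq hP ⟨n, ?_⟩
      rw [ih]
      exact_mod_cast hs.determines hP n
    rw [← add_assoc, evolve, pre_extend, h1, ih]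
    push_cast
    rw [← add_assoc, pre_pastAt_succ]

variable [MeasurableSpace A] [Countable A] [DiscreteMeasurableSpace A]

lemma measurable_evolve (hP : IsKernel P) (k : ℕ) :
    Measurable fun p : (ℕ → A) × (ℤ → ℝ) => evolve e P w p.1 p.2 k := by
  induction k with
  | zero => exact measurable_fst
  | succ k ih =>
    have hU : Measurable fun p : (ℕ → A) × (ℤ → ℝ) => p.2 (k : ℤ) :=
      (measurable_pi_apply (k : ℤ)).comp measurable_snd
    exact measurable_extend.comp (((measurable_nextSymbol hP).comp (ih.prodMk hU)).prodMk ih)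

/-- One update step preserves the law of the past: `FollowsUpdate` gives the joint law of past and
next symbol, and stationarity identifies the extended past with the past one time later. -/
lemma map_extend_nextSymbol (hP : IsKernel P) {ν : Measure (ℤ → A)} [IsProbabilityMeasure ν]
    (hν : MeasurePreserving (fun (x : ℤ → A) (n : ℤ) => x (n + 1)) ν ν)
    (hF : FollowsUpdate e P w ν) :
    ((ν.map pastOf).prod unif).map (fun p => extend (nextSymbol e P w p.1 p.2) p.1) =
      ν.map pastOf := by
  have := Measure.isProbabilityMeasure_map (μ := ν) (measurable_pastOf (A := A)).aemeasurable
  have hnext := measurable_nextSymbol (e := e) (w := w) hP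
  have hext : Measurable fun p : (ℕ → A) × ℝ => extend (nextSymbol e P w p.1 p.2) p.1 :=
    measurable_extend.comp (hnext.prodMk measurable_fst)
  ext S hS
  have hSa : ∀ a : A, MeasurableSet {z | extend a z ∈ S} := fun a =>
    (measurable_extend.comp (measurable_const.prodMk measurable_id)) hS
  have h1 : S = ⋃ a, {z | z 0 = a ∧ (fun n => z (n + 1)) ∈ {z | extend a z ∈ S}} := by
    ext z
    have hz : extend (z 0) (fun n => z (n + 1)) = z := by
      ext n; cases n <;> rfl
    simp [hz]
  have h2 : (fun p : (ℕ → A) × ℝ => extend (nextSymbol e P w p.1 p.2) p.1) ⁻¹' S =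
      ⋃ a, {p | p.1 ∈ {z | extend a z ∈ S} ∧ nextSymbol e P w p.1 p.2 = a} := by
    ext p; simp
  have hm : ∀ a, MeasurableSet {p : (ℕ → A) × ℝ |
      p.1 ∈ {z | extend a z ∈ S} ∧ nextSymbol e P w p.1 p.2 = a} := fun a =>
    (measurable_fst (hSa a)).inter (hnext (measurableSet_singleton a))
  have hm' : ∀ a, MeasurableSet {z : ℕ → A |
      z 0 = a ∧ (fun n => z (n + 1)) ∈ {z | extend a z ∈ S}} := fun a =>
    measurableSet_prepend (hSa a) [a]
  rw [Measure.map_apply hext hS, h2, measure_iUnion _ hm]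
  · conv_rhs => rw [h1]
    rw [measure_iUnion _ hm']
    · refine tsum_congr fun a => ?_
      rw [Measure.map_apply measurable_pastOf (hm' a),
        measure_prepend_cons hν (hSa a), hF _ (hSa a), Measure.prod_apply (hm a),
        ← lintegral_indicator (hSa a)]
      refine lintegral_congr fun z => ?_
      by_cases hz : extend a z ∈ S <;> simp [hz]
    · exact fun a b hab => Set.disjoint_left.2 fun z hz hz' => hab (hz.1.symm.trans hz'.1)
  · exact fun a b hab => Set.disjoint_left.2 fun z hz hz' => hab (hz.2.symm.trans hz'.2)

lemma map_evolve (hP : IsKernel P) {ν : Measure (ℤ → A)} [IsProbabilityMeasure ν]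
    (hν : MeasurePreserving (fun (x : ℤ → A) (n : ℤ) => x (n + 1)) ν ν)
    (hF : FollowsUpdate e P w ν) (k : ℕ) :
    ((ν.map pastOf).prod lawU).map (fun p => evolve e P w p.1 p.2 k) = ν.map pastOf := by
  have := Measure.isProbabilityMeasure_map (μ := ν) (measurable_pastOf (A := A)).aemeasurable
  induction k with
  | zero => exact measurePreserving_fst.map_eq
  | succ k ih =>
    have hY := measurable_evolve (e := e) (w := w) hP k
    have hU : Measurable fun p : (ℕ → A) × (ℤ → ℝ) => p.2 (k : ℤ) :=
      (measurable_pi_apply (k : ℤ)).comp measurable_snd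
    have hjoint : ((ν.map pastOf).prod lawU).map
        (fun p => (evolve e P w p.1 p.2 k, p.2 (k : ℤ))) = (ν.map pastOf).prod unif := by
      refine (Measure.prod_eq fun s t hs ht => ?_).symm
      rw [Measure.map_apply (hY.prodMk hU) (hs.prod ht)]
      conv_rhs => rw [← ih, Measure.map_apply hY hs]
      rw [Measure.prod_apply (hY hs), Measure.prod_apply ((hY.prodMk hU) (hs.prod ht)),
        ← lintegral_mul_const _ (measurable_measure_prodMk_left (hY hs))]
      refine lintegral_congr fun z => ?_
      have hYz : Measurable fun U => evolve e P w z U k := hY.comp measurable_prodMk_left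
      rw [← lawU_eval (k : ℤ) ht]
      refine lawU_inter (E := (fun U => evolve e P w z U k) ⁻¹' s) (S := Set.Iio (k : ℤ))
        (T := {(k : ℤ)}) (hYz hs) ((measurable_pi_apply (k : ℤ)) ht) ?_ ?_ (by simp)
      · intro U U' hU h
        have h' : evolve e P w z U k ∈ s := h
        rw [evolve_congr z hU] at h'
        exact h'
      · intro U U' hU h
        have h' : U k ∈ t := h
        rw [hU k rfl] at h'
        exact h'
    conv_rhs => rw [← map_extend_nextSymbol (e := e) (w := w) hP hν hF, ← hjoint]
    have hext : Measurable fun p : (ℕ → A) × ℝ => extend (nextSymbol e P w p.1 p.2) p.1 :=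
      measurable_extend.comp ((measurable_nextSymbol hP).prodMk measurable_fst)
    rw [Measure.map_map hext (hY.prodMk hU)]
    rfl

/-- At time `k + j`, the last `j` symbols of the evolved past equal those of the chain unless no
regeneration occurs in `0, …, k`. The error tends to zero. -/
lemma map_pastOf_eq (hP : IsKernel P)
    (hE : (spontaneousSymbols P).Nonempty) (hw : ∀ a ∈ w, a ∈ spontaneousSymbols P)
    (hsum : Summable fun k : ℕ => 1 - alphaW P w k) {ν : Measure (ℤ → A)}
    [IsProbabilityMeasure ν]
    (hν : MeasurePreserving (fun (x : ℤ → A) (n : ℤ) => x (n + 1)) ν ν)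
    (hF : FollowsUpdate e P w ν) (j : ℕ) :
    (ν.map pastOf).map (fun z => pre z j) =
      ((lawU.map (chain e P w)).map pastOf).map (fun z => pre z j) := by
  have := Measure.isProbabilityMeasure_map (μ := ν) (measurable_pastOf (A := A)).aemeasurable
  have hchain := measurable_chain (e := e) (w := w) hP
  have := Measure.isProbabilityMeasure_map (μ := lawU) hchain.aemeasurable
  have := Measure.isProbabilityMeasure_map (μ := lawU.map (chain e P w))
    (measurable_pastOf (A := A)).aemeasurable
  have hpre := measurable_pre (A := A) j
  have := Measure.isProbabilityMeasure_map (μ := ν.map pastOf) hpre.aemeasurable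
  have := Measure.isProbabilityMeasure_map (μ := (lawU.map (chain e P w)).map pastOf)
    hpre.aemeasurable
  -- Between probability measures one inequality suffices.
  refine Measure.eq_of_le_of_measure_univ_eq ?_ (by simp)
  refine Measure.le_iff.2 fun L hL => ?_
  have hlim := (tendsto_noRegeneration (e := e) hP hE hw hsum).const_add
    (((lawU.map (chain e P w)).map pastOf).map (fun z => pre z j) L)
  rw [add_zero] at hlim
  refine ge_of_tendsto' hlim fun k => ?_
  have hst := measurePreserving_shift_of_stationary
    (map_chain_stationary (e := e) (w := w) hP) (k + j)
  have h1 : ((lawU.map (chain e P w)).map pastOf).map (fun z => pre z j) L =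
      lawU {U | pre (pastAt (chain e P w U) ((k + j : ℕ) : ℤ)) j ∈ L} := by
    rw [Measure.map_apply hpre hL, Measure.map_apply measurable_pastOf (hpre hL),
      ← hst.measure_preimage (measurable_pastOf (hpre hL)).nullMeasurableSet,
      Measure.map_apply hchain (hst.measurable (measurable_pastOf (hpre hL)))]
    congr 1
    ext U
    simp only [Set.mem_preimage, pastOf_shift, Set.mem_ofPred_eq]
  have h2 : (ν.map pastOf).map (fun z => pre z j) L =
      ((ν.map pastOf).prod lawU) {p | pre (evolve e P w p.1 p.2 (k + j)) j ∈ L} := by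
    rw [Measure.map_apply hpre hL]
    conv_lhs => rw [← map_evolve (e := e) (w := w) hP hν hF (k + j)]
    rw [Measure.map_apply (measurable_evolve hP _) (hpre hL)]
    rfl
  rw [h1, h2]
  have hsub : {p : (ℕ → A) × (ℤ → ℝ) | pre (evolve e P w p.1 p.2 (k + j)) j ∈ L} ⊆
      Set.univ ×ˢ ({U | pre (pastAt (chain e P w U) ((k + j : ℕ) : ℤ)) j ∈ L} ∪
        NoRegeneration e P w k) := by
    rintro ⟨z, U⟩ h
    refine ⟨trivial, ?_⟩
    by_cases hno : U ∈ NoRegeneration e P w k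
    · exact Or.inr hno
    · left
      simp only [NoRegeneration, Set.mem_iInter, not_forall, Set.mem_compl_iff, not_not] at hno
      obtain ⟨s, hs, hR⟩ := hno
      obtain ⟨s, rfl⟩ := Int.eq_ofNat_of_zero_le hs.1
      have hsk : s ≤ k := by exact_mod_cast hs.2
      obtain ⟨i, rfl⟩ := Nat.exists_eq_add_of_le hsk
      have := pre_evolve hP z hR (i + j)
      rw [← add_assoc] at this
      have := pre_eq_of_le this (Nat.le_add_left j i)
      have hLmem : pre (evolve e P w z U (s + i + j)) j ∈ L := h
      rw [this] at hLmem
      rw [Set.mem_ofPred_eq]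
      convert hLmem using 3
      push_cast
      ring
  refine (measure_mono hsub).trans ?_
  rw [Measure.prod_prod, measure_univ, one_mul]
  exact measure_union_le _ _

/-- The constructed chain is the only stationary chain that is compatible with `P`. -/
lemma IsStationaryCompatible.eq_map_chain (hP : IsKernel P)
    (hE : (spontaneousSymbols P).Nonempty) (hw : ∀ a ∈ w, a ∈ spontaneousSymbols P)
    (hsum : Summable fun k : ℕ => 1 - alphaW P w k) {ν : Measure (ℤ → A)}
    (hν : IsStationaryCompatible P ν) : ν = lawU.map (chain e P w) := by
  have := hν.isProbabilityMeasure
  have hμ := isStationaryCompatible_map_chain (e := e) hP hE hw hsum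
  have := hμ.isProbabilityMeasure
  have hpast := map_pastOf_eq (e := e) hP hE hw hsum hν.stationary (hν.followsUpdate hP hsum hw)
  refine IsProjectiveLimit.unique (P := fun I => ν.map I.restrict) (fun I => rfl) fun I => ?_
  obtain ⟨k, hk⟩ : ∃ k : ℕ, ∀ i ∈ I, -(k : ℤ) ≤ i ∧ i < k := by
    refine ⟨I.sup Int.natAbs + 1, fun i hi => ?_⟩
    have := Finset.le_sup (f := Int.natAbs) hi
    omega
  -- Shifted by `k`, the sites of `I` fall in the last `2 * k` symbols of the past, site `i` at
  -- position `k - 1 - i`.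
  let g : List A → (I → A) := fun l i => l.getD ((k : ℤ) - 1 - i).toNat (Classical.arbitrary A)
  have hg : Measurable g := .of_discrete
  have hrestrict : ∀ ρ : Measure (ℤ → A),
      MeasurePreserving (fun (x : ℤ → A) (n : ℤ) => x (n + 1)) ρ ρ →
      ρ.map I.restrict = ((ρ.map pastOf).map (fun z => pre z (2 * k))).map g := by
    intro ρ hρ
    have hsh := measurePreserving_shift_of_stationary hρ k
    conv_rhs => rw [← hsh.map_eq]
    rw [Measure.map_map measurable_pastOf hsh.measurable,
      Measure.map_map (measurable_pre _) (measurable_pastOf.comp hsh.measurable),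
      Measure.map_map hg ((measurable_pre _).comp (measurable_pastOf.comp hsh.measurable))]
    congr 1
    ext x i
    have hi := hk i i.2
    simp only [Function.comp_apply, g, pastOf_shift, Finset.restrict]
    rw [List.getD_eq_getElem _ _ (by simp; omega)]
    simp only [pre, List.getElem_map, List.getElem_range, pastAt]
    congr 1
    omega
  simp only
  rw [hrestrict ν hν.stationary, hrestrict _ hμ.stationary, hpast]

end Uniqueness

/-! ### Cycles between regenerations and their probabilities -/

section Cycles

variable {A : Type*} {e : A ↪ ℕ} {P : A → (ℕ → A) → ℝ} {w : List A}

lemma reverse_pre_pastAt (x : ℤ → A) (s t : ℤ) :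
    (pre (pastAt x t) (t - s).toNat).reverse = block x s t := by
  rw [block, coe_range, List.map_map]
  refine List.ext_getElem (by simp) fun i h1 h2 => ?_
  simp only [List.length_reverse, length_pre] at h1
  simp only [pre, List.getElem_reverse, List.getElem_map, List.getElem_range,
    List.length_map, List.length_range, pastAt, Function.comp_apply]
  congr 1
  omega

/-- The construction from `s` succeeds at `L` sites and yields a string in `B` (in the order of
time), and the constructions from the later sites get stuck before `s + L`. -/
def Cycle (e : A ↪ ℕ) (P : A → (ℕ → A) → ℝ) (w : List A) (B : Set (List A)) (s : ℤ) (L : ℕ) :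
    Set (ℤ → ℝ) :=
  {U | ∃ v, run e P w U s L = some v ∧ v.reverse ∈ B} ∩
    {U | ∀ r, 0 < r → r < L → run e P w U (s + r) (L - r) = none}

lemma dependsOnSites_cycle (B : Set (List A)) (s : ℤ) (L : ℕ) :
    DependsOnSites (Cycle e P w B s L) (Set.Ico s (s + L)) := by
  rintro U U' hU ⟨⟨v, hv, hvB⟩, h⟩
  refine ⟨⟨v, (run_congr hU) ▸ hv, hvB⟩, fun r h0 hr => ?_⟩
  rw [← h r h0 hr]
  refine (run_congr fun i hi => hU i ?_).symm
  have h1 := hi.1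
  have h2 := hi.2
  constructor <;> omega

lemma preimage_shift_cycle (B : Set (List A)) (s k : ℤ) (L : ℕ) :
    shift k ⁻¹' Cycle e P w B s L = Cycle e P w B (s + k) L := by
  ext U
  simp only [Cycle, Set.mem_preimage, Set.mem_inter_iff, Set.mem_ofPred_eq, run_shift,
    add_right_comm s _ k]

/-- `k` further cycles, with strings in `B 0, B 1, …`, start at `s`, and the construction that
starts after them never gets stuck. -/
def Forward (e : A ↪ ℕ) (P : A → (ℕ → A) → ℝ) (w : List A) :
    (ℕ → Set (List A)) → ℕ → ℤ → Set (ℤ → ℝ)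
  | _, 0, s => {U | IsRegeneration e P w U s}
  | B, k + 1, s => ⋃ l : ℕ, Cycle e P w (B 0) s (l + 1) ∩
      Forward e P w (fun i => B (i + 1)) k (s + (l + 1 : ℕ))

/-- `k` cycles, with strings in `B 0, B 1, …` (the most recent first), end at `s`. -/
def Backward (e : A ↪ ℕ) (P : A → (ℕ → A) → ℝ) (w : List A) :
    (ℕ → Set (List A)) → ℕ → ℤ → Set (ℤ → ℝ)
  | _, 0, _ => Set.univ
  | B, k + 1, s => ⋃ l : ℕ, Cycle e P w (B 0) (s - (l + 1 : ℕ)) (l + 1) ∩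
      Backward e P w (fun i => B (i + 1)) k (s - (l + 1 : ℕ))

lemma dependsOnSites_forward (B : ℕ → Set (List A)) (k : ℕ) (s : ℤ) :
    DependsOnSites (Forward e P w B k s) (Set.Ici s) := by
  induction k generalizing B s with
  | zero => exact dependsOnSites_isRegeneration s
  | succ k ih =>
    refine .iUnion fun l => ((dependsOnSites_cycle _ _ _).mono fun i hi => hi.1).inter
      ((ih _ _).mono fun i hi => ?_)
    exact le_trans (by omega) (Set.mem_Ici.1 hi)

lemma dependsOnSites_backward (B : ℕ → Set (List A)) (k : ℕ) (s : ℤ) :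
    DependsOnSites (Backward e P w B k s) (Set.Iio s) := by
  induction k generalizing B s with
  | zero => exact fun _ _ _ _ => trivial
  | succ k ih =>
    refine .iUnion fun l => ((dependsOnSites_cycle _ _ _).mono fun i hi => ?_).inter
      ((ih _ _).mono fun i hi => ?_)
    · have := hi.2
      simp only [Set.mem_Iio]
      omega
    · simp only [Set.mem_Iio] at *
      omega

lemma Cycle.not_isRegeneration {U : ℤ → ℝ} {B : Set (List A)} {s t : ℤ} {L : ℕ}
    (h : U ∈ Cycle e P w B s L) (h1 : s < t) (h2 : t < s + L) : ¬ IsRegeneration e P w U t := by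
  obtain ⟨r, rfl⟩ := Int.exists_add_of_le h1.le
  exact fun hR => hR _ (h.2 r (by omega) (by omega))

section

variable [Nonempty A]

lemma Cycle.isRegeneration (hP : IsKernel P) {U : ℤ → ℝ} {B : Set (List A)} {s : ℤ} {L : ℕ}
    (h : U ∈ Cycle e P w B s L) (hR : IsRegeneration e P w U (s + L)) :
    IsRegeneration e P w U s := by
  obtain ⟨v, hv, -⟩ := h.1
  exact hR.of_run hP (by simp [hv])

/-- If `s + L` is a regeneration, an earlier site is one exactly when its construction reaches `s +
L`. This makes the statement about regenerations local, which is the source of the independence of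
the blocks. -/
lemma mem_cycle_iff (hP : IsKernel P) {U : ℤ → ℝ} {B : Set (List A)} {s : ℤ} {L : ℕ}
    (hR : IsRegeneration e P w U (s + L)) :
    U ∈ Cycle e P w B s L ↔ IsRegeneration e P w U s ∧
      (∀ t, s < t → t < s + L → ¬ IsRegeneration e P w U t) ∧
      block (chain e P w U) s (s + L) ∈ B := by
  have hblock : ∀ h : run e P w U s L ≠ none, run e P w U s L =
      some (block (chain e P w U) s (s + L)).reverse := by
    intro h
    rw [run_eq_pre hP h, ← reverse_pre_pastAt, List.reverse_reverse, add_sub_cancel_left,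
      Int.toNat_natCast]
  constructor
  · intro h
    refine ⟨Cycle.isRegeneration hP h hR, fun t h1 h2 => Cycle.not_isRegeneration h h1 h2, ?_⟩
    obtain ⟨v, hv, hvB⟩ := h.1
    have := hblock (by simp [hv])
    rw [hv, Option.some_inj] at this
    rwa [this, List.reverse_reverse] at hvB
  · rintro ⟨h1, h2, h3⟩
    refine ⟨⟨_, hblock (h1 L), by rwa [List.reverse_reverse]⟩, fun r h0 hr => ?_⟩
    by_contra hne
    refine h2 (s + r) (by omega) (by omega) (IsRegeneration.of_run (n := L - r) hP ?_ hne)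
    rwa [show s + (r : ℤ) + ((L - r : ℕ) : ℤ) = s + L by push_cast [hr.le]; ring]

lemma isRegeneration_of_mem_forward (hP : IsKernel P) {U : ℤ → ℝ} {B : ℕ → Set (List A)} {k : ℕ}
    {s : ℤ} (h : U ∈ Forward e P w B k s) : IsRegeneration e P w U s := by
  induction k generalizing B s with
  | zero => exact h
  | succ k ih =>
    obtain ⟨l, hl⟩ := Set.mem_iUnion.1 h
    exact Cycle.isRegeneration hP hl.1 (ih hl.2)

lemma measurableSet_cycle [Countable A] (hP : IsKernel P) (B : Set (List A)) (s : ℤ) (L : ℕ) :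
    MeasurableSet (Cycle e P w B s L) := by
  refine MeasurableSet.inter ?_ ?_
  · have : {U | ∃ v, run e P w U s L = some v ∧ v.reverse ∈ B} =
        ⋃ v ∈ {v : List A | v.reverse ∈ B}, {U | run e P w U s L = some v} := by
      ext U; simp [and_comm]
    rw [this]
    exact .biUnion (Set.to_countable _) fun v _ => measurableSet_run_eq hP s L v
  · simp only [Set.ofPred_forall]
    refine .iInter fun r => .iInter fun _ => .iInter fun _ => ?_
    convert (measurableSet_run_ne_none (e := e) (w := w) hP (s + r) (L - r)).compl using 1
    ext U; simp

lemma measurableSet_forward [Countable A] (hP : IsKernel P) (B : ℕ → Set (List A)) (k : ℕ)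
    (s : ℤ) : MeasurableSet (Forward e P w B k s) := by
  induction k generalizing B s with
  | zero => exact measurableSet_isRegeneration hP s
  | succ k ih => exact .iUnion fun l => (measurableSet_cycle hP _ _ _).inter (ih _ _)

lemma measurableSet_backward [Countable A] (hP : IsKernel P) (B : ℕ → Set (List A)) (k : ℕ)
    (s : ℤ) : MeasurableSet (Backward e P w B k s) := by
  induction k generalizing B s with
  | zero => exact .univ
  | succ k ih => exact .iUnion fun l => (measurableSet_cycle hP _ _ _).inter (ih _ _)

variable [Countable A]

lemma lawU_cycle_eq (hP : IsKernel P) (B : Set (List A)) (s : ℤ) (L : ℕ) :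
    lawU (Cycle e P w B s L) = lawU (Cycle e P w B 0 L) := by
  rw [← lawU_preimage_shift (measurableSet_cycle hP B 0 L) s, preimage_shift_cycle, zero_add]

/-- The law of the string of a cycle. -/
noncomputable def cycleLaw (e : A ↪ ℕ) (P : A → (ℕ → A) → ℝ) (w : List A) (B : Set (List A)) :
    ℝ≥0∞ :=
  ∑' l : ℕ, lawU (Cycle e P w B 0 (l + 1))

/-- Sum over the length of the first cycle and use independence of its sites from the later ones.
The lengths are exclusive: a longer cycle forbids the regeneration at the end of a shorter one. -/
lemma lawU_forward (hP : IsKernel P) (B : ℕ → Set (List A)) (k : ℕ) (s : ℤ) :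
    lawU (Forward e P w B k s) =
      (∏ i ∈ Finset.range k, cycleLaw e P w (B i)) * lawU {U | IsRegeneration e P w U 0} := by
  induction k generalizing B s with
  | zero => simpa [Forward] using lawU_isRegeneration_eq hP s
  | succ k ih =>
    rw [Forward, measure_iUnion]
    · have : ∀ l : ℕ, lawU (Cycle e P w (B 0) s (l + 1) ∩
          Forward e P w (fun i => B (i + 1)) k (s + (l + 1 : ℕ))) =
          lawU (Cycle e P w (B 0) 0 (l + 1)) *
            ((∏ i ∈ Finset.range k, cycleLaw e P w (B (i + 1))) *
              lawU {U | IsRegeneration e P w U 0}) := by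
        intro l
        rw [lawU_inter (measurableSet_cycle hP _ _ _) (measurableSet_forward hP _ _ _)
          (dependsOnSites_cycle _ _ _) (dependsOnSites_forward _ _ _), ih, lawU_cycle_eq hP]
        exact Set.disjoint_left.2 fun i hi hi' => absurd hi.2 (not_lt.2 hi')
      simp_rw [this]
      rw [ENNReal.tsum_mul_right, Finset.prod_range_succ', ← cycleLaw]
      ring
    · have key : ∀ {l l' : ℕ} {U}, l < l' → U ∈ Cycle e P w (B 0) s (l' + 1) →
          U ∈ Forward e P w (fun i => B (i + 1)) k (s + (l + 1 : ℕ)) → False :=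
        fun hl h h' => Cycle.not_isRegeneration h (by omega) (by push_cast; omega)
          (isRegeneration_of_mem_forward hP h')
      intro l l' hll
      refine Set.disjoint_left.2 fun U h h' => ?_
      rcases Nat.lt_or_gt_of_ne hll with hl | hl
      · exact key hl h'.1 h.2
      · exact key hl h.1 h'.2
    · exact fun l => (measurableSet_cycle hP _ _ _).inter (measurableSet_forward hP _ _ _)

/-- No regeneration at `s` is needed. Of two cycles ending at `s`, the longer requires the
construction from the start of the shorter to get stuck, the shorter requires it to succeed. -/
lemma lawU_backward (hP : IsKernel P) (B : ℕ → Set (List A)) (k : ℕ) (s : ℤ) :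
    lawU (Backward e P w B k s) = ∏ i ∈ Finset.range k, cycleLaw e P w (B i) := by
  induction k generalizing B s with
  | zero => simp [Backward]
  | succ k ih =>
    rw [Backward, measure_iUnion]
    · have : ∀ l : ℕ, lawU (Cycle e P w (B 0) (s - (l + 1 : ℕ)) (l + 1) ∩
          Backward e P w (fun i => B (i + 1)) k (s - (l + 1 : ℕ))) =
          lawU (Cycle e P w (B 0) 0 (l + 1)) *
            (∏ i ∈ Finset.range k, cycleLaw e P w (B (i + 1))) := by
        intro l
        rw [lawU_inter (measurableSet_cycle hP _ _ _) (measurableSet_backward hP _ _ _)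
          (dependsOnSites_cycle _ _ _) (dependsOnSites_backward _ _ _), ih, lawU_cycle_eq hP]
        exact Set.disjoint_left.2 fun i hi hi' => absurd hi.1 (not_le.2 hi')
      simp_rw [this]
      rw [ENNReal.tsum_mul_right, Finset.prod_range_succ', ← cycleLaw]
      ring
    · have key : ∀ {l l' : ℕ} {U}, l < l' → U ∈ Cycle e P w (B 0) (s - (l + 1 : ℕ)) (l + 1) →
          U ∈ Cycle e P w (B 0) (s - (l' + 1 : ℕ)) (l' + 1) → False := by
        intro l l' U hl h h'
        obtain ⟨v, hv, -⟩ := h.1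
        have := h'.2 (l' - l) (by omega) (by omega)
        rw [show s - ((l' + 1 : ℕ) : ℤ) + ((l' - l : ℕ) : ℤ) = s - (l + 1 : ℕ) by
          push_cast [hl.le]; ring, show l' + 1 - (l' - l) = l + 1 by omega, hv] at this
        cases this
      intro l l' hll
      refine Set.disjoint_left.2 fun U h h' => ?_
      rcases Nat.lt_or_gt_of_ne hll with hl | hl
      · exact key hl h.1 h'.1
      · exact key hl h'.1 h.1
    · exact fun l => (measurableSet_cycle hP _ _ _).inter (measurableSet_backward hP _ _ _)

/-- Some cycle covers the sites `0` and `1` or ends after `0`; `k` cycles with strings in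
`B 0, B 1, …` follow, and `k` cycles with strings in `B' 0, B' 1, …` precede it. -/
def Window (e : A ↪ ℕ) (P : A → (ℕ → A) → ℝ) (w : List A) (B' B : ℕ → Set (List A)) (k : ℕ) :
    Set (ℤ → ℝ) :=
  ⋃ p : ℕ × ℕ, (Backward e P w B' k (-p.1) ∩ Cycle e P w Set.univ (-p.1) (p.1 + p.2 + 1)) ∩
    Forward e P w B k (p.2 + 1)

/-- The pair `p` records the last regeneration `-p.1 ≤ 0` and the first positive one `p.2 + 1`;
these are unique, so the union is disjoint. Its sum is a factor separate from the other blocks. -/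
lemma lawU_window (hP : IsKernel P) (B' B : ℕ → Set (List A)) (k : ℕ) :
    lawU (Window e P w B' B k) =
      (∏ i ∈ Finset.range k, cycleLaw e P w (B' i)) * (∏ i ∈ Finset.range k, cycleLaw e P w (B i)) *
        ((∑' p : ℕ × ℕ, lawU (Cycle e P w Set.univ 0 (p.1 + p.2 + 1))) *
          lawU {U | IsRegeneration e P w U 0}) := by
  rw [Window, measure_iUnion]
  · have : ∀ p : ℕ × ℕ, lawU ((Backward e P w B' k (-p.1) ∩
        Cycle e P w Set.univ (-p.1) (p.1 + p.2 + 1)) ∩ Forward e P w B k (p.2 + 1)) =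
        lawU (Cycle e P w Set.univ 0 (p.1 + p.2 + 1)) *
          ((∏ i ∈ Finset.range k, cycleLaw e P w (B' i)) *
            (∏ i ∈ Finset.range k, cycleLaw e P w (B i)) *
              lawU {U | IsRegeneration e P w U 0}) := by
      rintro ⟨j, l⟩
      have hend : -(j : ℤ) + ((j + l + 1 : ℕ) : ℤ) = l + 1 := by push_cast; ring
      rw [lawU_inter (S := Set.Iio ((l : ℤ) + 1)) (T := Set.Ici ((l : ℤ) + 1))
        ((measurableSet_backward hP _ _ _).inter (measurableSet_cycle hP _ _ _))
        (measurableSet_forward hP _ _ _) ?_ (dependsOnSites_forward _ _ _) ?_,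
        lawU_inter (measurableSet_backward hP _ _ _) (measurableSet_cycle hP _ _ _)
        (dependsOnSites_backward _ _ _) (dependsOnSites_cycle _ _ _), lawU_backward hP,
        lawU_forward hP, lawU_cycle_eq hP]
      · ring
      · exact Set.disjoint_left.2 fun i hi hi' => absurd hi'.1 (not_le.2 hi)
      · refine ((dependsOnSites_backward _ _ _).mono fun i hi => ?_).inter
          ((dependsOnSites_cycle _ _ _).mono fun i hi => ?_)
        · simp only [Set.mem_Iio] at *; omega
        · rw [← hend]; exact hi.2
      · exact Set.disjoint_left.2 fun i hi hi' => absurd (Set.mem_Iio.1 hi) (not_lt.2 hi')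
    simp_rw [this]
    rw [ENNReal.tsum_mul_right]
    ring
  · intro p p' hpp
    refine Set.disjoint_left.2 fun U h h' => hpp ?_
    have hR := isRegeneration_of_mem_forward hP h.2
    have hR' := isRegeneration_of_mem_forward hP h'.2
    have hC := h.1.2
    have hC' := h'.1.2
    have hend : ∀ p : ℕ × ℕ, -(p.1 : ℤ) + ((p.1 + p.2 + 1 : ℕ) : ℤ) = p.2 + 1 := fun p => by
      push_cast; ring
    have hS := Cycle.isRegeneration hP hC (by rw [hend]; exact hR)
    have hS' := Cycle.isRegeneration hP hC' (by rw [hend]; exact hR')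
    have h1 := fun t => Cycle.not_isRegeneration (t := t) hC
    have h2 := fun t => Cycle.not_isRegeneration (t := t) hC'
    rw [hend] at h1 h2
    ext
    · rcases lt_trichotomy p.1 p'.1 with hlt | heq | hgt
      · exact absurd hS (h2 _ (by omega) (by omega))
      · exact heq
      · exact absurd hS' (h1 _ (by omega) (by omega))
    · rcases lt_trichotomy p.2 p'.2 with hlt | heq | hgt
      · exact absurd hR (h2 _ (by omega) (by omega))
      · exact heq
      · exact absurd hR' (h1 _ (by omega) (by omega))
  · exact fun p => ((measurableSet_backward hP _ _ _).inter (measurableSet_cycle hP _ _ _)).inter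
      (measurableSet_forward hP _ _ _)

end

end Cycles

/-! ### Regeneration times and the law of their blocks -/

section RegenerationTimes

variable {A : Type*} {e : A ↪ ℕ} {P : A → (ℕ → A) → ℝ} {w : List A}

/-- The first regeneration after `s`. -/
noncomputable def nextRegeneration (e : A ↪ ℕ) (P : A → (ℕ → A) → ℝ) (w : List A) (U : ℤ → ℝ)
    (s : ℤ) : ℤ :=
  s + 1 + (sInf {n : ℕ | IsRegeneration e P w U (s + 1 + n)} : ℕ)

/-- The last regeneration before `s`. -/
noncomputable def prevRegeneration (e : A ↪ ℕ) (P : A → (ℕ → A) → ℝ) (w : List A) (U : ℤ → ℝ)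
    (s : ℤ) : ℤ :=
  s - 1 - (sInf {n : ℕ | IsRegeneration e P w U (s - 1 - n)} : ℕ)

/-- The regeneration times, numbered so that those with a positive index are the positive ones. -/
noncomputable def regenerationTime (e : A ↪ ℕ) (P : A → (ℕ → A) → ℝ) (w : List A) :
    ℤ → (ℤ → ℝ) → ℤ
  | Int.ofNat n, U => (nextRegeneration e P w U)^[n] (prevRegeneration e P w U 1)
  | Int.negSucc n, U => (prevRegeneration e P w U)^[n + 1] (prevRegeneration e P w U 1)

lemma regenerationTime_natCast (U : ℤ → ℝ) (n : ℕ) : regenerationTime e P w n U =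
    (nextRegeneration e P w U)^[n] (prevRegeneration e P w U 1) := rfl

lemma regenerationTime_neg (U : ℤ → ℝ) (n : ℕ) : regenerationTime e P w (-n) U =
    (prevRegeneration e P w U)^[n] (prevRegeneration e P w U 1) := by
  cases n <;> rfl

lemma lt_nextRegeneration (U : ℤ → ℝ) (s : ℤ) : s < nextRegeneration e P w U s := by
  unfold nextRegeneration; omega

lemma prevRegeneration_lt (U : ℤ → ℝ) (s : ℤ) : prevRegeneration e P w U s < s := by
  unfold prevRegeneration; omega

lemma not_isRegeneration_of_lt_next {U : ℤ → ℝ} {s t : ℤ} (h1 : s < t)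
    (h2 : t < nextRegeneration e P w U s) : ¬ IsRegeneration e P w U t := by
  intro hR
  obtain ⟨n, rfl⟩ := Int.exists_add_of_le (show s + 1 ≤ t by omega)
  have : sInf {n : ℕ | IsRegeneration e P w U (s + 1 + n)} ≤ n := Nat.sInf_le hR
  unfold nextRegeneration at h2
  omega

lemma not_isRegeneration_of_prev_lt {U : ℤ → ℝ} {s t : ℤ} (h1 : prevRegeneration e P w U s < t)
    (h2 : t < s) : ¬ IsRegeneration e P w U t := by
  intro hR
  obtain ⟨n, hn⟩ := Int.exists_add_of_le (show t ≤ s - 1 by omega)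
  have : sInf {n : ℕ | IsRegeneration e P w U (s - 1 - n)} ≤ n := Nat.sInf_le (by
    rw [Set.mem_ofPred_eq, hn, add_sub_cancel_right]; exact hR)
  unfold prevRegeneration at h1
  omega

lemma nextRegeneration_eq {U : ℤ → ℝ} {s t : ℤ}
    (hR : IsRegeneration e P w U (nextRegeneration e P w U s)) (hst : s < t)
    (ht : IsRegeneration e P w U t) (h : ∀ r, s < r → r < t → ¬ IsRegeneration e P w U r) :
    nextRegeneration e P w U s = t := by
  rcases lt_trichotomy (nextRegeneration e P w U s) t with hlt | heq | hgt
  · exact absurd hR (h _ (lt_nextRegeneration U s) hlt)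
  · exact heq
  · exact absurd ht (not_isRegeneration_of_lt_next hst hgt)

lemma prevRegeneration_eq {U : ℤ → ℝ} {s t : ℤ}
    (hR : IsRegeneration e P w U (prevRegeneration e P w U t)) (hst : s < t)
    (hs : IsRegeneration e P w U s) (h : ∀ r, s < r → r < t → ¬ IsRegeneration e P w U r) :
    prevRegeneration e P w U t = s := by
  rcases lt_trichotomy (prevRegeneration e P w U t) s with hlt | heq | hgt
  · exact absurd hs (not_isRegeneration_of_prev_lt hlt hst)
  · exact heq
  · exact absurd hR (h _ hgt (prevRegeneration_lt U t))

lemma IsTypical.isRegeneration_next {U : ℤ → ℝ} (hU : IsTypical e P w U) (s : ℤ) :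
    IsRegeneration e P w U (nextRegeneration e P w U s) := by
  refine Nat.sInf_mem (s := {n : ℕ | IsRegeneration e P w U (s + 1 + n)}) ?_
  obtain ⟨t, ht, hR⟩ := hU.exists_ge (s + 1)
  obtain ⟨n, rfl⟩ := Int.exists_add_of_le ht
  exact ⟨n, hR⟩

lemma IsTypical.isRegeneration_prev {U : ℤ → ℝ} (hU : IsTypical e P w U) (s : ℤ) :
    IsRegeneration e P w U (prevRegeneration e P w U s) := by
  refine Nat.sInf_mem (s := {n : ℕ | IsRegeneration e P w U (s - 1 - n)}) ?_
  obtain ⟨t, ht, hR⟩ := hU.exists_le (s - 1)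
  obtain ⟨n, hn⟩ := Int.exists_add_of_le ht
  exact ⟨n, by rw [Set.mem_ofPred_eq, hn, add_sub_cancel_right]; exact hR⟩

lemma time_zero_le (U : ℤ → ℝ) : regenerationTime e P w 0 U ≤ 0 := by
  have := prevRegeneration_lt (e := e) (P := P) (w := w) U 1
  change prevRegeneration e P w U 1 ≤ 0
  omega

/-- Makes the forward and backward iterates fit together, as `IsTypical.time_succ` needs at negative
indices. -/
lemma IsTypical.next_prev {U : ℤ → ℝ} (hU : IsTypical e P w U) {s : ℤ}
    (hs : IsRegeneration e P w U s) :
    nextRegeneration e P w U (prevRegeneration e P w U s) = s :=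
  nextRegeneration_eq (hU.isRegeneration_next _) (prevRegeneration_lt U s) hs
    fun _ h1 h2 => not_isRegeneration_of_prev_lt h1 h2

lemma IsTypical.isRegeneration_time {U : ℤ → ℝ} (hU : IsTypical e P w U) (i : ℤ) :
    IsRegeneration e P w U (regenerationTime e P w i U) := by
  rcases i with n | n
  · cases n with
    | zero => exact hU.isRegeneration_prev 1
    | succ n =>
      rw [Int.ofNat_eq_natCast, regenerationTime_natCast, Function.iterate_succ_apply']
      exact hU.isRegeneration_next _
  · rw [regenerationTime, Function.iterate_succ_apply']
    exact hU.isRegeneration_prev _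

lemma IsTypical.time_succ {U : ℤ → ℝ} (hU : IsTypical e P w U) (i : ℤ) :
    regenerationTime e P w (i + 1) U = nextRegeneration e P w U (regenerationTime e P w i U) := by
  rcases i with n | n
  · exact Function.iterate_succ_apply' _ _ _
  · have h1 : regenerationTime e P w (Int.negSucc n) U =
        prevRegeneration e P w U (regenerationTime e P w (-n) U) := by
      rw [regenerationTime_neg, regenerationTime, Function.iterate_succ_apply']
    rw [h1, hU.next_prev (hU.isRegeneration_time _)]
    congr 1
    omega

lemma IsTypical.time_one_pos {U : ℤ → ℝ} (hU : IsTypical e P w U) :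
    0 < regenerationTime e P w 1 U := by
  have h1 : regenerationTime e P w 1 U =
      nextRegeneration e P w U (prevRegeneration e P w U 1) := rfl
  by_contra h
  refine not_isRegeneration_of_prev_lt (s := 1) (t := regenerationTime e P w 1 U) ?_ (by omega)
    (hU.isRegeneration_time 1)
  rw [h1]
  exact lt_nextRegeneration U _

/-- The block of the chain between two successive regeneration times. -/
noncomputable def regenerationBlock [Nonempty A] (e : A ↪ ℕ) (P : A → (ℕ → A) → ℝ) (w : List A)
    (i : ℤ) (U : ℤ → ℝ) : List A :=
  block (chain e P w U) (regenerationTime e P w i U) (regenerationTime e P w (i + 1) U)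

variable [Nonempty A]

lemma IsTypical.mem_forward_iff (hP : IsKernel P) {U : ℤ → ℝ} (hU : IsTypical e P w U)
    (B : ℕ → Set (List A)) (k : ℕ) (s : ℤ) :
    U ∈ Forward e P w B k s ↔ IsRegeneration e P w U s ∧ ∀ i < k,
      block (chain e P w U) ((nextRegeneration e P w U)^[i] s)
        ((nextRegeneration e P w U)^[i + 1] s) ∈ B i := by
  induction k generalizing B s with
  | zero => simp [Forward]
  | succ k ih =>
    rw [Nat.forall_lt_succ_left, Forward, Set.mem_iUnion]
    simp only [Function.iterate_succ_apply, Function.iterate_zero, id] at ih ⊢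
    constructor
    · rintro ⟨l, h1, h2⟩
      have hR := isRegeneration_of_mem_forward hP h2
      obtain ⟨h3, h4, h5⟩ := (mem_cycle_iff hP hR).1 h1
      have hs := nextRegeneration_eq (hU.isRegeneration_next s) (by omega) hR h4
      rw [hs]
      exact ⟨h3, h5, ((ih _ _).1 h2).2⟩
    · rintro ⟨h1, h2, h3⟩
      have hlt := lt_nextRegeneration (e := e) (P := P) (w := w) U s
      obtain ⟨l, hl⟩ := Int.exists_add_of_le (show s + 1 ≤ nextRegeneration e P w U s by omega)
      have hl' : s + ((l + 1 : ℕ) : ℤ) = nextRegeneration e P w U s := by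
        rw [hl]; push_cast; ring
      have hR := hU.isRegeneration_next s
      refine ⟨l, (mem_cycle_iff hP (by rw [hl']; exact hR)).2 ⟨h1, ?_, ?_⟩, ?_⟩
      · rw [hl']; exact fun t => not_isRegeneration_of_lt_next
      · rw [hl']; exact h2
      · rw [hl']; exact (ih _ _).2 ⟨hR, h3⟩

lemma IsTypical.mem_backward_iff (hP : IsKernel P) {U : ℤ → ℝ} (hU : IsTypical e P w U)
    (B : ℕ → Set (List A)) (k : ℕ) {s : ℤ} (hs : IsRegeneration e P w U s) :
    U ∈ Backward e P w B k s ↔ ∀ i < k,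
      block (chain e P w U) ((prevRegeneration e P w U)^[i + 1] s)
        ((prevRegeneration e P w U)^[i] s) ∈ B i := by
  induction k generalizing B s with
  | zero => simp [Backward]
  | succ k ih =>
    rw [Nat.forall_lt_succ_left, Backward, Set.mem_iUnion]
    simp only [Function.iterate_succ_apply, Function.iterate_zero, id] at ih ⊢
    have hend : ∀ l : ℕ, s - ((l + 1 : ℕ) : ℤ) + ((l + 1 : ℕ) : ℤ) = s := fun l => by ring
    constructor
    · rintro ⟨l, h1, h2⟩
      obtain ⟨h3, h4, h5⟩ := (mem_cycle_iff hP (by rw [hend]; exact hs)).1 h1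
      rw [hend] at h4 h5
      have hp := prevRegeneration_eq (hU.isRegeneration_prev s) (by omega) h3 h4
      rw [hp]
      exact ⟨h5, (ih _ h3).1 h2⟩
    · rintro ⟨h2, h3⟩
      have hlt := prevRegeneration_lt (e := e) (P := P) (w := w) U s
      obtain ⟨l, hl⟩ := Int.exists_add_of_le (show prevRegeneration e P w U s + 1 ≤ s by omega)
      have hl' : s - ((l + 1 : ℕ) : ℤ) = prevRegeneration e P w U s := by
        push_cast; linarith
      have hR := hU.isRegeneration_prev s
      refine ⟨l, (mem_cycle_iff hP (by rw [hend]; exact hs)).2 ?_, ?_⟩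
      · rw [hend, hl']
        exact ⟨hR, fun t => not_isRegeneration_of_prev_lt, h2⟩
      · rw [hl']; exact (ih _ hR).2 h3

/-- The block with index `0`, which surrounds the origin, is left unconstrained. -/
lemma IsTypical.mem_window_iff (hP : IsKernel P) {U : ℤ → ℝ} (hU : IsTypical e P w U)
    (B' B : ℕ → Set (List A)) (k : ℕ) :
    U ∈ Window e P w B' B k ↔ (∀ i < k, regenerationBlock e P w (-(i + 1 : ℕ)) U ∈ B' i) ∧
      ∀ i < k, regenerationBlock e P w (i + 1 : ℕ) U ∈ B i := by
  have hend : ∀ p : ℕ × ℕ, -(p.1 : ℤ) + ((p.1 + p.2 + 1 : ℕ) : ℤ) = p.2 + 1 := fun p => by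
    push_cast; ring
  set t₀ := prevRegeneration e P w U 1 with ht₀
  have hR₀ : IsRegeneration e P w U t₀ := hU.isRegeneration_prev 1
  have hR₁ := hU.isRegeneration_next t₀
  have h₀ : t₀ ≤ 0 := time_zero_le U
  have h₁ : 0 < nextRegeneration e P w U t₀ := hU.time_one_pos
  have hb : ∀ i : ℕ, regenerationBlock e P w (-(i + 1 : ℕ)) U =
      block (chain e P w U) ((prevRegeneration e P w U)^[i + 1] t₀)
        ((prevRegeneration e P w U)^[i] t₀) := by
    intro i
    rw [regenerationBlock, regenerationTime_neg,
      show (-((i + 1 : ℕ) : ℤ) + 1) = -(i : ℤ) by push_cast; ring, regenerationTime_neg]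
  have hf : ∀ i : ℕ, regenerationBlock e P w (i + 1 : ℕ) U =
      block (chain e P w U) ((nextRegeneration e P w U)^[i] (nextRegeneration e P w U t₀))
        ((nextRegeneration e P w U)^[i + 1] (nextRegeneration e P w U t₀)) := by
    intro i
    rw [regenerationBlock, regenerationTime_natCast,
      show (((i + 1 : ℕ) : ℤ) + 1) = ((i + 2 : ℕ) : ℤ) by push_cast; ring,
      regenerationTime_natCast, Function.iterate_succ_apply, Function.iterate_succ_apply]
  simp only [hb, hf]
  rw [← hU.mem_backward_iff hP _ _ hR₀, Window, Set.mem_iUnion]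
  constructor
  · rintro ⟨p, ⟨h1, h2⟩, h3⟩
    have hRp := isRegeneration_of_mem_forward hP h3
    obtain ⟨h4, h5, -⟩ := (mem_cycle_iff hP (by rw [hend]; exact hRp)).1 h2
    rw [hend] at h5
    have ht : t₀ = -p.1 :=
      prevRegeneration_eq hR₀ (by omega) h4 fun r hr1 hr2 => h5 r hr1 (by omega)
    have hn : nextRegeneration e P w U t₀ = p.2 + 1 :=
      nextRegeneration_eq hR₁ (by omega) hRp fun r hr1 hr2 => h5 r (by omega) hr2
    rw [hn, ht]
    exact ⟨h1, ((hU.mem_forward_iff hP _ _ _).1 h3).2⟩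
  · rintro ⟨h1, h2⟩
    refine ⟨((-t₀).toNat, (nextRegeneration e P w U t₀ - 1).toNat), ?_⟩
    have e1 : -((-t₀).toNat : ℤ) = t₀ := by omega
    have e2 : ((nextRegeneration e P w U t₀ - 1).toNat : ℤ) + 1 =
        nextRegeneration e P w U t₀ := by omega
    have e3 := hend ((-t₀).toNat, (nextRegeneration e P w U t₀ - 1).toNat)
    simp only [e1, e2] at e3 ⊢
    refine ⟨⟨h1, (mem_cycle_iff hP (by rw [e3]; exact hR₁)).2 ⟨hR₀, ?_, trivial⟩⟩,
      (hU.mem_forward_iff hP _ _ _).2 ⟨hR₁, h2⟩⟩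
    rw [e3]
    exact fun t => not_isRegeneration_of_lt_next

/-! ### Measurability -/

/-- Random times take countably many values, so one may decompose over the value of `f`. -/
lemma measurable_apply_of_countable {β : Type*} [MeasurableSpace β] {g : (ℤ → ℝ) → ℤ → β}
    {f : (ℤ → ℝ) → ℤ} (hg : ∀ s, Measurable fun U => g U s) (hf : Measurable f) :
    Measurable fun U => g U (f U) := by
  intro S hS
  have : (fun U => g U (f U)) ⁻¹' S = ⋃ s : ℤ, f ⁻¹' {s} ∩ (fun U => g U s) ⁻¹' S := by
    ext U; simp
  rw [this]
  exact .iUnion fun s => (hf (measurableSet_singleton s)).inter (hg s hS)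

lemma measurable_sInf_nat {p : (ℤ → ℝ) → ℕ → Prop} (hp : ∀ n, MeasurableSet {U | p U n}) :
    Measurable fun U => sInf {n | p U n} := by
  refine measurable_to_countable' fun m => ?_
  -- The second part accounts for the convention that the infimum of the empty set is `0`.
  have : (fun U => sInf {n | p U n}) ⁻¹' {m} =
      ({U | p U m} ∩ ⋂ j ∈ Set.Iio m, {U | p U j}ᶜ) ∪
        ((⋂ n, {U | p U n}ᶜ) ∩ {_U | m = 0}) := by
    ext U
    simp only [Set.mem_preimage, Set.mem_singleton_iff, Set.mem_union, Set.mem_inter_iff,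
      Set.mem_ofPred_eq, Set.mem_iInter, Set.mem_compl_iff, Set.mem_Iio]
    constructor
    · rintro rfl
      by_cases hex : ∃ n, p U n
      · exact Or.inl ⟨Nat.sInf_mem (s := {n | p U n}) hex, fun j hj => Nat.notMem_of_lt_sInf hj⟩
      · push Not at hex
        refine Or.inr ⟨hex, ?_⟩
        simp [hex]
    · rintro (⟨h1, h2⟩ | ⟨h1, rfl⟩)
      · refine le_antisymm (Nat.sInf_le h1) ?_
        by_contra hlt
        exact h2 _ (not_le.1 hlt) (Nat.sInf_mem (s := {n | p U n}) ⟨m, h1⟩)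
      · simp [h1]
  rw [this]
  exact ((hp m).inter (.biInter (Set.to_countable _) fun j _ => (hp j).compl)).union
    ((MeasurableSet.iInter fun n => (hp n).compl).inter (MeasurableSet.const _))

/-- A successful construction over `L` sites yields exactly `L` symbols, so the condition keeps the
terms with `L > n`. -/
lemma cycleLaw_lt_length (hP : IsKernel P) (n : ℕ) :
    cycleLaw e P w {v | n < v.length} = ∑' l : ℕ, lawU (Cycle e P w Set.univ 0 (n + l + 1)) := by
  have hlen : ∀ L, Cycle e P w {v | n < v.length} 0 L =
      if n < L then Cycle e P w Set.univ 0 L else ∅ := by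
    intro L
    ext U
    simp only [Cycle, Set.mem_inter_iff, Set.mem_ofPred_eq]
    split_ifs with h
    · refine and_congr_left fun _ => exists_congr fun v => and_congr_right fun hv => ?_
      simp [length_of_run hP hv, h]
    · simp only [Set.mem_empty_iff_false, iff_false, not_and]
      rintro ⟨v, hv, hn⟩
      rw [List.length_reverse, length_of_run hP hv] at hn
      exact absurd hn h
  have hsplit := Summable.sum_add_tsum_nat_add' (k := n) (f := fun l : ℕ =>
    lawU (Cycle e P w {v | n < v.length} 0 (l + 1))) ENNReal.summable
  have hzero : ∑ l ∈ Finset.range n, lawU (Cycle e P w {v | n < v.length} 0 (l + 1)) = 0 :=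
    Finset.sum_eq_zero fun l hl => by
      rw [hlen, if_neg (not_lt.2 (Finset.mem_range.1 hl)), measure_empty]
  rw [hzero, zero_add] at hsplit
  rw [cycleLaw, ← hsplit]
  refine tsum_congr fun l => ?_
  rw [hlen, if_pos (by omega), Nat.add_comm l n]

variable [Countable A]

lemma measurable_nextRegeneration (hP : IsKernel P) (s : ℤ) :
    Measurable fun U => nextRegeneration e P w U s :=
  (Measurable.of_discrete (f := fun n : ℕ => s + 1 + (n : ℤ))).comp
    (measurable_sInf_nat fun _ => measurableSet_isRegeneration hP _)

lemma measurable_prevRegeneration (hP : IsKernel P) (s : ℤ) :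
    Measurable fun U => prevRegeneration e P w U s :=
  (Measurable.of_discrete (f := fun n : ℕ => s - 1 - (n : ℤ))).comp
    (measurable_sInf_nat fun _ => measurableSet_isRegeneration hP _)

lemma measurable_regenerationTime (hP : IsKernel P) (i : ℤ) :
    Measurable (regenerationTime e P w i) := by
  rcases i with n | n
  · induction n with
    | zero => exact measurable_prevRegeneration hP 1
    | succ n ih =>
      have : regenerationTime e P w (Int.ofNat (n + 1)) = fun U =>
          nextRegeneration e P w U (regenerationTime e P w (Int.ofNat n) U) :=
        funext fun U => Function.iterate_succ_apply' _ _ _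
      rw [this]
      exact measurable_apply_of_countable (measurable_nextRegeneration hP) ih
  · have key : ∀ n : ℕ, Measurable fun U =>
        (prevRegeneration e P w U)^[n] (prevRegeneration e P w U 1) := by
      intro n
      induction n with
      | zero => exact measurable_prevRegeneration hP 1
      | succ n ih =>
        simp only [Function.iterate_succ_apply']
        exact measurable_apply_of_countable (measurable_prevRegeneration hP) ih
    exact key (n + 1)

/-- With no constraint on the other blocks, `Window` only says that some cycle surrounds the origin,
which is almost sure. -/
lemma tsum_cycle_mul (hP : IsKernel P)
    (hE : (spontaneousSymbols P).Nonempty) (hw : ∀ a ∈ w, a ∈ spontaneousSymbols P)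
    (hsum : Summable fun k : ℕ => 1 - alphaW P w k) :
    (∑' p : ℕ × ℕ, lawU (Cycle e P w Set.univ 0 (p.1 + p.2 + 1))) *
      lawU {U | IsRegeneration e P w U 0} = 1 := by
  have h := lawU_window (e := e) (w := w) hP (fun _ => Set.univ) (fun _ => Set.univ) 0
  simp only [Finset.range_zero, Finset.prod_empty, one_mul] at h
  rw [← h, ← measure_univ (μ := lawU)]
  refine measure_congr ?_
  filter_upwards [ae_isTypical (e := e) hP hE hw hsum] with U hU
  refine propext ⟨fun _ => trivial, fun _ => (hU.mem_window_iff hP _ _ 0).2 ?_⟩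
  simp

/-- A regeneration at `0` is almost surely followed by another. `lawU_forward` with one
unconstrained cycle then multiplies a positive finite number by `cycleLaw` without changing it. -/
lemma cycleLaw_univ (hP : IsKernel P)
    (hE : (spontaneousSymbols P).Nonempty) (hw : ∀ a ∈ w, a ∈ spontaneousSymbols P)
    (hsum : Summable fun k : ℕ => 1 - alphaW P w k) : cycleLaw e P w Set.univ = 1 := by
  have h := lawU_forward (e := e) (w := w) hP (fun _ => Set.univ) 1 0
  have h' : lawU (Forward e P w (fun _ => Set.univ) 1 0) =
      lawU {U | IsRegeneration e P w U 0} := by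
    refine measure_congr ?_
    filter_upwards [ae_isTypical (e := e) hP hE hw hsum] with U hU
    refine propext ?_
    change U ∈ Forward e P w (fun _ => Set.univ) 1 0 ↔ IsRegeneration e P w U 0
    rw [hU.mem_forward_iff hP]
    simp
  rw [h', Finset.prod_range_one] at h
  have hpos := (lawU_isRegeneration_pos (e := e) hP hE hw hsum).ne'
  calc cycleLaw e P w Set.univ
      = cycleLaw e P w Set.univ * lawU {U | IsRegeneration e P w U 0} /
          lawU {U | IsRegeneration e P w U 0} :=
        (ENNReal.mul_div_cancel_right hpos (measure_ne_top _ _)).symm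
    _ = 1 := by rw [← h, ENNReal.div_self hpos (measure_ne_top _ _)]

lemma prod_eq_prod_range_mul {M : Type*} [CommMonoid M] (f : ℤ → M) (S : Finset ℤ) (k : ℕ)
    (h0 : (0 : ℤ) ∉ S) (hk : ∀ i ∈ S, i.natAbs ≤ k) (hf : ∀ i ∉ S, f i = 1) :
    (∏ i ∈ Finset.range k, f (-(i + 1 : ℕ))) * (∏ i ∈ Finset.range k, f (i + 1 : ℕ)) =
      ∏ i ∈ S, f i := by
  classical
  let n : ℕ → ℤ := fun i => -((i + 1 : ℕ) : ℤ)
  let p : ℕ → ℤ := fun i => ((i + 1 : ℕ) : ℤ)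
  have hn : Function.Injective n := fun i j h => by simp only [n] at h; omega
  have hp : Function.Injective p := fun i j h => by simp only [p] at h; omega
  have hdisj : Disjoint ((Finset.range k).image n) ((Finset.range k).image p) := by
    refine Finset.disjoint_left.2 fun i hi hi' => ?_
    obtain ⟨a, -, rfl⟩ := Finset.mem_image.1 hi
    obtain ⟨b, -, hb⟩ := Finset.mem_image.1 hi'
    simp only [n, p] at hb
    omega
  rw [← Finset.prod_image (s := Finset.range k) (f := f) (g := n) hn.injOn,
    ← Finset.prod_image (s := Finset.range k) (f := f) (g := p) hp.injOn,
    ← Finset.prod_union hdisj]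
  refine (Finset.prod_subset (fun i hi => ?_) fun i _ hi => hf i hi).symm
  have h1 := hk i hi
  have h2 : i ≠ 0 := fun h => h0 (h ▸ hi)
  rw [Finset.mem_union, Finset.mem_image, Finset.mem_image]
  rcases lt_or_gt_of_ne h2 with h | h
  · exact Or.inl ⟨i.natAbs - 1, Finset.mem_range.2 (by omega), by simp only [n]; omega⟩
  · exact Or.inr ⟨i.natAbs - 1, Finset.mem_range.2 (by omega), by simp only [p]; omega⟩

/-- Indices outside `S` are left free, which costs a factor one by `cycleLaw_univ`; the event thus
becomes a symmetric `Window`. The index `0` is excluded because its block is singled out by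
containing the origin. -/
lemma lawU_iInter_regenerationBlock (hP : IsKernel P)
    (hE : (spontaneousSymbols P).Nonempty) (hw : ∀ a ∈ w, a ∈ spontaneousSymbols P)
    (hsum : Summable fun k : ℕ => 1 - alphaW P w k) (S : Finset ℤ) (h0 : (0 : ℤ) ∉ S)
    (B : ℤ → Set (List A)) :
    lawU (⋂ i ∈ S, regenerationBlock e P w i ⁻¹' B i) = ∏ i ∈ S, cycleLaw e P w (B i) := by
  classical
  let C : ℤ → Set (List A) := fun i => if i ∈ S then B i else Set.univ
  obtain ⟨k, hk⟩ : ∃ k, ∀ i ∈ S, i.natAbs ≤ k :=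
    ⟨S.sup Int.natAbs, fun i hi => Finset.le_sup (f := Int.natAbs) hi⟩
  have hwin : lawU (⋂ i ∈ S, regenerationBlock e P w i ⁻¹' B i) =
      lawU (Window e P w (fun i => C (-(i + 1 : ℕ))) (fun i => C (i + 1 : ℕ)) k) := by
    refine measure_congr ?_
    filter_upwards [ae_isTypical (e := e) hP hE hw hsum] with U hU
    refine propext (Iff.trans ?_ (hU.mem_window_iff hP _ _ k).symm)
    change U ∈ (⋂ i ∈ S, regenerationBlock e P w i ⁻¹' B i) ↔ _
    simp only [Set.mem_iInter, Set.mem_preimage]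
    constructor
    · intro h
      have h' : ∀ i, regenerationBlock e P w i U ∈ C i := fun i => by
        by_cases hi : i ∈ S
        · simpa only [C, hi, if_true] using h i hi
        · simp [C, hi]
      exact ⟨fun i _ => h' _, fun i _ => h' _⟩
    · rintro ⟨h1, h2⟩ i hi
      have hki := hk i hi
      have hi0 : i ≠ 0 := fun h => h0 (h ▸ hi)
      have hC : C i = B i := by simp [C, hi]
      rw [← hC]
      rcases lt_or_gt_of_ne hi0 with h | h
      · have := h1 (i.natAbs - 1) (by omega)
        rwa [show -((i.natAbs - 1 + 1 : ℕ) : ℤ) = i by omega] at this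
      · have := h2 (i.natAbs - 1) (by omega)
        rwa [show ((i.natAbs - 1 + 1 : ℕ) : ℤ) = i by omega] at this
  rw [hwin, lawU_window hP, tsum_cycle_mul hP hE hw hsum, mul_one,
    prod_eq_prod_range_mul (fun i => cycleLaw e P w (C i)) S k h0 hk fun i hi => ?_]
  · exact Finset.prod_congr rfl fun i hi => by simp [C, hi]
  · simp only [C, hi, if_false]
    exact cycleLaw_univ hP hE hw hsum

lemma lawU_regenerationBlock (hP : IsKernel P)
    (hE : (spontaneousSymbols P).Nonempty) (hw : ∀ a ∈ w, a ∈ spontaneousSymbols P)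
    (hsum : Summable fun k : ℕ => 1 - alphaW P w k) {i : ℤ} (hi : i ≠ 0) (B : Set (List A)) :
    lawU (regenerationBlock e P w i ⁻¹' B) = cycleLaw e P w B := by
  simpa using lawU_iInter_regenerationBlock (e := e) hP hE hw hsum {i} (by simpa using hi.symm)
    fun _ => B

lemma iIndepFun_regenerationBlock (hP : IsKernel P)
    (hE : (spontaneousSymbols P).Nonempty) (hw : ∀ a ∈ w, a ∈ spontaneousSymbols P)
    (hsum : Summable fun k : ℕ => 1 - alphaW P w k) :
    iIndepFun (fun i : {i : ℤ // i ≠ 0} => regenerationBlock e P w (i : ℤ)) lawU := by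
  classical
  refine iIndepFun_iff_measure_inter_preimage_eq_mul.2 fun S B _ => ?_
  let C : ℤ → Set (List A) := fun i => if h : i ≠ 0 then B ⟨i, h⟩ else Set.univ
  have hC : ∀ i : {i : ℤ // i ≠ 0}, C i = B i := fun i => by simp [C, i.2]
  have h := lawU_iInter_regenerationBlock (e := e) hP hE hw hsum
    (S.map (Function.Embedding.subtype _)) (by simp) C
  rw [Finset.prod_map] at h
  simp only [Function.Embedding.subtype_apply, hC] at h
  rw [Finset.prod_congr rfl fun i _ =>
    lawU_regenerationBlock (e := e) hP hE hw hsum i.2 (B i), ← h]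
  congr 1
  ext U
  simp only [Set.mem_iInter, Set.mem_preimage, Finset.mem_map, Function.Embedding.subtype_apply]
  constructor
  · rintro h _ ⟨i, hi, rfl⟩
    rw [hC]; exact h i hi
  · intro h i hi
    have := h i ⟨i, hi, rfl⟩
    rwa [hC] at this

variable [MeasurableSpace A] [DiscreteMeasurableSpace A]

lemma measurable_regenerationBlock (hP : IsKernel P) (i : ℤ) :
    Measurable (regenerationBlock e P w i) := by
  refine measurable_apply_of_countable
    (g := fun U t => block (chain e P w U) (regenerationTime e P w i U) t) (fun t => ?_)
    (measurable_regenerationTime hP (i + 1))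
  refine measurable_apply_of_countable (g := fun U s => block (chain e P w U) s t) (fun s => ?_)
    (measurable_regenerationTime hP i)
  simp only [← reverse_pre_pastAt]
  exact (Measurable.of_discrete (f := List.reverse)).comp
    ((measurable_pre _).comp ((measurable_pastAt t).comp (measurable_chain hP)))

/-! ### The law of the blocks -/

lemma identDistrib_regenerationBlock (hP : IsKernel P)
    (hE : (spontaneousSymbols P).Nonempty) (hw : ∀ a ∈ w, a ∈ spontaneousSymbols P)
    (hsum : Summable fun k : ℕ => 1 - alphaW P w k) {i j : ℤ} (hi : i ≠ 0) (hj : j ≠ 0) :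
    IdentDistrib (regenerationBlock e P w i) (regenerationBlock e P w j) lawU lawU where
  aemeasurable_fst := (measurable_regenerationBlock hP i).aemeasurable
  aemeasurable_snd := (measurable_regenerationBlock hP j).aemeasurable
  map_eq := by
    ext B hB
    rw [Measure.map_apply (measurable_regenerationBlock hP i) hB,
      Measure.map_apply (measurable_regenerationBlock hP j) hB,
      lawU_regenerationBlock hP hE hw hsum hi, lawU_regenerationBlock hP hE hw hsum hj]

/-- The mean is the sum of the probabilities that the length exceeds `n`. It is the double sum in
`tsum_cycle_mul`, whose product with the probability of a regeneration is one, hence finite. -/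
lemma integrable_length_regenerationBlock (hP : IsKernel P)
    (hE : (spontaneousSymbols P).Nonempty) (hw : ∀ a ∈ w, a ∈ spontaneousSymbols P)
    (hsum : Summable fun k : ℕ => 1 - alphaW P w k) {i : ℤ} (hi : i ≠ 0) :
    Integrable (fun U => ((regenerationBlock e P w i U).length : ℝ)) lawU := by
  have hblock := measurable_regenerationBlock (e := e) (w := w) hP i
  have hm : Measurable fun U => ((regenerationBlock e P w i U).length : ℝ) :=
    (Measurable.of_discrete (f := fun v : List A => (v.length : ℝ))).comp hblock
  refine ⟨hm.aestronglyMeasurable, ?_⟩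
  have hset : ∀ n : ℕ, MeasurableSet (regenerationBlock e P w i ⁻¹' {v | n < v.length}) :=
    fun n => hblock (.of_discrete)
  have hsumset : ∀ U, ‖((regenerationBlock e P w i U).length : ℝ)‖ₑ =
      ∑' n : ℕ, (regenerationBlock e P w i ⁻¹' {v | n < v.length}).indicator
        (1 : (ℤ → ℝ) → ℝ≥0∞) U := by
    intro U
    rw [tsum_eq_sum (s := Finset.range (regenerationBlock e P w i U).length)]
    · have h1 : ∀ n ∈ Finset.range (regenerationBlock e P w i U).length,
          (regenerationBlock e P w i ⁻¹' {v | n < v.length}).indicator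
            (1 : (ℤ → ℝ) → ℝ≥0∞) U = 1 :=
        fun n hn => Set.indicator_of_mem
          (show U ∈ regenerationBlock e P w i ⁻¹' {v | n < v.length} from
            Finset.mem_range.1 hn) _
      rw [Finset.sum_congr rfl h1]
      simp [Real.enorm_natCast]
    · intro n hn
      have h2 : U ∉ regenerationBlock e P w i ⁻¹' {v | n < v.length} :=
        fun h => hn (Finset.mem_range.2 h)
      exact Set.indicator_of_notMem h2 _
  rw [HasFiniteIntegral]
  simp_rw [hsumset]
  rw [lintegral_tsum fun n => (measurable_one.indicator (hset n)).aemeasurable]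
  simp_rw [lintegral_indicator_one (hset _), lawU_regenerationBlock hP hE hw hsum hi,
    cycleLaw_lt_length hP]
  rw [← ENNReal.tsum_prod (f := fun n l => lawU (Cycle e P w Set.univ 0 (n + l + 1))), lt_top_iff_ne_top]
  intro htop
  have h1 := tsum_cycle_mul (e := e) hP hE hw hsum
  rw [htop, ENNReal.top_mul (lawU_isRegeneration_pos hP hE hw hsum).ne'] at h1
  exact ENNReal.top_ne_one h1

end RegenerationTimes

end InfiniteMemory

theorem corollary2 {A : Type*} [Countable A] [MeasurableSpace A] [DiscreteMeasurableSpace A]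
    (e : A ↪ ℕ) (P : A → (ℕ → A) → ℝ) (hP : InfiniteMemory.IsKernel P)
    (hE : (InfiniteMemory.spontaneousSymbols P).Nonempty)
    (w : List A) (hw : ∀ a ∈ w, a ∈ InfiniteMemory.spontaneousSymbols P)
    (hsum : Summable fun k : ℕ => 1 - InfiniteMemory.alphaW P w k) :
    ∃ X : (ℤ → ℝ) → ℤ → A, Measurable X ∧
      InfiniteMemory.IsStationaryCompatible P (InfiniteMemory.lawU.map X) ∧
      (∀ ν : Measure (ℤ → A), InfiniteMemory.IsStationaryCompatible P ν →
        ν = InfiniteMemory.lawU.map X) ∧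
      (∀ m n : ℤ, m ≤ n → ∀ᵐ U ∂InfiniteMemory.lawU,
        ∃ θ ≤ m, InfiniteMemory.Outputs e P w U m n θ (X U)) ∧
      ∃ T : ℤ → (ℤ → ℝ) → ℤ,
        (∀ i, Measurable (T i)) ∧
        (∀ᵐ U ∂InfiniteMemory.lawU, (∀ i, T i U < T (i + 1) U) ∧ T 0 U ≤ 0 ∧ 0 < T 1 U) ∧
        iIndepFun (fun (i : {i : ℤ // i ≠ 0}) (U : ℤ → ℝ) =>
          InfiniteMemory.block (X U) (T i U) (T (i + 1) U)) InfiniteMemory.lawU ∧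
        (∀ i j : ℤ, i ≠ 0 → j ≠ 0 →
          IdentDistrib (fun U => InfiniteMemory.block (X U) (T i U) (T (i + 1) U))
            (fun U => InfiniteMemory.block (X U) (T j U) (T (j + 1) U))
            InfiniteMemory.lawU InfiniteMemory.lawU) ∧
        ∀ i : ℤ, i ≠ 0 →
          Integrable (fun U => ((InfiniteMemory.block (X U) (T i U) (T (i + 1) U)).length : ℝ))
            InfiniteMemory.lawU := by
  have : Nonempty A := ⟨hE.some⟩
  have htyp := InfiniteMemory.ae_isTypical (e := e) hP hE hw hsum
  refine ⟨InfiniteMemory.chain e P w, InfiniteMemory.measurable_chain hP,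
    InfiniteMemory.isStationaryCompatible_map_chain hP hE hw hsum,
    fun ν hν => hν.eq_map_chain hP hE hw hsum, fun m n hmn => ?_,
    InfiniteMemory.regenerationTime e P w, InfiniteMemory.measurable_regenerationTime hP, ?_,
    InfiniteMemory.iIndepFun_regenerationBlock hP hE hw hsum,
    fun i j hi hj => InfiniteMemory.identDistrib_regenerationBlock hP hE hw hsum hi hj,
    fun i hi => InfiniteMemory.integrable_length_regenerationBlock hP hE hw hsum hi⟩
  · filter_upwards [htyp] with U hU
    exact hU.outputs hP hmn
  · filter_upwards [htyp] with U hU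
    refine ⟨fun i => ?_, InfiniteMemory.time_zero_le U, hU.time_one_pos⟩
    rw [hU.time_succ]
    exact InfiniteMemory.lt_nextRegeneration U _
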